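/- **Conventions.** $\mathbb{R}^{n+2,2}$ carries the standard form $(\,,)$ of signature $(n+2,2)$; $(a\wedge b)c=(a,c)b-(b,c)a$; $\mathcal{L}$ is the light cone, $\mathcal{Z}$ the set of isotropic $2$-planes; $\mathrm{O}(n+2,2)$ acts by Lie sphere transformations. Everything is $C^\infty$. A smooth map $f:\Sigma\to\mathcal{Z}$ (viewed as a rank $2$ bundle) is a *Legendre map* if $d\sigma\in\Omega^1(f^\perp)$ for all $\sigma\in\Gamma f$ and if $d_X\sigma\in f(x)$ for all $\sigma\in\Gamma f$ forces $X=0$, for $X\in T_x\Sigma$. A *gauge potential* of $f$ is an $\eta\in\Omega^1(f\wedge f^\perp)$ with $d\eta=[\eta\wedge\eta]=0$ whose quadratic differential $(X,Y)\mapsto \mathrm{tr}(f\to f:\sigma\mapsto\eta(X)d_Y\sigma)$ is not identically zero; $f$ is *Lie applicable* if it has one. Let $I_1,I_2\subseteq\mathbb{R}$ be open intervals and $f:I_1\times I_2\to\mathcal{Z}$ a Lie applicable Legendre map into $\mathbb{R}^{4,2}$. Assume that $f$ is umbilic-free and parametrised by curvature line coordinates $(u,v)$, i.e. there are smooth rank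 $1$ subbundles $s_1,s_2\le f$ (the curvature spheres) with $s_1\cap s_2=\{0\}$, $\partial_u\sigma_1\in f(x)$ whenever $\sigma_1\in\Gamma f$, $\sigma_1(x)\in s_1(x)$, and $\partial_v\sigma_2\in f(x)$ whenever $\sigma_2\in\Gamma f$, $\sigma_2(x)\in s_2(x)$; and that $f$ is regular, i.e. $s_1,s_2$ are immersions into $\mathbb{P}(\mathcal{L})$. A family of parameter lines is called *spherical* if, for some $\mathfrak{p}$ with $(\mathfrak{p},\mathfrak{p})=-1$, there is a smooth $\nu:I_1\times I_2\to\mathbb{P}(\mathcal{L})$, constant along these lines, with $\nu\perp f\cap\mathfrak{p}^\perp$, the spheres $\nu$ meeting the point sphere map $f\cap\mathfrak{p}^\perp$ transversally (i.e. $(\nu\oplus\langle\mathfrak{p}\rangle)\cap f=\{0\}$). For a Legendre curve $C:I\to\mathcal{Z}$ in $\mathbb{R}^{3,2}$ and a $3$-dimensional $W_0\le\mathbb{R}^{3,2}$, $C$ is *constrained elastic with respect to $W_0$* if for some gauge potential $\xi$ of $C$ there is a $3$-dimensional space $W$ of linear conserved quantities of $d+t\xi$ with $W(0)=W_0$; a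 linear conserved quantity is $p(t)=p_0+tp_1$ with $p_0,p_1:I\to\mathbb{R}^{3,2}$ smooth, $p_1\in\Gamma C$ and $(d+t\xi)p(t)=0$ for all $t\in\mathbb{R}$. **Theorem.** If the $u$-parameter lines of $f$ are spherical and the $v$-parameter lines are not, then there is a single Legendre curve $C:I_1\to\mathcal{Z}$ in $\mathbb{R}^{3,2}$ such that 1. $C$ is a constrained elastic curve: it is constrained elastic with respect to some $3$-dimensional $W_0$, and it projects to a constrained elastic curve in a space form, i.e. there are $\mathfrak{p},\mathfrak{q}\in W_0$ with $(\mathfrak{p},\mathfrak{p})=\pm1$, $\mathfrak{q}\ne0$, $(\mathfrak{p},\mathfrak{q})=0$ such that the set $D=\{u\in I_1: C(u)\cap\langle\mathfrak{p},\mathfrak{q}\rangle^\perp\neq\{0\}\}$ of parameters where the projection does not exist has no accumulation point in $I_1$, and on $I_1\setminus D$ the point sphere map $\mathfrak{f}\in C$, $(\mathfrak{f},\mathfrak{q})=-1$, $(\mathfrak{f},\mathfrak{p})=0$, and tangent plane congruence $\mathfrak{t}\in C$, $(\mathfrak{t},\mathfrak{p})=-1$, $(\mathfrak{t},\mathfrak{q})=0$,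 are smooth, $\mathfrak{f}$ is a regular spacelike curve, and its curvature $k$, defined by $d\mathfrak{t}=-k\,d\mathfrak{f}$, satisfies $$k''+\chi\tfrac{k^3}{2}+(\mu+\kappa)k+\lambda=0,\qquad \chi=-(\mathfrak{p},\mathfrak{p}),\ \kappa=-(\mathfrak{q},\mathfrak{q}),$$ with constants $\lambda,\mu\in\mathbb{R}$, where $'$ is the derivative with respect to arc length of $\mathfrak{f}$; 2. every $u$-parameter line is a Lie sphere transform of $C$: with the standard inclusion $\iota:\mathbb{R}^{3,2}\to\mathbb{R}^{4,2}$, for each $v\in I_2$ there is $A_v\in\mathrm{O}(4,2)$ with $f(u,v)=A_v\,\iota(C(u))$ for all $u\in I_1$. -/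

import Mathlib

open scoped ContDiff

/-- The coordinate space of `ℝ^{n+2,2}`: `n + 2` positive and two negative directions. -/
abbrev LieSpace (n : ℕ) : Type := (Fin (n + 2) ⊕ Fin 2) → ℝ

/-- The standard symmetric bilinear form of signature `(n+2, 2)`. -/
noncomputable def lieForm (n : ℕ) : LinearMap.BilinForm ℝ (LieSpace n) :=
  Matrix.toBilin' (Matrix.diagonal (Sum.elim (fun _ => (1 : ℝ)) (fun _ => (-1 : ℝ))))

theorem lieForm_apply {n : ℕ} (x y : LieSpace n) :
    lieForm n x y =
      (∑ i, x (Sum.inl i) * y (Sum.inl i)) - ∑ j, x (Sum.inr j) * y (Sum.inr j) := by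
  simp [lieForm, Matrix.toBilin'_apply', Matrix.mulVec_diagonal, dotProduct, sub_eq_add_neg]

/-- Orthogonal complement of a subspace of `ℝ^{n+2,2}`. -/
noncomputable def perp {n : ℕ} (F : Submodule ℝ (LieSpace n)) : Submodule ℝ (LieSpace n) :=
  (lieForm n).orthogonal F

/-- `A` represents a Lie sphere transformation: it belongs to the orthogonal group
`O(n+2, 2)`. -/
def IsLieSphereTransformation {n : ℕ} (A : LieSpace n ≃ₗ[ℝ] LieSpace n) : Prop :=
  ∀ x y, lieForm n (A x) (A y) = lieForm n x y

/-- The standard isometric inclusion `ℝ^{n+2,2} → ℝ^{n+3,2}`, whose image is the orthogonal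
complement of the last spacelike basis vector. -/
noncomputable def lieInclusion (n : ℕ) : LieSpace n →ₗ[ℝ] LieSpace (n + 1) where
  toFun x := Sum.elim
    (fun j => if h : (j : ℕ) < n + 2 then x (Sum.inl ⟨j, h⟩) else 0) (fun j => x (Sum.inr j))
  map_add' x y := by
    ext (j | j)
    · by_cases h : (j : ℕ) < n + 2 <;> simp [h]
    · simp
  map_smul' c x := by
    ext (j | j)
    · by_cases h : (j : ℕ) < n + 2 <;> simp [h]
    · simp

/-- The skew endomorphism `a ∧ b : c ↦ (a, c) b - (b, c) a`. -/
noncomputable def wedge {n : ℕ} (a b : LieSpace n) : LieSpace n →L[ℝ] LieSpace n :=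
  LinearMap.toContinuousLinearMap
    ((lieForm n a).smulRight b - (lieForm n b).smulRight a)

theorem wedge_apply {n : ℕ} (a b c : LieSpace n) :
    wedge a b c = lieForm n a c • b - lieForm n b c • a := by
  simp [wedge]

/-- The space `F ∧ G` spanned by the `a ∧ b` with `a ∈ F` and `b ∈ G`. -/
noncomputable def wedgeSpace {n : ℕ} (F G : Submodule ℝ (LieSpace n)) :
    Submodule ℝ (LieSpace n →L[ℝ] LieSpace n) :=
  Submodule.span ℝ {w | ∃ a ∈ F, ∃ b ∈ G, w = wedge a b}

section Maps

variable {n : ℕ} {E : Type*} [NormedAddCommGroup E] [NormedSpace ℝ E]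

/-- `F` is a smooth rank `k` subbundle of the trivial bundle over the open set `U`. -/
def IsSmoothSubbundle (U : Set E) (k : ℕ) (F : E → Submodule ℝ (LieSpace n)) : Prop :=
  ∀ x ∈ U, Module.finrank ℝ (F x) = k ∧
    ∃ N : Set E, IsOpen N ∧ x ∈ N ∧ ∃ σ : Fin k → E → LieSpace n,
      (∀ i, ContDiffOn ℝ ∞ (σ i) N) ∧
      ∀ y ∈ N ∩ U, F y = Submodule.span ℝ (Set.range fun i => σ i y)

/-- `F` consists of isotropic subspaces over `U`. -/
def IsNullOn (U : Set E) (F : E → Submodule ℝ (LieSpace n)) : Prop :=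
  ∀ x ∈ U, ∀ a ∈ F x, ∀ b ∈ F x, lieForm n a b = 0

/-- Smooth sections of `F` over `U`. -/
def IsSmoothSection (U : Set E) (F : E → Submodule ℝ (LieSpace n)) (σ : E → LieSpace n) : Prop :=
  ContDiffOn ℝ ∞ σ U ∧ ∀ x ∈ U, σ x ∈ F x

/-- `F` is immersed over `U`: if the derivative of every section of `F` in the direction `X` at
`x` lies in `F x`, then `X = 0`. -/
def IsImmersedBundle (U : Set E) (F : E → Submodule ℝ (LieSpace n)) : Prop :=
  ∀ x ∈ U, ∀ X : E, (∀ σ, IsSmoothSection U F σ → fderiv ℝ σ x X ∈ F x) → X = 0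

/-- Legendre maps `f : U → 𝒵` into the Grassmannian of isotropic `2`-planes. -/
structure IsLegendreMap (U : Set E) (f : E → Submodule ℝ (LieSpace n)) : Prop where
  smooth : IsSmoothSubbundle U 2 f
  isotropic : IsNullOn U f
  contact : ∀ σ, IsSmoothSection U f σ → ∀ x ∈ U, ∀ X : E, fderiv ℝ σ x X ∈ perp (f x)
  immersed : IsImmersedBundle U f

/-- `X` belongs to the curvature space at `x` of the subspace `s ≤ f x`. A line `s` is a curvature
sphere of `f` at `x` when this happens for some `X ≠ 0`. -/
def InCurvatureSpace (U : Set E) (f : E → Submodule ℝ (LieSpace n)) (x : E)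
    (s : Submodule ℝ (LieSpace n)) (X : E) : Prop :=
  ∀ σ, IsSmoothSection U f σ → σ x ∈ s → fderiv ℝ σ x X ∈ f x

/-- The quadratic differential `𝒬^η` takes the value `c` on `(X, Y)` at `x`: `c` is the trace of
the endomorphism `σ ↦ η(X) d_Y σ` of `f x`. -/
def HasQuadDiffValue (U : Set E) (f : E → Submodule ℝ (LieSpace n))
    (η : E → E →L[ℝ] LieSpace n →L[ℝ] LieSpace n) (x X Y : E) (c : ℝ) : Prop :=
  ∃ T : f x →ₗ[ℝ] f x,
    (∀ σ, IsSmoothSection U f σ → ∀ a : f x, (a : LieSpace n) = σ x →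
      (T a : LieSpace n) = η x X (fderiv ℝ σ x Y)) ∧
    LinearMap.trace ℝ (f x) T = c

/-- `η` is a gauge potential of `f`: a smooth `1`-form with values in `f ∧ f^⊥` such that
`dη = [η ∧ η] = 0` and whose quadratic differential is not identically zero. -/
structure IsGaugePotential (U : Set E) (f : E → Submodule ℝ (LieSpace n))
    (η : E → E →L[ℝ] LieSpace n →L[ℝ] LieSpace n) : Prop where
  smooth : ContDiffOn ℝ ∞ η U
  values : ∀ x ∈ U, ∀ X : E, η x X ∈ wedgeSpace (f x) (perp (f x))
  closed : ∀ x ∈ U, ∀ X Y : E, fderiv ℝ η x X Y - fderiv ℝ η x Y X = 0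
  commute : ∀ x ∈ U, ∀ X Y : E, (η x X).comp (η x Y) = (η x Y).comp (η x X)
  quadDiff_ne_zero : ∃ x ∈ U, ∃ X Y : E, ∃ c : ℝ, c ≠ 0 ∧ HasQuadDiffValue U f η x X Y c

/-- Lie applicable Legendre maps. -/
def IsLieApplicable (U : Set E) (f : E → Submodule ℝ (LieSpace n)) : Prop :=
  IsLegendreMap U f ∧ ∃ η, IsGaugePotential U f η

/-- The integral lines of the constant vector field `X` are spherical curvature lines of `f`: for
some timelike point sphere complex `p`, the point sphere map `Λ = f ∩ p^⊥` is orthogonal to a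
smooth map `ν` into the Lie quadric which is constant along these lines, and the spheres defined by
`ν` intersect `Λ` transversally. The null lines of `ν x ⊔ ⟨p⟩` are the two orientations of the
sphere `ν x`, so transversality says that neither of them is a contact sphere of `f` at `x`. -/
def HasSphericalLines (U : Set E) (f : E → Submodule ℝ (LieSpace n)) (X : E) : Prop :=
  ∃ p : LieSpace n, lieForm n p p = -1 ∧
    ∃ ν : E → Submodule ℝ (LieSpace n), IsSmoothSubbundle U 1 ν ∧ IsNullOn U ν ∧
      (∀ x ∈ U, ∀ t : ℝ, x + t • X ∈ U → ν (x + t • X) = ν x) ∧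
      (∀ x ∈ U, ∀ a ∈ f x, lieForm n a p = 0 → ∀ b ∈ ν x, lieForm n a b = 0) ∧
      ∀ x ∈ U, Disjoint (f x) (ν x ⊔ Submodule.span ℝ {p})

/-- `p₀ + t p₁` is a linear conserved quantity of the family of connections `d + t ξ`. -/
structure IsLinearConservedQuantity (U : Set E) (C : E → Submodule ℝ (LieSpace n))
    (ξ : E → E →L[ℝ] LieSpace n →L[ℝ] LieSpace n) (p₀ p₁ : E → LieSpace n) : Prop where
  smooth_zero : ContDiffOn ℝ ∞ p₀ U
  smooth_one : ContDiffOn ℝ ∞ p₁ U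
  top_mem : ∀ x ∈ U, p₁ x ∈ C x
  parallel : ∀ t : ℝ, ∀ x ∈ U, ∀ X : E,
    fderiv ℝ (fun y => p₀ y + t • p₁ y) x X + t • ξ x X (p₀ x + t • p₁ x) = 0

end Maps

/-- The Legendre map `f` on `I₁ × I₂ ⊆ ℝ²` is umbilic-free, with curvature sphere congruences
`s₁` and `s₂`, and is parametrised by curvature line coordinates: `∂/∂u` and `∂/∂v` lie in the
curvature spaces of `s₁` and `s₂`. -/
structure IsCurvatureLineParametrisation (U : Set (ℝ × ℝ))
    (f s₁ s₂ : ℝ × ℝ → Submodule ℝ (LieSpace 2)) : Prop where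
  smooth₁ : IsSmoothSubbundle U 1 s₁
  smooth₂ : IsSmoothSubbundle U 1 s₂
  le₁ : ∀ x ∈ U, s₁ x ≤ f x
  le₂ : ∀ x ∈ U, s₂ x ≤ f x
  disjoint : ∀ x ∈ U, Disjoint (s₁ x) (s₂ x)
  curvature₁ : ∀ x ∈ U, InCurvatureSpace U f x (s₁ x) (1, 0)
  curvature₂ : ∀ x ∈ U, InCurvatureSpace U f x (s₂ x) (0, 1)

/-- A Legendre curve `C : I → 𝒵` in `ℝ^{3,2}` is constrained elastic with respect to the
`3`-dimensional subspace `W₀`: for some polarisation `ξ` (on an interval, a gauge potential of `C`)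
there is a `3`-dimensional space `W` of linear conserved quantities of `d + t ξ` with
`W(0) = W₀`. -/
def IsConstrainedElasticWrt (I : Set ℝ) (C : ℝ → Submodule ℝ (LieSpace 1))
    (W₀ : Submodule ℝ (LieSpace 1)) : Prop :=
  Module.finrank ℝ W₀ = 3 ∧ ∃ ξ, IsGaugePotential I C ξ ∧
    ∃ W : Submodule ℝ ((ℝ → LieSpace 1) × (ℝ → LieSpace 1)), Module.finrank ℝ W = 3 ∧
      (∀ P ∈ W, IsLinearConservedQuantity I C ξ P.1 P.2) ∧
      ∀ u ∈ I, W.map ((LinearMap.proj u).comp (LinearMap.fst ℝ _ _)) = W₀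

/-- Derivative of `g` with respect to the arc length of the spacelike curve `γ`. -/
noncomputable def arcDeriv (γ : ℝ → LieSpace 1) (g : ℝ → ℝ) (u : ℝ) : ℝ :=
  (Real.sqrt (lieForm 1 (deriv γ u) (deriv γ u)))⁻¹ * deriv g u

/-- The parameters at which `C` has no projection to the space form of `p, q`, that is, at which
the functionals `(·, p)` and `(·, q)` are linearly dependent on `C u`. -/
def projectionSingularSet (I : Set ℝ) (C : ℝ → Submodule ℝ (LieSpace 1))
    (p q : LieSpace 1) : Set ℝ :=
  {u ∈ I | ¬ Disjoint (C u) (perp (Submodule.span ℝ {p, q}))}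

/-- `C` projects to a constrained elastic curve in the space form `{y ∈ ℒ : (y,q) = -1, (y,p) = 0}`
with point sphere complex `p`, space form vector `q`, `χ = -(p,p) = ±1` and sectional curvature
`κ = -(q,q)`. The parameters without a projection have no accumulation point in `I`; elsewhere the
point sphere map `γ` is a regular spacelike curve with tangent plane congruence `τ` and curvature
`k`, and `k_ss + χ k³ / 2 + (μ + κ) k + λ = 0` for constants `λ, μ`. -/
def ProjectsToConstrainedElastic (I : Set ℝ) (C : ℝ → Submodule ℝ (LieSpace 1))
    (p q : LieSpace 1) : Prop :=
  (lieForm 1 p p = 1 ∨ lieForm 1 p p = -1) ∧ q ≠ 0 ∧ lieForm 1 p q = 0 ∧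
  (∀ u ∈ I, ∃ N ∈ nhds u, N ∩ projectionSingularSet I C p q ⊆ {u}) ∧
  ∃ (γ τ : ℝ → LieSpace 1) (k : ℝ → ℝ) (lam mu : ℝ),
    ContDiffOn ℝ ∞ γ (I \ projectionSingularSet I C p q) ∧
    ContDiffOn ℝ ∞ τ (I \ projectionSingularSet I C p q) ∧
    ContDiffOn ℝ ∞ k (I \ projectionSingularSet I C p q) ∧
    ∀ u ∈ I \ projectionSingularSet I C p q,
      (γ u ∈ C u ∧ lieForm 1 (γ u) q = -1 ∧ lieForm 1 (γ u) p = 0) ∧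
      (τ u ∈ C u ∧ lieForm 1 (τ u) p = -1 ∧ lieForm 1 (τ u) q = 0) ∧
      0 < lieForm 1 (deriv γ u) (deriv γ u) ∧
      deriv τ u = -(k u) • deriv γ u ∧
      arcDeriv γ (arcDeriv γ k) u + (-lieForm 1 p p) * (k u) ^ 3 / 2
        + (mu + -lieForm 1 q q) * k u + lam = 0

/-!
The proof rests on Joachimsthal's theorem. Let `ν` be the spheres and `p` the point sphere complex
for which the `u`-parameter lines are spherical. The Lorentz plane spanned by `ν` and `p` contains
a normal of `f`; as the curvature sphere `s₁` is immersed, its direction is constant along the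
`u`-lines. This gives a unit normal `q(v)` of `f` depending on `v` only (`exists_unit_normal`).

Let `s` be the section of `s₁` with `(s, q') = -1`. Comparing inner products with `f`, `q` and
`∂ᵤ²s` gives `∂ᵥs = q + (s, q'') s` (`IsUnitNormal.exists_normalisedLift`). Up to scale this is
the linear equation `F' = (q ∧ q') F`, whose fundamental solutions `B(v)` are isometries, so
`f(u, v) = B(v) f(u, v₀)` and `B(v) q(v₀) = q(v)` (`IsNormalisedLift.exists_isSweptFrame`). Thus
all `u`-lines are Lie sphere transforms of one Legendre curve in `q(v₀)^⊥ ≅ ℝ^{3,2}`, with lift `c`.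

In the moving frame, closedness of a gauge potential of `f` yields a function `γ(u)` and a constant
`ρ`, not both zero, such that for every `v` the function `μ(u) = (q'(v), B(v) c(u))` satisfies
`2 γ μ''' + 3 γ' μ'' + (γ'' - 2 ρ) μ' = 0` (`IsSweptFrame.exists_polarisation`). This equation says
that `B(v)⁻¹ q'(v)` is the constant term of a linear conserved quantity of the gauge potential
`ξ = (ρ c ∧ c' + γ c' ∧ c'') du` of the curve. If `q'(v₀)`, `q''(v₀)` and `B(v)⁻¹ q'(v)`
were dependent for all `v`, then a spacelike vector depending on `u` only would be normal to `f`,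
and the `v`-lines would be spherical (`IsSweptFrame.exists_ne_of_not_spherical`). So the constant
terms contain a three-dimensional space `W₀` (`IsPolarisedFrame.isConstrainedElasticWrt`).

The third order equation has a quadratic first integral, which is a constant symmetric form
`polForm` on `W₀`. It is nondegenerate because `γ` has no zeros
(`IsPolarisedFrame.coeff_ne_zero_and_wronskian_ne_zero`). Hence the pairings of `W₀` with `c`
trace out a conic: for suitable `p, q, r ∈ W₀` the functions `P = (p, c)`, `Q = (q, c)`,
`R = (r, c)` satisfy `Q² = 2 P R`. Here `p` is isotropic for `polForm`, and it can be chosen with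
`(p, p) ≠ 0` because otherwise `d + t ξ` would, for some `t`, have a three-dimensional isotropic
space of parallel sections, whereas isotropic spaces in `ℝ^{3,2}` are at most planes
(`IsPolarisedFrame.exists_conic_frame`). In the space form defined by `p` and `q` the curvature is
`k = Q / P`, and pairing the structure equation of the curve with the constant vector
`r` is the equation of constrained elastic curves (`arcDeriv_arcDeriv_curvature`).
-/

/-! ### Linear algebra of the Lie form -/

theorem lieForm_comm {n : ℕ} (x y : LieSpace n) : lieForm n x y = lieForm n y x := by
  simp only [lieForm_apply, mul_comm]

theorem lieForm_nondegenerate (n : ℕ) : (lieForm n).Nondegenerate := by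
  unfold lieForm
  apply LinearMap.BilinForm.nondegenerate_toBilin'_of_det_ne_zero'
  rw [Matrix.det_diagonal]
  simp

theorem eq_zero_of_forall_lieForm {n : ℕ} {x : LieSpace n} (h : ∀ y, lieForm n x y = 0) :
    x = 0 :=
  (lieForm_nondegenerate n).1 x h

theorem mem_perp {n : ℕ} {F : Submodule ℝ (LieSpace n)} {x : LieSpace n} :
    x ∈ perp F ↔ ∀ a ∈ F, lieForm n a x = 0 := by
  simp [perp, LinearMap.BilinForm.mem_orthogonal_iff]

theorem finrank_lieSpace (n : ℕ) : Module.finrank ℝ (LieSpace n) = n + 4 := by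
  simp [LieSpace]

theorem finrank_perp {n : ℕ} (F : Submodule ℝ (LieSpace n)) :
    Module.finrank ℝ (perp F) = n + 4 - Module.finrank ℝ F := by
  rw [perp, LinearMap.BilinForm.finrank_orthogonal (lieForm_nondegenerate n), finrank_lieSpace]

/-- The projection of `ℝ^{n+2,2}` to the timelike coordinates. -/
noncomputable def timeProj (n : ℕ) : LieSpace n →ₗ[ℝ] (Fin 2 → ℝ) :=
  LinearMap.funLeft ℝ ℝ Sum.inr

theorem timeProj_eq_zero {n : ℕ} {x : LieSpace n} (h : timeProj n x = 0)
    (h' : lieForm n x x ≤ 0) : x = 0 := by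
  have h2 : ∀ j, x (Sum.inr j) = 0 := fun j => congrFun h j
  rw [lieForm_apply] at h'
  simp only [h2, mul_zero, Finset.sum_const_zero, sub_zero] at h'
  have h3 := (Finset.sum_eq_zero_iff_of_nonneg
    (fun i _ => mul_self_nonneg (x (Sum.inl i)))).1
    (le_antisymm h' (Finset.sum_nonneg fun i _ => mul_self_nonneg _))
  ext (j | j)
  · simpa using h3 j (Finset.mem_univ _)
  · exact h2 j

theorem timeProj_injective_of_isotropic {n : ℕ} {F : Submodule ℝ (LieSpace n)}
    (hF : ∀ a ∈ F, ∀ b ∈ F, lieForm n a b = 0) :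
    Function.Injective ((timeProj n).domRestrict F) := by
  rw [← LinearMap.ker_eq_bot, LinearMap.ker_eq_bot']
  intro a ha
  exact Subtype.ext (timeProj_eq_zero ha (hF a a.2 a a.2).le)

/-- Isotropic subspaces of `ℝ^{n+2,2}` have dimension at most two. -/
theorem finrank_le_two_of_isotropic {n : ℕ} {F : Submodule ℝ (LieSpace n)}
    (hF : ∀ a ∈ F, ∀ b ∈ F, lieForm n a b = 0) : Module.finrank ℝ F ≤ 2 := by
  simpa using LinearMap.finrank_le_finrank_of_injective (timeProj_injective_of_isotropic hF)

/-- The form is positive definite on `F^⊥ / F` when `F` is a maximal isotropic subspace. -/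
theorem mem_of_perp_of_nonpos {n : ℕ} {F : Submodule ℝ (LieSpace n)}
    (hF : ∀ a ∈ F, ∀ b ∈ F, lieForm n a b = 0) (h2 : Module.finrank ℝ F = 2)
    {x : LieSpace n} (hx : ∀ a ∈ F, lieForm n a x = 0) (hxx : lieForm n x x ≤ 0) : x ∈ F := by
  have hs : Function.Surjective ((timeProj n).domRestrict F) :=
    (LinearMap.injective_iff_surjective_of_finrank_eq_finrank (by simp [h2])).1
      (timeProj_injective_of_isotropic hF)
  obtain ⟨a, ha⟩ := hs (timeProj n x)
  have h0 : x - a = 0 := by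
    apply timeProj_eq_zero
    · rw [map_sub, ← ha]
      simp
    · have h3 : lieForm n x a = 0 := by rw [lieForm_comm]; exact hx a a.2
      simpa [hx a a.2, hF a a.2 a a.2, h3] using hxx
  rw [sub_eq_zero.1 h0]
  exact a.2

theorem lieForm_self_pos_of_perp {n : ℕ} {F : Submodule ℝ (LieSpace n)}
    (hF : ∀ a ∈ F, ∀ b ∈ F, lieForm n a b = 0) (h2 : Module.finrank ℝ F = 2)
    {x : LieSpace n} (hx : ∀ a ∈ F, lieForm n a x = 0) (hxF : x ∉ F) : 0 < lieForm n x x := by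
  by_contra h
  exact hxF (mem_of_perp_of_nonpos hF h2 hx (not_lt.1 h))

/-- A vector orthogonal to `n + 2` independent vectors of `F^⊥` lies in the two-plane `F`. -/
theorem mem_of_orthogonal_family {n : ℕ} {F : Submodule ℝ (LieSpace n)}
    (h2 : Module.finrank ℝ F = 2) {w : Fin (n + 2) → LieSpace n} (hw : LinearIndependent ℝ w)
    (hF : ∀ i, ∀ a ∈ F, lieForm n (w i) a = 0) {x : LieSpace n}
    (hx : ∀ i, lieForm n (w i) x = 0) : x ∈ F := by
  have key : ∀ y, (∀ i, lieForm n (w i) y = 0) →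
      y ∈ perp (Submodule.span ℝ (Set.range w)) := by
    intro y hy
    rw [mem_perp]
    intro a ha
    induction ha using Submodule.span_induction with
    | mem a ha => obtain ⟨i, rfl⟩ := ha; exact hy i
    | zero => simp
    | add a b _ _ ha hb => simp [ha, hb]
    | smul c a _ ha => simp [ha]
  have hle : F ≤ perp (Submodule.span ℝ (Set.range w)) := fun a ha =>
    key a fun i => hF i a ha
  have heq : F = perp (Submodule.span ℝ (Set.range w)) := by
    apply Submodule.eq_of_le_of_finrank_eq hle
    rw [finrank_perp, finrank_span_eq_card hw, h2]
    simp
  rw [heq]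
  exact key x hx

theorem isotropic_span_pair {n : ℕ} {a b : LieSpace n} (haa : lieForm n a a = 0)
    (hab : lieForm n a b = 0) (hbb : lieForm n b b = 0) :
    ∀ x ∈ Submodule.span ℝ {a, b}, ∀ y ∈ Submodule.span ℝ {a, b}, lieForm n x y = 0 := by
  intro x hx y hy
  obtain ⟨x₁, x₂, rfl⟩ := Submodule.mem_span_pair.1 hx
  obtain ⟨y₁, y₂, rfl⟩ := Submodule.mem_span_pair.1 hy
  have hba : lieForm n b a = 0 := by rw [lieForm_comm, hab]
  simp [haa, hab, hbb, hba]

theorem finrank_span_pair_eq_two {n : ℕ} {a b : LieSpace n} (h : LinearIndependent ℝ ![a, b]) :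
    Module.finrank ℝ (Submodule.span ℝ {a, b}) = 2 := by
  have := finrank_span_eq_card h
  rwa [Matrix.range_cons_cons_empty, Fintype.card_fin] at this

/-- The form as a continuous bilinear map. -/
noncomputable def lieCLM (n : ℕ) : LieSpace n →L[ℝ] LieSpace n →L[ℝ] ℝ :=
  LinearMap.toContinuousLinearMap
    ((LinearMap.toContinuousLinearMap (𝕜 := ℝ) (E := LieSpace n) (F' := ℝ)).toLinearMap.comp
      (lieForm n))

theorem wedge_eq_smulRight {n : ℕ} (a b : LieSpace n) :
    wedge a b = (lieCLM n a).smulRight b - (lieCLM n b).smulRight a := by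
  ext1 c
  rw [wedge_apply]
  rfl

/-! ### Calculus with the Lie form -/

section Calculus

variable {n : ℕ} {E : Type*} [NormedAddCommGroup E] [NormedSpace ℝ E]

theorem ContDiffOn.lieForm {m : WithTop ℕ∞} {s : Set E} {f g : E → LieSpace n}
    (hf : ContDiffOn ℝ m f s) (hg : ContDiffOn ℝ m g s) :
    ContDiffOn ℝ m (fun x => _root_.lieForm n (f x) (g x)) s :=
  ((lieCLM n).contDiff.comp_contDiffOn hf).clm_apply hg

theorem ContDiffOn.wedge {m : WithTop ℕ∞} {s : Set E} {f g : E → LieSpace n}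
    (hf : ContDiffOn ℝ m f s) (hg : ContDiffOn ℝ m g s) :
    ContDiffOn ℝ m (fun x => _root_.wedge (f x) (g x)) s := by
  simp only [wedge_eq_smulRight]
  exact (((lieCLM n).contDiff.comp_contDiffOn hf).smulRight hg).sub
    (((lieCLM n).contDiff.comp_contDiffOn hg).smulRight hf)

theorem HasDerivAt.lieForm {f g : ℝ → LieSpace n} {f' g' : LieSpace n} {t : ℝ}
    (hf : HasDerivAt f f' t) (hg : HasDerivAt g g' t) :
    HasDerivAt (fun x => _root_.lieForm n (f x) (g x))
      (_root_.lieForm n f' (g t) + _root_.lieForm n (f t) g') t :=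
  ((lieCLM n).hasFDerivAt.comp_hasDerivAt t hf).clm_apply hg

theorem fderiv_lieForm {f g : E → LieSpace n} {x : E} (hf : DifferentiableAt ℝ f x)
    (hg : DifferentiableAt ℝ g x) (X : E) :
    fderiv ℝ (fun y => _root_.lieForm n (f y) (g y)) x X =
      _root_.lieForm n (fderiv ℝ f x X) (g x) + _root_.lieForm n (f x) (fderiv ℝ g x X) := by
  have h := (((lieCLM n).hasFDerivAt.comp x hf.hasFDerivAt).clm_apply hg.hasFDerivAt).fderiv
  have h2 : fderiv ℝ (fun y => _root_.lieForm n (f y) (g y)) x X = _ :=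
    congrArg (fun T : E →L[ℝ] ℝ => T X) h
  rw [h2]
  simp only [add_apply, ContinuousLinearMap.comp_apply,
    ContinuousLinearMap.flip_apply, Function.comp_apply]
  exact add_comm _ _

end Calculus

/-! ### Legendre curves spanned by a null curve and its derivative -/

theorem HasDerivAt.eq_zero_of_eqOn_const {G : Type*} [NormedAddCommGroup G] [NormedSpace ℝ G]
    {I : Set ℝ} (hI : IsOpen I) {F : ℝ → G} {k F' : G} {u : ℝ} (hu : u ∈ I)
    (h : ∀ x ∈ I, F x = k) (hF : HasDerivAt F F' u) : F' = 0 := by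
  have h1 : F =ᶠ[nhds u] fun _ => k := by
    filter_upwards [hI.mem_nhds hu] with x hx using h x hx
  exact (hF.congr_of_eventuallyEq h1.symm).unique (hasDerivAt_const u k)

theorem eq_of_hasDerivAt_zero {G : Type*} [NormedAddCommGroup G] [NormedSpace ℝ G]
    {I : Set ℝ} (hI : I.OrdConnected) {F : ℝ → G} (hF : ∀ u ∈ I, HasDerivAt F 0 u) :
    ∀ x ∈ I, ∀ y ∈ I, F x = F y := by
  intro x hx y hy
  have := hI.convex.norm_image_sub_le_of_norm_hasDerivWithin_le (C := 0)
    (fun u hu => (hF u hu).hasDerivWithinAt) (by simp) hy hx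
  rw [zero_mul, norm_le_zero_iff, sub_eq_zero] at this
  exact this

/-- `c 0` is a null curve over `I` whose iterated derivatives are `c 1`, `c 2`, …; its derivative
is null and its second derivative is spacelike. Such a curve spans, together with its derivative,
a Legendre curve of which it is the curvature sphere congruence. -/
structure IsLegendreFrame {n : ℕ} (I : Set ℝ) (c : ℕ → ℝ → LieSpace n) : Prop where
  isOpen : IsOpen I
  hasDerivAt : ∀ i, ∀ u ∈ I, HasDerivAt (c i) (c (i + 1) u) u
  smooth : ∀ i, ContDiffOn ℝ ∞ (c i) I
  null_zero : ∀ u ∈ I, lieForm n (c 0 u) (c 0 u) = 0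
  null_one : ∀ u ∈ I, lieForm n (c 1 u) (c 1 u) = 0
  pos_two : ∀ u ∈ I, 0 < lieForm n (c 2 u) (c 2 u)

namespace IsLegendreFrame

variable {n : ℕ} {I : Set ℝ} {c : ℕ → ℝ → LieSpace n}

theorem gram_succ (h : IsLegendreFrame I c) {i j : ℕ} {k : ℝ}
    (hk : ∀ u ∈ I, lieForm n (c i u) (c j u) = k) {u : ℝ} (hu : u ∈ I) :
    lieForm n (c (i + 1) u) (c j u) + lieForm n (c i u) (c (j + 1) u) = 0 :=
  ((h.hasDerivAt i u hu).lieForm (h.hasDerivAt j u hu)).eq_zero_of_eqOn_const h.isOpen hu hk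

theorem gram₀₁ (h : IsLegendreFrame I c) {u : ℝ} (hu : u ∈ I) :
    lieForm n (c 0 u) (c 1 u) = 0 := by
  have := h.gram_succ h.null_zero hu
  rw [lieForm_comm (c (0 + 1) u)] at this
  simp only [zero_add] at this
  linarith

theorem gram₀₂ (h : IsLegendreFrame I c) {u : ℝ} (hu : u ∈ I) :
    lieForm n (c 0 u) (c 2 u) = 0 := by
  have := h.gram_succ (fun u hu => h.gram₀₁ hu) hu
  simp only [zero_add, h.null_one u hu] at this
  simpa using this

theorem gram₁₂ (h : IsLegendreFrame I c) {u : ℝ} (hu : u ∈ I) :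
    lieForm n (c 1 u) (c 2 u) = 0 := by
  have := h.gram_succ h.null_one hu
  rw [lieForm_comm (c (1 + 1) u)] at this
  simp only [Nat.reduceAdd] at this
  linarith

theorem gram₀₃ (h : IsLegendreFrame I c) {u : ℝ} (hu : u ∈ I) :
    lieForm n (c 0 u) (c 3 u) = 0 := by
  have := h.gram_succ (fun u hu => h.gram₀₂ hu) hu
  simp only [zero_add, h.gram₁₂ hu, Nat.reduceAdd] at this
  simpa using this

theorem gram₁₃ (h : IsLegendreFrame I c) {u : ℝ} (hu : u ∈ I) :
    lieForm n (c 1 u) (c 3 u) = -lieForm n (c 2 u) (c 2 u) := by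
  have := h.gram_succ (fun u hu => h.gram₁₂ hu) hu
  simp only [Nat.reduceAdd] at this
  linarith

theorem gram₀₄ (h : IsLegendreFrame I c) {u : ℝ} (hu : u ∈ I) :
    lieForm n (c 0 u) (c 4 u) = lieForm n (c 2 u) (c 2 u) := by
  have := h.gram_succ (fun u hu => h.gram₀₃ hu) hu
  simp only [zero_add, Nat.reduceAdd, h.gram₁₃ hu] at this
  linarith

/-- Pairing with the third and fourth derivatives reads off the coefficients in the Legendre
curve. -/
theorem coeff_eq_zero (h : IsLegendreFrame I c) {u : ℝ} (hu : u ∈ I) {x y : ℝ}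
    (h3 : lieForm n (x • c 0 u + y • c 1 u) (c 3 u) = 0)
    (h4 : lieForm n (x • c 0 u + y • c 1 u) (c 4 u) = 0) : x = 0 ∧ y = 0 := by
  have hg := (h.pos_two u hu).ne'
  simp only [map_add, map_smul, LinearMap.add_apply, LinearMap.smul_apply, smul_eq_mul,
    h.gram₀₃ hu, h.gram₁₃ hu, h.gram₀₄ hu] at h3 h4
  have hy : y = 0 := by
    have : y * lieForm n (c 2 u) (c 2 u) = 0 := by linarith
    exact (mul_eq_zero.1 this).resolve_right hg
  subst hy
  have : x * lieForm n (c 2 u) (c 2 u) = 0 := by linarith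
  exact ⟨(mul_eq_zero.1 this).resolve_right hg, rfl⟩

theorem linearIndependent_pair (h : IsLegendreFrame I c) {u : ℝ} (hu : u ∈ I) :
    LinearIndependent ℝ ![c 0 u, c 1 u] := by
  rw [LinearIndependent.pair_iff]
  intro x y hxy
  exact h.coeff_eq_zero hu (by rw [hxy]; simp) (by rw [hxy]; simp)

theorem linearIndependent_triple (h : IsLegendreFrame I c) {u : ℝ} (hu : u ∈ I) :
    LinearIndependent ℝ ![c 0 u, c 1 u, c 2 u] := by
  rw [Fintype.linearIndependent_iff]
  intro t ht
  simp only [Fin.sum_univ_three, Matrix.cons_val_zero, Matrix.cons_val_one,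
    Matrix.cons_val] at ht
  have h2 : t 2 = 0 := by
    have := congrArg (fun z => lieForm n z (c 2 u)) ht
    simpa [h.gram₀₂ hu, h.gram₁₂ hu, (h.pos_two u hu).ne'] using this
  rw [h2, zero_smul, add_zero] at ht
  have := h.coeff_eq_zero hu (by rw [ht]; simp) (by rw [ht]; simp)
  intro i
  fin_cases i
  · exact this.1
  · exact this.2
  · exact h2

theorem isotropic_span (h : IsLegendreFrame I c) {u : ℝ} (hu : u ∈ I) :
    ∀ x ∈ Submodule.span ℝ {c 0 u, c 1 u}, ∀ y ∈ Submodule.span ℝ {c 0 u, c 1 u},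
      lieForm n x y = 0 :=
  isotropic_span_pair (h.null_zero u hu) (h.gram₀₁ hu) (h.null_one u hu)

theorem finrank_span (h : IsLegendreFrame I c) {u : ℝ} (hu : u ∈ I) :
    Module.finrank ℝ (Submodule.span ℝ {c 0 u, c 1 u}) = 2 :=
  finrank_span_pair_eq_two (h.linearIndependent_pair hu)

theorem perp_of_pair {u : ℝ} {x : LieSpace n} (h0 : lieForm n (c 0 u) x = 0)
    (h1 : lieForm n (c 1 u) x = 0) :
    ∀ a ∈ Submodule.span ℝ {c 0 u, c 1 u}, lieForm n a x = 0 := by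
  intro a ha
  obtain ⟨s, t, rfl⟩ := Submodule.mem_span_pair.1 ha
  simp [h0, h1]

theorem two_mem_perp (h : IsLegendreFrame I c) {u : ℝ} (hu : u ∈ I) :
    c 2 u ∈ perp (Submodule.span ℝ {c 0 u, c 1 u}) :=
  mem_perp.2 (perp_of_pair (h.gram₀₂ hu) (h.gram₁₂ hu))

theorem two_notMem_span (h : IsLegendreFrame I c) {u : ℝ} (hu : u ∈ I) :
    c 2 u ∉ Submodule.span ℝ {c 0 u, c 1 u} := fun hc =>
  (h.pos_two u hu).ne' (h.isotropic_span hu _ hc _ hc)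

theorem isLegendreMap (h : IsLegendreFrame I c) :
    IsLegendreMap I fun u => Submodule.span ℝ {c 0 u, c 1 u} where
  smooth u hu := by
    refine ⟨h.finrank_span hu, I, h.isOpen, hu, ![c 0, c 1], ?_, ?_⟩
    · intro i
      fin_cases i
      · exact h.smooth 0
      · exact h.smooth 1
    · intro y _
      have : (fun i => (![c 0, c 1] : Fin 2 → ℝ → LieSpace n) i y) = ![c 0 y, c 1 y] := by
        ext1 i; fin_cases i <;> rfl
      rw [this, Matrix.range_cons_cons_empty]
  isotropic u hu := h.isotropic_span hu
  contact σ hσ u hu X := by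
    have hd : HasDerivAt σ (deriv σ u) u :=
      ((hσ.1.contDiffAt (h.isOpen.mem_nhds hu)).differentiableAt (by simp)).hasDerivAt
    have key : ∀ i, (∀ x ∈ I, lieForm n (c i x) (σ x) = 0) →
        lieForm n (c (i + 1) u) (σ u) = 0 → lieForm n (c i u) (deriv σ u) = 0 := by
      intro i hi h1
      have := ((h.hasDerivAt i u hu).lieForm hd).eq_zero_of_eqOn_const h.isOpen hu hi
      rwa [h1, zero_add] at this
    have h0 : ∀ x ∈ I, lieForm n (c 0 x) (σ x) = 0 := fun x hx =>
      h.isotropic_span hx _ (Submodule.subset_span (by simp)) _ (hσ.2 x hx)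
    have h1 : ∀ x ∈ I, lieForm n (c 1 x) (σ x) = 0 := fun x hx =>
      h.isotropic_span hx _ (Submodule.subset_span (by simp)) _ (hσ.2 x hx)
    have h2 : lieForm n (c 2 u) (σ u) = 0 := by
      rw [lieForm_comm]
      exact mem_perp.1 (h.two_mem_perp hu) _ (hσ.2 u hu)
    rw [fderiv_eq_smul_deriv]
    exact Submodule.smul_mem _ _ (mem_perp.2
      (perp_of_pair (key 0 h0 (h1 u hu)) (key 1 h1 h2)))
  immersed u hu X hX := by
    have h1 := hX (c 1) ⟨h.smooth 1, fun x _ => Submodule.subset_span (by simp)⟩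
    rw [fderiv_eq_smul_deriv, (h.hasDerivAt 1 u hu).deriv] at h1
    by_contra hne
    exact h.two_notMem_span hu ((Submodule.smul_mem_iff _ hne).1 h1)

theorem hasDerivAt_lieForm (h : IsLegendreFrame I c) (m : LieSpace n) (i : ℕ) {u : ℝ}
    (hu : u ∈ I) : HasDerivAt (fun x => lieForm n m (c i x)) (lieForm n m (c (i + 1) u)) u := by
  simpa using (hasDerivAt_const u m).lieForm (h.hasDerivAt i u hu)

end IsLegendreFrame

namespace IsLegendreFrame

variable {I : Set ℝ} {c : ℕ → ℝ → LieSpace 1}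

theorem mem_span_of_perp (h : IsLegendreFrame I c) {u : ℝ} (hu : u ∈ I) {x : LieSpace 1}
    (h0 : lieForm 1 (c 0 u) x = 0) (h1 : lieForm 1 (c 1 u) x = 0)
    (h2 : lieForm 1 (c 2 u) x = 0) : x ∈ Submodule.span ℝ {c 0 u, c 1 u} := by
  apply mem_of_orthogonal_family (h.finrank_span hu) (h.linearIndependent_triple hu)
  · intro i a ha
    fin_cases i
    · exact h.isotropic_span hu _ (Submodule.subset_span (by simp)) _ ha
    · exact h.isotropic_span hu _ (Submodule.subset_span (by simp)) _ ha
    · rw [lieForm_comm]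
      exact mem_perp.1 (h.two_mem_perp hu) a ha
  · intro i
    fin_cases i
    · exact h0
    · exact h1
    · exact h2

/-- The curve is full: no nonzero constant vector is orthogonal to it along an open set. -/
theorem eq_zero_of_orthogonal (h : IsLegendreFrame I c) {J : Set ℝ} (hJ : IsOpen J)
    (hJI : J ⊆ I) {u : ℝ} (hu : u ∈ J) {k : LieSpace 1}
    (hk : ∀ x ∈ J, lieForm 1 k (c 0 x) = 0) : k = 0 := by
  have key : ∀ i, ∀ x ∈ J, lieForm 1 k (c i x) = 0 := by
    intro i
    induction i with
    | zero => exact hk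
    | succ i ih =>
      intro x hx
      have := ((hasDerivAt_const x k).lieForm (h.hasDerivAt i x (hJI hx))).eq_zero_of_eqOn_const
        hJ hx ih
      simpa using this
  have huI := hJI hu
  have hmem := h.mem_span_of_perp huI (x := k) (by rw [lieForm_comm]; exact key 0 u hu)
    (by rw [lieForm_comm]; exact key 1 u hu) (by rw [lieForm_comm]; exact key 2 u hu)
  obtain ⟨x, y, rfl⟩ := Submodule.mem_span_pair.1 hmem
  obtain ⟨hx, hy⟩ := h.coeff_eq_zero huI (key 3 u hu) (key 4 u hu)
  simp [hx, hy]

end IsLegendreFrame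

/-! ### Polarised curves and their linear conserved quantities -/

theorem trace_eq_add_of_pair {n : ℕ} {F : Submodule ℝ (LieSpace n)} {a b : LieSpace n}
    (hF : F = Submodule.span ℝ {a, b}) (hab : LinearIndependent ℝ ![a, b]) (T : F →ₗ[ℝ] F)
    (ha : a ∈ F) (hb : b ∈ F) {x y z w : ℝ} (hTa : (T ⟨a, ha⟩ : LieSpace n) = x • a + y • b)
    (hTb : (T ⟨b, hb⟩ : LieSpace n) = z • a + w • b) : LinearMap.trace ℝ F T = x + w := by
  have hli : LinearIndependent ℝ ![(⟨a, ha⟩ : F), ⟨b, hb⟩] := by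
    rw [LinearIndependent.pair_iff] at hab ⊢
    intro s t hst
    exact hab s t (congrArg Subtype.val hst)
  have hcard : Fintype.card (Fin 2) = Module.finrank ℝ F := by
    rw [hF, finrank_span_pair_eq_two hab, Fintype.card_fin]
  set B := basisOfLinearIndependentOfCardEqFinrank hli hcard with hB
  have hB0 : B 0 = ⟨a, ha⟩ := by simp [hB]
  have hB1 : B 1 = ⟨b, hb⟩ := by simp [hB]
  have h0 : T (B 0) = x • B 0 + y • B 1 := by
    rw [hB0, hB1]; exact Subtype.ext hTa
  have h1 : T (B 1) = z • B 0 + w • B 1 := by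
    rw [hB0, hB1]; exact Subtype.ext hTb
  rw [LinearMap.trace_eq_matrix_trace ℝ B, Matrix.trace_fin_two, LinearMap.toMatrix_apply,
    LinearMap.toMatrix_apply, h0, h1]
  simp

/-- A Legendre frame `c` with a polarisation: the vectors of `W` are the constant terms of linear
conserved quantities of the connections `d + t (ρ c ∧ c' + γ c' ∧ c'') du`. Here `γ 0`, `γ 1`, …
are the iterated derivatives of `γ`. -/
structure IsPolarisedFrame (I : Set ℝ) (c : ℕ → ℝ → LieSpace 1) (γ : ℕ → ℝ → ℝ) (ρ : ℝ)
    (W : Submodule ℝ (LieSpace 1)) : Prop extends IsLegendreFrame I c where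
  ordConnected : I.OrdConnected
  hasDerivAt_coeff : ∀ i, ∀ u ∈ I, HasDerivAt (γ i) (γ (i + 1) u) u
  smooth_coeff : ∀ i, ContDiffOn ℝ ∞ (γ i) I
  ode : ∀ m ∈ W, ∀ u ∈ I, 2 * γ 0 u * lieForm 1 m (c 3 u) + 3 * γ 1 u * lieForm 1 m (c 2 u)
    + (γ 2 u - 2 * ρ) * lieForm 1 m (c 1 u) = 0

/-- The gauge potential `(ρ c ∧ c' + γ c' ∧ c'') du`. -/
noncomputable def polPotential (c : ℕ → ℝ → LieSpace 1) (γ : ℕ → ℝ → ℝ) (ρ : ℝ) (u : ℝ) :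
    ℝ →L[ℝ] LieSpace 1 →L[ℝ] LieSpace 1 :=
  ContinuousLinearMap.toSpanSingleton ℝ
    (ρ • wedge (c 0 u) (c 1 u) + γ 0 u • wedge (c 1 u) (c 2 u))

/-- The top term of the linear conserved quantity with constant term `m`. -/
noncomputable def polTop (c : ℕ → ℝ → LieSpace 1) (γ : ℕ → ℝ → ℝ) (ρ : ℝ) (m : LieSpace 1)
    (u : ℝ) : LieSpace 1 :=
  -((ρ * lieForm 1 m (c 0 u) - 2 * γ 0 u * lieForm 1 m (c 2 u)
      - γ 1 u * lieForm 1 m (c 1 u)) • c 0 u + (γ 0 u * lieForm 1 m (c 1 u)) • c 1 u)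

/-- The symmetric form `m, m' ↦ -½ ((m₁, m') + (m, m'₁))` on constant terms of linear conserved
quantities, `m₁` denoting the top term belonging to `m`. -/
noncomputable def polForm (c : ℕ → ℝ → LieSpace 1) (γ : ℕ → ℝ → ℝ) (ρ : ℝ) (m m' : LieSpace 1)
    (u : ℝ) : ℝ :=
  ρ * (lieForm 1 m (c 0 u) * lieForm 1 m' (c 0 u))
    - γ 0 u * (lieForm 1 m (c 2 u) * lieForm 1 m' (c 0 u)
      + lieForm 1 m (c 0 u) * lieForm 1 m' (c 2 u))
    - γ 1 u / 2 * (lieForm 1 m (c 1 u) * lieForm 1 m' (c 0 u)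
      + lieForm 1 m (c 0 u) * lieForm 1 m' (c 1 u))
    + γ 0 u * (lieForm 1 m (c 1 u) * lieForm 1 m' (c 1 u))

theorem polPotential_apply (c : ℕ → ℝ → LieSpace 1) (γ : ℕ → ℝ → ℝ) (ρ : ℝ) (u X : ℝ)
    (z : LieSpace 1) :
    polPotential c γ ρ u X z = X • (ρ • (lieForm 1 (c 0 u) z • c 1 u - lieForm 1 (c 1 u) z • c 0 u)
      + γ 0 u • (lieForm 1 (c 1 u) z • c 2 u - lieForm 1 (c 2 u) z • c 1 u)) := by
  simp [polPotential, ContinuousLinearMap.toSpanSingleton_apply, wedge_apply]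

theorem lieForm_polTop_add (c : ℕ → ℝ → LieSpace 1) (γ : ℕ → ℝ → ℝ) (ρ : ℝ) (m m' : LieSpace 1)
    (u : ℝ) : lieForm 1 (polTop c γ ρ m u) m' + lieForm 1 m (polTop c γ ρ m' u) =
      -2 * polForm c γ ρ m m' u := by
  simp only [polTop, polForm, map_neg, map_add, map_smul, LinearMap.neg_apply,
    LinearMap.add_apply, LinearMap.smul_apply, smul_eq_mul, lieForm_comm (c 0 u) m',
    lieForm_comm (c 1 u) m']
  ring

namespace IsPolarisedFrame

variable {I : Set ℝ} {c : ℕ → ℝ → LieSpace 1} {γ : ℕ → ℝ → ℝ} {ρ : ℝ}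
  {W : Submodule ℝ (LieSpace 1)}

theorem hasDerivAt_polTop (h : IsPolarisedFrame I c γ ρ W) {m : LieSpace 1} (hm : m ∈ W) {u : ℝ}
    (hu : u ∈ I) : HasDerivAt (polTop c γ ρ m) (-polPotential c γ ρ u 1 m) u := by
  have H : HasDerivAt (polTop c γ ρ m) _ u :=
    ((((((h.hasDerivAt_lieForm m 0 hu).const_mul ρ).sub
      (((h.hasDerivAt_coeff 0 u hu).const_mul 2).mul (h.hasDerivAt_lieForm m 2 hu))).sub
      ((h.hasDerivAt_coeff 1 u hu).mul (h.hasDerivAt_lieForm m 1 hu))).smul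
      (h.hasDerivAt 0 u hu)).add
      (((h.hasDerivAt_coeff 0 u hu).mul (h.hasDerivAt_lieForm m 1 hu)).smul
        (h.hasDerivAt 1 u hu))).neg
  refine H.congr_deriv ?_
  have hode := h.ode m hm u hu
  rw [polPotential_apply]
  simp only [lieForm_comm _ m, zero_add, Nat.reduceAdd, Pi.mul_apply, Pi.sub_apply]
  have e : 2 * γ 0 u * lieForm 1 m (c 3 u) = -(3 * γ 1 u * lieForm 1 m (c 2 u)
    + (γ 2 u - 2 * ρ) * lieForm 1 m (c 1 u)) := by linarith
  rw [e]
  module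

/-- `polForm` is a first integral of the third order equation. -/
theorem hasDerivAt_polForm (h : IsPolarisedFrame I c γ ρ W) {m m' : LieSpace 1} (hm : m ∈ W)
    (hm' : m' ∈ W) {u : ℝ} (hu : u ∈ I) : HasDerivAt (polForm c γ ρ m m') 0 u := by
  have d := fun m i => h.hasDerivAt_lieForm m i hu
  have H : HasDerivAt (polForm c γ ρ m m') _ u :=
    (((((d m 0).mul (d m' 0)).const_mul ρ).sub
      ((h.hasDerivAt_coeff 0 u hu).mul (((d m 2).mul (d m' 0)).add ((d m 0).mul (d m' 2))))).sub
      (((h.hasDerivAt_coeff 1 u hu).div_const 2).mul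
        (((d m 1).mul (d m' 0)).add ((d m 0).mul (d m' 1))))).add
      ((h.hasDerivAt_coeff 0 u hu).mul ((d m 1).mul (d m' 1)))
  refine H.congr_deriv ?_
  have e := h.ode m hm u hu
  have e' := h.ode m' hm' u hu
  simp only [zero_add, Nat.reduceAdd, Pi.mul_apply, Pi.add_apply]
  linear_combination (-1 / 2 * lieForm 1 m' (c 0 u)) * e + (-1 / 2 * lieForm 1 m (c 0 u)) * e'

theorem polForm_eq (h : IsPolarisedFrame I c γ ρ W) {m m' : LieSpace 1} (hm : m ∈ W)
    (hm' : m' ∈ W) {u v : ℝ} (hu : u ∈ I) (hv : v ∈ I) :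
    polForm c γ ρ m m' u = polForm c γ ρ m m' v :=
  eq_of_hasDerivAt_zero h.ordConnected (fun _ hx => h.hasDerivAt_polForm hm hm' hx) u hu v hv

theorem isGaugePotential (h : IsPolarisedFrame I c γ ρ W) {u₀ : ℝ} (hu₀ : u₀ ∈ I)
    (hγ : γ 0 u₀ ≠ 0) :
    IsGaugePotential I (fun u => Submodule.span ℝ {c 0 u, c 1 u}) (polPotential c γ ρ) where
  smooth := by
    have h1 : ContDiffOn ℝ ∞ (fun u => ρ • wedge (c 0 u) (c 1 u)
        + γ 0 u • wedge (c 1 u) (c 2 u)) I :=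
      (((h.smooth 0).wedge (h.smooth 1)).const_smul ρ).add
        ((h.smooth_coeff 0).smul ((h.smooth 1).wedge (h.smooth 2)))
    exact (contDiffOn_const (c := (1 : ℝ →L[ℝ] ℝ))).smulRight h1
  values u hu X := by
    have hm : ∀ x, x ∈ Submodule.span ℝ {c 0 u, c 1 u} →
        x ∈ perp (Submodule.span ℝ {c 0 u, c 1 u}) := fun x hx =>
      mem_perp.2 fun a ha => h.isotropic_span hu a ha x hx
    have h0 : c 0 u ∈ Submodule.span ℝ {c 0 u, c 1 u} := Submodule.subset_span (by simp)
    have h1 : c 1 u ∈ Submodule.span ℝ {c 0 u, c 1 u} := Submodule.subset_span (by simp)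
    exact Submodule.smul_mem _ _ (Submodule.add_mem _
      (Submodule.smul_mem _ _ (Submodule.subset_span ⟨_, h0, _, hm _ h1, rfl⟩))
      (Submodule.smul_mem _ _ (Submodule.subset_span ⟨_, h1, _, h.two_mem_perp hu, rfl⟩)))
  closed u hu X Y := by
    have key : ∀ X Y : ℝ, fderiv ℝ (polPotential c γ ρ) u X Y =
        (X * Y) • fderiv ℝ (polPotential c γ ρ) u 1 1 := fun X Y => by
      rw [← mul_one X, ← mul_one Y, ← smul_eq_mul, ← smul_eq_mul, map_smul, map_smul]
      simp [smul_smul, mul_comm]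
    rw [key X Y, key Y X, mul_comm, sub_self]
  commute u hu X Y := by
    ext1 z
    have : ∀ X : ℝ, polPotential c γ ρ u X = X • polPotential c γ ρ u 1 := fun X => by
      rw [← map_smul, smul_eq_mul, mul_one]
    rw [this X, this Y]
    simp only [ContinuousLinearMap.comp_apply, smul_apply, map_smul]
    exact smul_comm _ _ _
  quadDiff_ne_zero := by
    have hmem : c 1 u₀ ∈ Submodule.span ℝ {c 0 u₀, c 1 u₀} := Submodule.subset_span (by simp)
    have hmem0 : c 0 u₀ ∈ Submodule.span ℝ {c 0 u₀, c 1 u₀} := Submodule.subset_span (by simp)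
    have hg := (h.pos_two u₀ hu₀).ne'
    -- As `(c'', σ') = -(c''', σ)` for sections `σ`, the endomorphism is `σ ↦ γ (c''', σ) c'`.
    refine ⟨u₀, hu₀, 1, 1, -(γ 0 u₀ * lieForm 1 (c 2 u₀) (c 2 u₀)),
      neg_ne_zero.2 (mul_ne_zero hγ hg),
      (((γ 0 u₀ • lieForm 1 (c 3 u₀)).comp (Submodule.subtype _)).smulRight ⟨c 1 u₀, hmem⟩),
      ?_, ?_⟩
    · intro σ hσ a ha
      have hd : HasDerivAt σ (deriv σ u₀) u₀ :=
        ((hσ.1.contDiffAt (h.isOpen.mem_nhds hu₀)).differentiableAt (by simp)).hasDerivAt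
      have hp := h.isLegendreMap.contact σ hσ u₀ hu₀ 1
      rw [fderiv_eq_smul_deriv, one_smul] at hp ⊢
      have h2 := ((h.hasDerivAt 2 u₀ hu₀).lieForm hd).eq_zero_of_eqOn_const h.isOpen hu₀
        (fun x hx => by
          rw [lieForm_comm]
          exact mem_perp.1 (h.two_mem_perp hx) _ (hσ.2 x hx))
      rw [polPotential_apply, mem_perp.1 hp _ hmem, mem_perp.1 hp _ hmem0]
      simp only [LinearMap.smulRight_apply, LinearMap.comp_apply, Submodule.subtype_apply,
        LinearMap.smul_apply, Submodule.coe_smul, smul_eq_mul, ha]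
      have e : lieForm 1 (c 2 u₀) (deriv σ u₀) = -lieForm 1 (c 3 u₀) (σ u₀) := by linarith
      rw [e]
      module
    · rw [trace_eq_add_of_pair rfl (h.linearIndependent_pair hu₀) _ hmem0 hmem
        (x := 0) (y := 0) (z := 0) (w := -(γ 0 u₀ * lieForm 1 (c 2 u₀) (c 2 u₀)))]
      · simp
      · simp [lieForm_comm (c 3 u₀), h.gram₀₃ hu₀]
      · simp [lieForm_comm (c 3 u₀), h.gram₁₃ hu₀]

theorem isLinearConservedQuantity (h : IsPolarisedFrame I c γ ρ W) {m : LieSpace 1} (hm : m ∈ W) :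
    IsLinearConservedQuantity I (fun u => Submodule.span ℝ {c 0 u, c 1 u}) (polPotential c γ ρ)
      (fun _ => m) (polTop c γ ρ m) where
  smooth_zero := contDiffOn_const
  smooth_one := by
    have d := fun i => (contDiffOn_const (c := m)).lieForm (h.smooth i)
    exact ((((contDiffOn_const.mul (d 0)).sub
      ((contDiffOn_const.mul (h.smooth_coeff 0)).mul (d 2))).sub
      ((h.smooth_coeff 1).mul (d 1))).smul (h.smooth 0)).add
      (((h.smooth_coeff 0).mul (d 1)).smul (h.smooth 1)) |>.neg
  top_mem u hu := Submodule.neg_mem _ (Submodule.mem_span_pair.2 ⟨_, _, rfl⟩)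
  parallel t u hu X := by
    have H : HasDerivAt (fun y => m + t • polTop c γ ρ m y) (t • -polPotential c γ ρ u 1 m) u :=
      ((h.hasDerivAt_polTop hm hu).const_smul t).const_add m
    have htop : polPotential c γ ρ u X (polTop c γ ρ m u) = 0 := by
      rw [polPotential_apply]
      simp [polTop, h.null_zero u hu, h.gram₀₁ hu, h.null_one u hu, lieForm_comm (c 1 u) (c 0 u),
        lieForm_comm (c 2 u) (c 0 u), lieForm_comm (c 2 u) (c 1 u), h.gram₀₂ hu, h.gram₁₂ hu]
    have hX : polPotential c γ ρ u X = X • polPotential c γ ρ u 1 := by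
      rw [← map_smul, smul_eq_mul, mul_one]
    rw [fderiv_eq_smul_deriv, H.deriv, map_add, map_smul, htop, hX]
    simp only [smul_apply]
    module

theorem isConstrainedElasticWrt (h : IsPolarisedFrame I c γ ρ W)
    (hW : Module.finrank ℝ W = 3) {u₀ : ℝ} (hu₀ : u₀ ∈ I) (hγ : γ 0 u₀ ≠ 0) :
    IsConstrainedElasticWrt I (fun u => Submodule.span ℝ {c 0 u, c 1 u}) W := by
  let Q : LieSpace 1 →ₗ[ℝ] ((ℝ → LieSpace 1) × (ℝ → LieSpace 1)) :=
    { toFun := fun m => (fun _ => m, polTop c γ ρ m)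
      map_add' := fun m m' => by
        refine Prod.ext (by ext1; rfl) (funext fun u => ?_)
        simp only [polTop, Prod.snd_add, Pi.add_apply, map_add, LinearMap.add_apply]
        module
      map_smul' := fun t m => by
        refine Prod.ext (by ext1; rfl) (funext fun u => ?_)
        simp only [polTop, Prod.smul_snd, Pi.smul_apply, map_smul, LinearMap.smul_apply,
          smul_eq_mul, RingHom.id_apply]
        module }
  have hQ : Function.Injective Q := fun m m' hmm =>
    congrFun (congrArg Prod.fst hmm) 0
  refine ⟨hW, polPotential c γ ρ, h.isGaugePotential hu₀ hγ, W.map Q, ?_, ?_, ?_⟩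
  · rw [(Submodule.equivMapOfInjective Q hQ W).symm.finrank_eq, hW]
  · rintro _ ⟨m, hm, rfl⟩
    exact h.isLinearConservedQuantity hm
  · intro u hu
    rw [← Submodule.map_comp]
    have : ((LinearMap.proj u).comp (LinearMap.fst ℝ (ℝ → LieSpace 1) (ℝ → LieSpace 1))).comp Q
        = LinearMap.id := rfl
    rw [this, Submodule.map_id]

end IsPolarisedFrame

/-! ### Nondegeneracy of the polarisation -/

/-- The determinant of the two-jets at `u` of the pairings of `x`, `y`, `z` with the curve. -/
noncomputable def jetDet (c : ℕ → ℝ → LieSpace 1) (x y z : LieSpace 1) (u : ℝ) : ℝ :=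
  (lieForm 1 y (c 0 u) * lieForm 1 z (c 1 u) - lieForm 1 z (c 0 u) * lieForm 1 y (c 1 u))
      * lieForm 1 x (c 2 u)
    + (lieForm 1 z (c 0 u) * lieForm 1 x (c 1 u) - lieForm 1 x (c 0 u) * lieForm 1 z (c 1 u))
      * lieForm 1 y (c 2 u)
    + (lieForm 1 x (c 0 u) * lieForm 1 y (c 1 u) - lieForm 1 y (c 0 u) * lieForm 1 x (c 1 u))
      * lieForm 1 z (c 2 u)

theorem eq_zero_of_jetDet_ne_zero {c : ℕ → ℝ → LieSpace 1} {x y z : LieSpace 1} {u : ℝ}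
    (h : jetDet c x y z u ≠ 0) {a b d : ℝ}
    (h0 : lieForm 1 (a • x + b • y + d • z) (c 0 u) = 0)
    (h1 : lieForm 1 (a • x + b • y + d • z) (c 1 u) = 0)
    (h2 : lieForm 1 (a • x + b • y + d • z) (c 2 u) = 0) : a = 0 ∧ b = 0 ∧ d = 0 := by
  simp only [map_add, map_smul, LinearMap.add_apply, LinearMap.smul_apply, smul_eq_mul] at h0 h1 h2
  unfold jetDet at h
  set X0 := lieForm 1 x (c 0 u)
  set X1 := lieForm 1 x (c 1 u)
  set X2 := lieForm 1 x (c 2 u)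
  set Y0 := lieForm 1 y (c 0 u)
  set Y1 := lieForm 1 y (c 1 u)
  set Y2 := lieForm 1 y (c 2 u)
  set Z0 := lieForm 1 z (c 0 u)
  set Z1 := lieForm 1 z (c 1 u)
  set Z2 := lieForm 1 z (c 2 u)
  refine ⟨?_, ?_, ?_⟩
  · refine (mul_eq_zero.1 (?_ : a * _ = 0)).resolve_right h
    linear_combination (Y1 * Z2 - Z1 * Y2) * h0 + (Z0 * Y2 - Y0 * Z2) * h1
      + (Y0 * Z1 - Z0 * Y1) * h2
  · refine (mul_eq_zero.1 (?_ : b * _ = 0)).resolve_right h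
    linear_combination (Z1 * X2 - X1 * Z2) * h0 + (X0 * Z2 - Z0 * X2) * h1
      + (Z0 * X1 - X0 * Z1) * h2
  · refine (mul_eq_zero.1 (?_ : d * _ = 0)).resolve_right h
    linear_combination (X1 * Y2 - Y1 * X2) * h0 + (Y0 * X2 - X0 * Y2) * h1
      + (X0 * Y1 - Y0 * X1) * h2

theorem linearIndependent_of_jetDet_ne_zero {c : ℕ → ℝ → LieSpace 1} {x y z : LieSpace 1} {u : ℝ}
    (h : jetDet c x y z u ≠ 0) : LinearIndependent ℝ ![x, y, z] := by
  rw [Fintype.linearIndependent_iff]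
  intro t ht
  simp only [Fin.sum_univ_three, Matrix.cons_val_zero, Matrix.cons_val_one,
    Matrix.cons_val] at ht
  obtain ⟨h0, h1, h2⟩ := eq_zero_of_jetDet_ne_zero h (by rw [ht]; simp) (by rw [ht]; simp)
    (by rw [ht]; simp)
  intro i
  fin_cases i
  · exact h0
  · exact h1
  · exact h2

namespace IsPolarisedFrame

variable {I : Set ℝ} {c : ℕ → ℝ → LieSpace 1} {γ : ℕ → ℝ → ℝ} {ρ : ℝ}
  {W : Submodule ℝ (LieSpace 1)}

theorem pairing_eq_zero_of_const (h : IsPolarisedFrame I c γ ρ W) {e : LieSpace 1} {k : ℝ}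
    (he : ∀ u ∈ I, lieForm 1 e (c 0 u) = k) :
    (∀ u ∈ I, lieForm 1 e (c 1 u) = 0) ∧ ∀ u ∈ I, lieForm 1 e (c 2 u) = 0 := by
  have h1 : ∀ u ∈ I, lieForm 1 e (c 1 u) = 0 := fun u hu =>
    (h.hasDerivAt_lieForm e 0 hu).eq_zero_of_eqOn_const h.isOpen hu he
  exact ⟨h1, fun u hu => (h.hasDerivAt_lieForm e 1 hu).eq_zero_of_eqOn_const h.isOpen hu h1⟩

/-- If `W` contains three vectors, one of which pairs to a constant with the curve, whose pairings
with the curve are linearly independent functions, then the coefficient `γ` and the Wronskian of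
these functions have no zeros: `γ³` times the square of the Wronskian is constant, and it vanishes
nowhere because the curve is full on every open set. -/
theorem coeff_ne_zero_and_wronskian_ne_zero (h : IsPolarisedFrame I c γ ρ W)
    {e₁ e₂ e₃ : LieSpace 1} (h₂ : e₂ ∈ W) (h₃ : e₃ ∈ W)
    (he₁ : ∀ u ∈ I, lieForm 1 e₁ (c 0 u) = -1) (he₂ : ∀ u ∈ I, lieForm 1 e₂ (c 1 u) ≠ 0)
    (hω : ∃ u ∈ I, lieForm 1 e₂ (c 1 u) * lieForm 1 e₃ (c 2 u)
      - lieForm 1 e₂ (c 2 u) * lieForm 1 e₃ (c 1 u) ≠ 0)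
    (hne : ρ ≠ 0 ∨ ∃ u ∈ I, γ 0 u ≠ 0) {u : ℝ} (hu : u ∈ I) :
    γ 0 u ≠ 0 ∧ lieForm 1 e₂ (c 1 u) * lieForm 1 e₃ (c 2 u)
      - lieForm 1 e₂ (c 2 u) * lieForm 1 e₃ (c 1 u) ≠ 0 := by
  obtain ⟨he₁', -⟩ := h.pairing_eq_zero_of_const he₁
  obtain ⟨u₁, hu₁, hγ₁⟩ : ∃ u ∈ I, γ 0 u ≠ 0 := by
    by_contra hcon
    push Not at hcon
    have h1 : ∀ u ∈ I, γ 1 u = 0 := fun u hu =>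
      (h.hasDerivAt_coeff 0 u hu).eq_zero_of_eqOn_const h.isOpen hu hcon
    have h2 : γ 2 u = 0 := (h.hasDerivAt_coeff 1 u hu).eq_zero_of_eqOn_const h.isOpen hu h1
    have e := h.ode e₂ h₂ u hu
    rw [hcon u hu, h1 u hu, h2] at e
    have hρ : ρ = 0 := by
      have : ρ * lieForm 1 e₂ (c 1 u) = 0 := by linarith
      exact (mul_eq_zero.1 this).resolve_right (he₂ u hu)
    rcases hne with h0 | ⟨v, hv, h0⟩
    · exact h0 hρ
    · exact h0 (hcon v hv)
  set w : ℝ → ℝ := fun u => lieForm 1 e₂ (c 1 u) * lieForm 1 e₃ (c 2 u)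
      - lieForm 1 e₂ (c 2 u) * lieForm 1 e₃ (c 1 u) with hwdef
  have hconst : ∀ x ∈ I, ∀ y ∈ I, (fun u => γ 0 u ^ 3 * w u ^ 2) x =
      (fun u => γ 0 u ^ 3 * w u ^ 2) y := by
    apply eq_of_hasDerivAt_zero h.ordConnected
    intro u hu
    have dw : HasDerivAt w _ u := ((h.hasDerivAt_lieForm e₂ 1 hu).mul
      (h.hasDerivAt_lieForm e₃ 2 hu)).sub
      ((h.hasDerivAt_lieForm e₂ 2 hu).mul (h.hasDerivAt_lieForm e₃ 1 hu))
    refine (((h.hasDerivAt_coeff 0 u hu).pow 3).mul (dw.pow 2)).congr_deriv ?_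
    have o₂ := h.ode e₂ h₂ u hu
    have o₃ := h.ode e₃ h₃ u hu
    simp only [hwdef, zero_add, Nat.reduceAdd, Pi.pow_apply]
    push_cast
    linear_combination (γ 0 u ^ 2 * w u) * (lieForm 1 e₂ (c 1 u) * o₃ - lieForm 1 e₃ (c 1 u) * o₂)
  have hw₁ : w u₁ ≠ 0 := by
    intro h0
    obtain ⟨ε, hε, hball⟩ := Metric.isOpen_iff.1
      ((h.smooth_coeff 0).continuousOn.isOpen_inter_preimage h.isOpen
        (isOpen_compl_singleton (x := (0 : ℝ)))) u₁ ⟨hu₁, hγ₁⟩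
    set J := Metric.ball u₁ ε
    have hJI : J ⊆ I := fun x hx => (hball hx).1
    have hJ1 : u₁ ∈ J := Metric.mem_ball_self hε
    have hwJ : ∀ x ∈ J, w x = 0 := by
      intro x hx
      have := hconst x (hJI hx) u₁ hu₁
      simp only [h0] at this
      have h3 : γ 0 x ^ 3 ≠ 0 := pow_ne_zero _ (hball hx).2
      simpa using (mul_eq_zero.1 (this.trans (by ring))).resolve_left h3
    have hJc : J.OrdConnected := (convex_ball u₁ ε).ordConnected
    -- On `J` the derivatives of the two pairings are proportional.
    have hk : ∀ x ∈ J, lieForm 1 e₃ (c 1 x) / lieForm 1 e₂ (c 1 x) =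
        lieForm 1 e₃ (c 1 u₁) / lieForm 1 e₂ (c 1 u₁) := by
      intro x hx
      refine eq_of_hasDerivAt_zero hJc
        (F := fun x => lieForm 1 e₃ (c 1 x) / lieForm 1 e₂ (c 1 x)) (fun x hx => ?_) x hx u₁ hJ1
      refine ((h.hasDerivAt_lieForm e₃ 1 (hJI hx)).div (h.hasDerivAt_lieForm e₂ 1 (hJI hx))
        (he₂ x (hJI hx))).congr_deriv ?_
      have := hwJ x hx
      simp only [hwdef] at this
      rw [div_eq_zero_iff]
      left
      linear_combination this
    set κ := lieForm 1 e₃ (c 1 u₁) / lieForm 1 e₂ (c 1 u₁)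
    have hκ : ∀ x ∈ J, lieForm 1 (e₃ - κ • e₂) (c 1 x) = 0 := by
      intro x hx
      have := hk x hx
      rw [div_eq_iff (he₂ x (hJI hx))] at this
      simp [this]
    have hd : ∀ x ∈ J, lieForm 1 (e₃ - κ • e₂) (c 0 x) = lieForm 1 (e₃ - κ • e₂) (c 0 u₁) := by
      intro x hx
      refine eq_of_hasDerivAt_zero hJc
        (F := fun x => lieForm 1 (e₃ - κ • e₂) (c 0 x)) (fun x hx => ?_) x hx u₁ hJ1
      exact (h.hasDerivAt_lieForm (e₃ - κ • e₂) 0 (hJI hx)).congr_deriv (hκ x hx)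
    set d := lieForm 1 (e₃ - κ • e₂) (c 0 u₁)
    have hz : e₃ - κ • e₂ + d • e₁ = 0 := by
      apply h.eq_zero_of_orthogonal Metric.isOpen_ball hJI hJ1
      intro x hx
      rw [map_add, LinearMap.add_apply, hd x hx, map_smul, LinearMap.smul_apply,
        he₁ x (hJI hx)]
      simp
    obtain ⟨v, hv, hv0⟩ := hω
    have he₃ : e₃ = κ • e₂ - d • e₁ := by
      rw [← sub_eq_zero, ← hz]; module
    apply hv0
    have h1v := he₁' v hv
    have h2v := (h.pairing_eq_zero_of_const he₁).2 v hv
    rw [he₃]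
    simp only [map_sub, map_smul, LinearMap.sub_apply, LinearMap.smul_apply, smul_eq_mul, h1v, h2v]
    ring
  have := hconst u hu u₁ hu₁
  have hne' : γ 0 u ^ 3 * w u ^ 2 ≠ 0 := by
    simp only at this
    rw [this]
    exact mul_ne_zero (pow_ne_zero _ hγ₁) (pow_ne_zero _ hw₁)
  exact ⟨fun h0 => hne' (by rw [h0]; ring), fun h0 => hne' (by
    simp only [hwdef] at h0 ⊢; rw [h0]; ring)⟩

end IsPolarisedFrame

/-! ### The conic traced out by the curvature sphere -/

/-- If the Gram matrix of `polForm` on `x`, `y`, `z` is antidiagonal with entries `-A`, `A`, `-A`,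
then the pairings with the curve lie on the dual conic. At a fixed parameter, the cross product of
the one-jets gives a vector with vanishing one-jet; it is isotropic for `polForm` and pairs under
`polForm` with `x`, `y`, `z` to multiples of their pairings with the curve. -/
theorem sq_eq_two_mul_mul_of_polForm {c : ℕ → ℝ → LieSpace 1} {γ : ℕ → ℝ → ℝ} {ρ A u : ℝ}
    (hA : A ≠ 0) {x y z : LieSpace 1} (hxx : polForm c γ ρ x x u = 0)
    (hxy : polForm c γ ρ x y u = 0) (hxz : polForm c γ ρ x z u = -A)
    (hyy : polForm c γ ρ y y u = A) (hyz : polForm c γ ρ y z u = 0)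
    (hzz : polForm c γ ρ z z u = 0) :
    lieForm 1 y (c 0 u) ^ 2 = 2 * lieForm 1 x (c 0 u) * lieForm 1 z (c 0 u) ∧
      jetDet c x y z u ≠ 0 := by
  unfold polForm at *
  unfold jetDet
  generalize lieForm 1 x (c 0 u) = X0 at *
  generalize lieForm 1 x (c 1 u) = X1 at *
  generalize lieForm 1 x (c 2 u) = X2 at *
  generalize lieForm 1 y (c 0 u) = Y0 at *
  generalize lieForm 1 y (c 1 u) = Y1 at *
  generalize lieForm 1 y (c 2 u) = Y2 at *
  generalize lieForm 1 z (c 0 u) = Z0 at *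
  generalize lieForm 1 z (c 1 u) = Z1 at *
  generalize lieForm 1 z (c 2 u) = Z2 at *
  generalize γ 0 u = g at *
  generalize γ 1 u = g1 at *
  set a := Y0 * Z1 - Z0 * Y1 with ha
  set b := Z0 * X1 - X0 * Z1 with hb
  set d := X0 * Y1 - Y0 * X1 with hd
  set D := a * X2 + b * Y2 + d * Z2 with hD
  have kx : g * D * X0 = A * d := by
    linear_combination (-a) * hxx - b * hxy - d * hxz
  have ky : g * D * Y0 = -A * b := by
    linear_combination (-a) * hxy - b * hyy - d * hyz
  have kz : g * D * Z0 = A * a := by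
    linear_combination (-a) * hxz - b * hyz - d * hzz
  have kk : A * (b ^ 2 - 2 * a * d) = 0 := by
    have h0 : a * X0 + b * Y0 + d * Z0 = 0 := by rw [ha, hb, hd]; ring
    linear_combination (-g * D) * h0 + a * kx + b * ky + d * kz
  have hgD : g * D ≠ 0 := by
    intro h0
    -- The Gram determinant is `-g³ D²`.
    have hdet : g ^ 3 * D ^ 2 = A ^ 3 := by
      have key : g ^ 3 * D ^ 2 = -(
        (ρ * (X0 * X0) - g * (X2 * X0 + X0 * X2) - g1 / 2 * (X1 * X0 + X0 * X1) + g * (X1 * X1))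
        * ((ρ * (Y0 * Y0) - g * (Y2 * Y0 + Y0 * Y2) - g1 / 2 * (Y1 * Y0 + Y0 * Y1) + g * (Y1 * Y1))
          * (ρ * (Z0 * Z0) - g * (Z2 * Z0 + Z0 * Z2) - g1 / 2 * (Z1 * Z0 + Z0 * Z1)
            + g * (Z1 * Z1))
          - (ρ * (Y0 * Z0) - g * (Y2 * Z0 + Y0 * Z2) - g1 / 2 * (Y1 * Z0 + Y0 * Z1)
            + g * (Y1 * Z1)) ^ 2)
        - (ρ * (X0 * Y0) - g * (X2 * Y0 + X0 * Y2) - g1 / 2 * (X1 * Y0 + X0 * Y1) + g * (X1 * Y1))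
        * ((ρ * (X0 * Y0) - g * (X2 * Y0 + X0 * Y2) - g1 / 2 * (X1 * Y0 + X0 * Y1) + g * (X1 * Y1))
          * (ρ * (Z0 * Z0) - g * (Z2 * Z0 + Z0 * Z2) - g1 / 2 * (Z1 * Z0 + Z0 * Z1)
            + g * (Z1 * Z1))
          - (ρ * (Y0 * Z0) - g * (Y2 * Z0 + Y0 * Z2) - g1 / 2 * (Y1 * Z0 + Y0 * Z1)
            + g * (Y1 * Z1))
          * (ρ * (X0 * Z0) - g * (X2 * Z0 + X0 * Z2) - g1 / 2 * (X1 * Z0 + X0 * Z1)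
            + g * (X1 * Z1)))
        + (ρ * (X0 * Z0) - g * (X2 * Z0 + X0 * Z2) - g1 / 2 * (X1 * Z0 + X0 * Z1) + g * (X1 * Z1))
        * ((ρ * (X0 * Y0) - g * (X2 * Y0 + X0 * Y2) - g1 / 2 * (X1 * Y0 + X0 * Y1) + g * (X1 * Y1))
          * (ρ * (Y0 * Z0) - g * (Y2 * Z0 + Y0 * Z2) - g1 / 2 * (Y1 * Z0 + Y0 * Z1)
            + g * (Y1 * Z1))
          - (ρ * (Y0 * Y0) - g * (Y2 * Y0 + Y0 * Y2) - g1 / 2 * (Y1 * Y0 + Y0 * Y1)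
            + g * (Y1 * Y1))
          * (ρ * (X0 * Z0) - g * (X2 * Z0 + X0 * Z2) - g1 / 2 * (X1 * Z0 + X0 * Z1)
            + g * (X1 * Z1)))) := by
        rw [hD, ha, hb, hd]; ring
      rw [key, hxx, hxy, hxz, hyy, hyz, hzz]
      ring
    apply pow_ne_zero 3 hA
    rw [← hdet]
    linear_combination (g ^ 2 * D) * h0
  refine ⟨?_, fun h0 => hgD (by rw [h0, mul_zero])⟩
  have h4 : (g * D) ^ 2 * (Y0 ^ 2 - 2 * X0 * Z0) = 0 := by
    linear_combination (g * D * Y0 - A * b) * ky - 2 * (g * D * Z0) * kx - 2 * (A * d) * kz + A * kk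
  have := (mul_eq_zero.1 h4).resolve_left (pow_ne_zero 2 hgD)
  linarith

theorem isotropic_span_range {n : ℕ} {ι : Type*} {w : ι → LieSpace n}
    (hw : ∀ i j, lieForm n (w i) (w j) = 0) :
    ∀ x ∈ Submodule.span ℝ (Set.range w), ∀ y ∈ Submodule.span ℝ (Set.range w),
      lieForm n x y = 0 := by
  intro x hx y hy
  induction hx using Submodule.span_induction with
  | mem a ha =>
    obtain ⟨i, rfl⟩ := ha
    induction hy using Submodule.span_induction with
    | mem b hb => obtain ⟨j, rfl⟩ := hb; exact hw i j
    | zero => simp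
    | add a b _ _ ha hb => simp [ha, hb]
    | smul c a _ ha => simp [ha]
  | zero => simp
  | add a b _ _ ha hb => simp [ha, hb]
  | smul c a _ ha => simp [ha]

namespace IsPolarisedFrame

variable {I : Set ℝ} {c : ℕ → ℝ → LieSpace 1} {γ : ℕ → ℝ → ℝ} {ρ : ℝ}
  {W : Submodule ℝ (LieSpace 1)}

theorem lieForm_polTop_polTop (h : IsPolarisedFrame I c γ ρ W) (m m' : LieSpace 1) {u : ℝ}
    (hu : u ∈ I) : lieForm 1 (polTop c γ ρ m u) (polTop c γ ρ m' u) = 0 :=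
  h.isotropic_span hu _ (Submodule.neg_mem _ (Submodule.mem_span_pair.2 ⟨_, _, rfl⟩)) _
    (Submodule.neg_mem _ (Submodule.mem_span_pair.2 ⟨_, _, rfl⟩))

/-- The metric does not restrict to a multiple of `polForm` on the span of `x`, `y`, `z`:
otherwise, for some `t`, the values at `u` of the linear conserved quantities `m + t m₁` would form
a three-dimensional isotropic space. -/
theorem not_lieForm_eq_polForm (h : IsPolarisedFrame I c γ ρ W) {u A s : ℝ} (hu : u ∈ I)
    (hA : A ≠ 0) {x y z : LieSpace 1} (hxx : polForm c γ ρ x x u = 0)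
    (hxy : polForm c γ ρ x y u = 0) (hxz : polForm c γ ρ x z u = -A)
    (hyy : polForm c γ ρ y y u = A) (hyz : polForm c γ ρ y z u = 0)
    (hzz : polForm c γ ρ z z u = 0) (gxx : lieForm 1 x x = 0) (gxy : lieForm 1 x y = 0)
    (gyy : lieForm 1 y y = s) (gxz : lieForm 1 x z = -s) (gyz : lieForm 1 y z = 0)
    (gzz : lieForm 1 z z = 0) : False := by
  have hD := (sq_eq_two_mul_mul_of_polForm hA hxx hxy hxz hyy hyz hzz).2
  set t := s / (2 * A) with ht
  have htA : 2 * t * A = s := by rw [ht]; field_simp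
  set w : LieSpace 1 → LieSpace 1 := fun m => m + t • polTop c γ ρ m u with hw
  have hform : ∀ m m', lieForm 1 (w m) (w m') = lieForm 1 m m' - 2 * t * polForm c γ ρ m m' u := by
    intro m m'
    have e := lieForm_polTop_add c γ ρ m m' u
    have e2 := h.lieForm_polTop_polTop m m' hu
    simp only [hw, map_add, map_smul, LinearMap.add_apply, LinearMap.smul_apply, smul_eq_mul, e2]
    linear_combination t * e
  have hsymm : ∀ m m', lieForm 1 (w m) (w m') = 0 → lieForm 1 (w m') (w m) = 0 := fun m m' e => by
    rw [lieForm_comm, e]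
  have exx : lieForm 1 (w x) (w x) = 0 := by rw [hform, gxx, hxx]; ring
  have exy : lieForm 1 (w x) (w y) = 0 := by rw [hform, gxy, hxy]; ring
  have exz : lieForm 1 (w x) (w z) = 0 := by rw [hform, gxz, hxz]; linarith
  have eyy : lieForm 1 (w y) (w y) = 0 := by rw [hform, gyy, hyy]; linarith
  have eyz : lieForm 1 (w y) (w z) = 0 := by rw [hform, gyz, hyz]; ring
  have ezz : lieForm 1 (w z) (w z) = 0 := by rw [hform, gzz, hzz]; ring
  have hiso : ∀ i j, lieForm 1 (![w x, w y, w z] i) (![w x, w y, w z] j) = 0 := by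
    intro i j
    fin_cases i <;> fin_cases j
    · exact exx
    · exact exy
    · exact exz
    · exact hsymm _ _ exy
    · exact eyy
    · exact eyz
    · exact hsymm _ _ exz
    · exact hsymm _ _ eyz
    · exact ezz
  have hli : LinearIndependent ℝ ![w x, w y, w z] := by
    rw [Fintype.linearIndependent_iff]
    intro b hb
    simp only [Fin.sum_univ_three, Matrix.cons_val_zero, Matrix.cons_val_one,
      Matrix.cons_val] at hb
    have hmem : b 0 • x + b 1 • y + b 2 • z ∈ Submodule.span ℝ {c 0 u, c 1 u} := by
      have e : b 0 • x + b 1 • y + b 2 • z = -(b 0 • t • polTop c γ ρ x u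
          + b 1 • t • polTop c γ ρ y u + b 2 • t • polTop c γ ρ z u) := by
        rw [eq_neg_iff_add_eq_zero, ← hb]
        simp only [hw]
        module
      have hT : ∀ m, polTop c γ ρ m u ∈ Submodule.span ℝ {c 0 u, c 1 u} := fun m =>
        Submodule.neg_mem _ (Submodule.mem_span_pair.2 ⟨_, _, rfl⟩)
      rw [e]
      exact Submodule.neg_mem _ (Submodule.add_mem _ (Submodule.add_mem _
        (Submodule.smul_mem _ _ (Submodule.smul_mem _ _ (hT x)))
        (Submodule.smul_mem _ _ (Submodule.smul_mem _ _ (hT y))))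
        (Submodule.smul_mem _ _ (Submodule.smul_mem _ _ (hT z))))
    obtain ⟨h0, h1, h2⟩ := eq_zero_of_jetDet_ne_zero hD
      (h.isotropic_span hu _ hmem _ (Submodule.subset_span (by simp)))
      (h.isotropic_span hu _ hmem _ (Submodule.subset_span (by simp)))
      (mem_perp.1 (h.two_mem_perp hu) _ hmem)
    intro i
    fin_cases i
    · exact h0
    · exact h1
    · exact h2
  have := finrank_le_two_of_isotropic (isotropic_span_range hiso)
  rw [finrank_span_eq_card hli] at this
  simp at this

/-- There are vectors of `W` with prescribed two-jet of the pairing with the curve. -/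
theorem exists_mem_jet (_h : IsPolarisedFrame I c γ ρ W) {e₁ e₂ e₃ : LieSpace 1} (h₁ : e₁ ∈ W)
    (h₂ : e₂ ∈ W) (h₃ : e₃ ∈ W) {u : ℝ} (he₀ : lieForm 1 e₁ (c 0 u) = -1)
    (he₁ : lieForm 1 e₁ (c 1 u) = 0) (he₂ : lieForm 1 e₁ (c 2 u) = 0)
    (hw : lieForm 1 e₂ (c 1 u) * lieForm 1 e₃ (c 2 u)
      - lieForm 1 e₂ (c 2 u) * lieForm 1 e₃ (c 1 u) ≠ 0) (a b d : ℝ) :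
    ∃ m ∈ W, lieForm 1 m (c 0 u) = a ∧ lieForm 1 m (c 1 u) = b ∧ lieForm 1 m (c 2 u) = d := by
  set w := lieForm 1 e₂ (c 1 u) * lieForm 1 e₃ (c 2 u)
      - lieForm 1 e₂ (c 2 u) * lieForm 1 e₃ (c 1 u) with hwdef
  set t := (b * lieForm 1 e₃ (c 2 u) - d * lieForm 1 e₃ (c 1 u)) / w with ht
  set r := (d * lieForm 1 e₂ (c 1 u) - b * lieForm 1 e₂ (c 2 u)) / w with hr
  refine ⟨(t * lieForm 1 e₂ (c 0 u) + r * lieForm 1 e₃ (c 0 u) - a) • e₁ + t • e₂ + r • e₃,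
    W.add_mem (W.add_mem (W.smul_mem _ h₁) (W.smul_mem _ h₂)) (W.smul_mem _ h₃), ?_, ?_, ?_⟩ <;>
    simp only [map_add, map_smul, LinearMap.add_apply, LinearMap.smul_apply, smul_eq_mul, he₀, he₁,
      he₂]
  · ring
  · rw [ht, hr]
    field_simp
    rw [hwdef]; ring
  · rw [ht, hr]
    field_simp
    rw [hwdef]; ring

/-- The vectors `p`, `q` used to project to a space form: `p` is isotropic for `polForm`, but not
for the metric, and `q` is orthogonal to `p` for both. -/
theorem exists_conic_frame (h : IsPolarisedFrame I c γ ρ W) {e₁ e₂ e₃ : LieSpace 1} (h₁ : e₁ ∈ W)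
    (h₂ : e₂ ∈ W) (h₃ : e₃ ∈ W) {u₀ : ℝ} (hu₀ : u₀ ∈ I) (hγ : γ 0 u₀ ≠ 0)
    (he₀ : lieForm 1 e₁ (c 0 u₀) = -1) (he₁ : lieForm 1 e₁ (c 1 u₀) = 0)
    (he₂ : lieForm 1 e₁ (c 2 u₀) = 0)
    (hw : lieForm 1 e₂ (c 1 u₀) * lieForm 1 e₃ (c 2 u₀)
      - lieForm 1 e₂ (c 2 u₀) * lieForm 1 e₃ (c 1 u₀) ≠ 0) :
    ∃ p ∈ W, ∃ q ∈ W, ∃ r ∈ W, (lieForm 1 p p = 1 ∨ lieForm 1 p p = -1) ∧ lieForm 1 p q = 0 ∧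
      ∀ u ∈ I, lieForm 1 q (c 0 u) ^ 2 = 2 * lieForm 1 p (c 0 u) * lieForm 1 r (c 0 u) ∧
        jetDet c p q r u ≠ 0 := by
  have hjet := h.exists_mem_jet h₁ h₂ h₃ he₀ he₁ he₂ hw
  -- The two-jets at `u₀` are chosen to make the Gram matrix of `polForm` antidiagonal.
  obtain ⟨z, hz, z0, z1, z2⟩ := hjet 0 0 1
  obtain ⟨y, hy, y0, y1, y2⟩ := hjet 0 1 0
  obtain ⟨x, hx, x0, x1, x2⟩ := hjet 1 (γ 1 u₀ / (2 * γ 0 u₀))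
    ((ρ - γ 1 u₀ * (γ 1 u₀ / (2 * γ 0 u₀)) + γ 0 u₀ * (γ 1 u₀ / (2 * γ 0 u₀)) ^ 2) / (2 * γ 0 u₀))
  set A := γ 0 u₀
  have hxx : polForm c γ ρ x x u₀ = 0 := by
    simp only [polForm, x0, x1, x2]; field_simp; ring
  have hxy : polForm c γ ρ x y u₀ = 0 := by
    simp only [polForm, x0, x1, x2, y0, y1, y2]; field_simp; ring
  have hxz : polForm c γ ρ x z u₀ = -A := by
    simp only [polForm, x0, x1, x2, z0, z1, z2]; ring
  have hyy : polForm c γ ρ y y u₀ = A := by simp only [polForm, y0, y1, y2]; ring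
  have hyz : polForm c γ ρ y z u₀ = 0 := by simp only [polForm, y0, y1, y2, z0, z1, z2]; ring
  have hzz : polForm c γ ρ z z u₀ = 0 := by simp only [polForm, z0, z1, z2]; ring
  have hconic : ∀ u ∈ I, lieForm 1 y (c 0 u) ^ 2 = 2 * lieForm 1 x (c 0 u) * lieForm 1 z (c 0 u) ∧
      jetDet c x y z u ≠ 0 := fun u hu =>
    sq_eq_two_mul_mul_of_polForm hγ ((h.polForm_eq hx hx hu hu₀).trans hxx)
      ((h.polForm_eq hx hy hu hu₀).trans hxy) ((h.polForm_eq hx hz hu hu₀).trans hxz)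
      ((h.polForm_eq hy hy hu hu₀).trans hyy) ((h.polForm_eq hy hz hu hu₀).trans hyz)
      ((h.polForm_eq hz hz hu hu₀).trans hzz)
  -- The isotropic vectors of `polForm` other than multiples of `z` are those proportional to
  -- `x + t y + t² z / 2`.
  obtain ⟨t, ht⟩ : ∃ t : ℝ, lieForm 1 (x + t • y + (t ^ 2 / 2) • z)
      (x + t • y + (t ^ 2 / 2) • z) ≠ 0 := by
    by_contra hcon
    push Not at hcon
    have key : ∀ t : ℝ, lieForm 1 x x + 2 * t * lieForm 1 x y
        + t ^ 2 * (lieForm 1 y y + lieForm 1 x z) + t ^ 3 * lieForm 1 y z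
        + t ^ 4 / 4 * lieForm 1 z z = 0 := by
      intro t
      rw [← hcon t]
      simp only [map_add, map_smul, LinearMap.add_apply, LinearMap.smul_apply, smul_eq_mul,
        lieForm_comm y x, lieForm_comm z x, lieForm_comm z y]
      ring
    have k0 := key 0
    have k1 := key 1
    have k2 := key (-1)
    have k3 := key 2
    have k4 := key (-2)
    norm_num at k0 k1 k2 k3 k4
    exact h.not_lieForm_eq_polForm hu₀ hγ hxx hxy hxz hyy hyz hzz (s := lieForm 1 y y) k0
      (by linarith) rfl (by linarith) (by linarith) (by linarith)
  set P := x + t • y + (t ^ 2 / 2) • z with hP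
  set N := lieForm 1 P P with hN
  set l := (Real.sqrt |N|)⁻¹ with hl
  have hsq : 0 < Real.sqrt |N| := Real.sqrt_pos.2 (abs_pos.2 ht)
  have hl0 : l ≠ 0 := inv_ne_zero hsq.ne'
  set b := -(lieForm 1 P (y + t • z) / N) with hb
  have hPW : P ∈ W := W.add_mem (W.add_mem hx (W.smul_mem _ hy)) (W.smul_mem _ hz)
  have hQW : y + t • z + b • P ∈ W := W.add_mem (W.add_mem hy (W.smul_mem _ hz)) (W.smul_mem _ hPW)
  -- `P`, `y + t z`, `z` is another such frame; `l` normalises `(P, P)`, and the shear by `b` makes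
  -- the second vector orthogonal to the first.
  refine ⟨l • P, W.smul_mem _ hPW, y + t • z + b • P, hQW,
    l⁻¹ • (z + b • (y + t • z) + (b ^ 2 / 2) • P), W.smul_mem _ (W.add_mem (W.add_mem hz
      (W.smul_mem _ (W.add_mem hy (W.smul_mem _ hz)))) (W.smul_mem _ hPW)), ?_, ?_, ?_⟩
  · have e : lieForm 1 (l • P) (l • P) = N / |N| := by
      simp only [map_smul, LinearMap.smul_apply, smul_eq_mul, ← hN]
      rw [hl, ← mul_assoc, ← mul_inv, Real.mul_self_sqrt (abs_nonneg _)]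
      field_simp
    rw [e]
    rcases lt_or_gt_of_ne ht with h0 | h0
    · right
      rw [abs_of_neg h0, div_neg, div_self ht]
    · left
      rw [abs_of_pos h0, div_self ht]
  · rw [map_smul, LinearMap.smul_apply, map_add, map_smul, ← hN, hb, smul_eq_mul, smul_eq_mul]
    field_simp
    ring
  · intro u hu
    obtain ⟨hc, hd⟩ := hconic u hu
    constructor
    · simp only [hP, map_add, map_smul, LinearMap.add_apply, LinearMap.smul_apply, smul_eq_mul]
      field_simp
      linear_combination 4 * hc
    · have : jetDet c (l • P) (y + t • z + b • P) (l⁻¹ • (z + b • (y + t • z) + (b ^ 2 / 2) • P)) u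
          = (l * l⁻¹) * jetDet c x y z u := by
        simp only [jetDet, hP, map_add, map_smul, LinearMap.add_apply, LinearMap.smul_apply,
          smul_eq_mul]
        ring
      rw [this, mul_inv_cancel₀ hl0, one_mul]
      exact hd

end IsPolarisedFrame

/-! ### Projection to a space form -/

/-- The curvature equation. With `T` the unit tangent, the structure equation of the curve in the
space form is `T_s = -κ γ + χ k τ - k p + q`. A constant vector `r` with `(γ, r) = -k` and
`(τ, r) = k² / 2` has `(T, r) = -k_s`, so pairing the structure equation with `r` gives the
equation of constrained elastic curves, with `μ = -(p, r)` and `λ = (q, r)`. -/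
theorem arcDeriv_arcDeriv_curvature {G : Set ℝ} (hG : IsOpen G) {γ τ : ℝ → LieSpace 1} {k : ℝ → ℝ}
    {p q r : LieSpace 1} (hγ : ContDiffOn ℝ ∞ γ G) (hτ : ContDiffOn ℝ ∞ τ G)
    (hk : ContDiffOn ℝ ∞ k G) (hpq : lieForm 1 p q = 0)
    (hγγ : ∀ u ∈ G, lieForm 1 (γ u) (γ u) = 0) (hγτ : ∀ u ∈ G, lieForm 1 (γ u) (τ u) = 0)
    (hττ : ∀ u ∈ G, lieForm 1 (τ u) (τ u) = 0)
    (hγq : ∀ u ∈ G, lieForm 1 (γ u) q = -1) (hγp : ∀ u ∈ G, lieForm 1 (γ u) p = 0)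
    (hτp : ∀ u ∈ G, lieForm 1 (τ u) p = -1) (hτq : ∀ u ∈ G, lieForm 1 (τ u) q = 0)
    (hpos : ∀ u ∈ G, 0 < lieForm 1 (deriv γ u) (deriv γ u))
    (hderiv : ∀ u ∈ G, deriv τ u = -(k u) • deriv γ u)
    (hγr : ∀ u ∈ G, lieForm 1 (γ u) r = -k u) (hτr : ∀ u ∈ G, lieForm 1 (τ u) r = k u ^ 2 / 2)
    {u : ℝ} (hu : u ∈ G)
    (hframe : ∀ X, lieForm 1 X (γ u) = 0 → lieForm 1 X (τ u) = 0 →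
      lieForm 1 X (deriv γ u) = 0 → lieForm 1 X p = 0 → lieForm 1 X q = 0 → X = 0) :
    arcDeriv γ (arcDeriv γ k) u + (-lieForm 1 p p) * (k u) ^ 3 / 2
        + (-lieForm 1 p r + -lieForm 1 q q) * k u + lieForm 1 q r = 0 := by
  have dγ : ∀ x ∈ G, HasDerivAt γ (deriv γ x) x := fun x hx =>
    ((hγ.contDiffAt (hG.mem_nhds hx)).differentiableAt (by simp)).hasDerivAt
  have dτ : ∀ x ∈ G, HasDerivAt τ (-(k x) • deriv γ x) x := fun x hx => by
    rw [← hderiv x hx]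
    exact ((hτ.contDiffAt (hG.mem_nhds hx)).differentiableAt (by simp)).hasDerivAt
  have dk : ∀ x ∈ G, HasDerivAt k (deriv k x) x := fun x hx =>
    ((hk.contDiffAt (hG.mem_nhds hx)).differentiableAt (by simp)).hasDerivAt
  have hγ' : ContDiffOn ℝ ∞ (deriv γ) G := hγ.deriv_of_isOpen hG (by simp)
  set N : ℝ → ℝ := fun x => Real.sqrt (lieForm 1 (deriv γ x) (deriv γ x)) with hN
  have hNpos : ∀ x ∈ G, 0 < N x := fun x hx => Real.sqrt_pos.2 (hpos x hx)
  have hNsq : ∀ x ∈ G, N x * N x = lieForm 1 (deriv γ x) (deriv γ x) := fun x hx =>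
    Real.mul_self_sqrt (hpos x hx).le
  set T : ℝ → LieSpace 1 := fun x => (N x)⁻¹ • deriv γ x with hT
  have hTs : ContDiffOn ℝ ∞ T G := by
    refine ContDiffOn.smul (ContDiffOn.inv ?_ fun x hx => (hNpos x hx).ne') hγ'
    exact (hγ'.lieForm hγ').sqrt fun x hx => (hpos x hx).ne'
  have dT : HasDerivAt T (deriv T u) u :=
    ((hTs.contDiffAt (hG.mem_nhds hu)).differentiableAt (by simp)).hasDerivAt
  have hγ'eq : ∀ x ∈ G, deriv γ x = N x • T x := fun x hx => by
    rw [hT, smul_smul, mul_inv_cancel₀ (hNpos x hx).ne', one_smul]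
  have hTof : ∀ x ∈ G, ∀ Y, lieForm 1 (deriv γ x) Y = 0 → lieForm 1 (T x) Y = 0 := by
    intro x _ Y hY
    simp [hT, hY]
  have e1 : ∀ x ∈ G, lieForm 1 (deriv γ x) (γ x) = 0 := fun x hx => by
    have := ((dγ x hx).lieForm (dγ x hx)).eq_zero_of_eqOn_const hG hx hγγ
    rw [lieForm_comm (γ x)] at this
    linarith
  have e2 : ∀ x ∈ G, lieForm 1 (deriv γ x) (τ x) = 0 := fun x hx => by
    have := ((dγ x hx).lieForm (dτ x hx)).eq_zero_of_eqOn_const hG hx hγτ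
    rw [map_smul, lieForm_comm (γ x), e1 x hx] at this
    simpa using this
  have econst : ∀ (Y : LieSpace 1) (a : ℝ), (∀ x ∈ G, lieForm 1 (γ x) Y = a) →
      ∀ x ∈ G, lieForm 1 (deriv γ x) Y = 0 := fun Y a hY x hx => by
    have := ((dγ x hx).lieForm (hasDerivAt_const x Y)).eq_zero_of_eqOn_const hG hx hY
    simpa using this
  have t1 : ∀ x ∈ G, lieForm 1 (T x) (γ x) = 0 := fun x hx => hTof x hx _ (e1 x hx)
  have t2 : ∀ x ∈ G, lieForm 1 (T x) (τ x) = 0 := fun x hx => hTof x hx _ (e2 x hx)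
  have t3 : ∀ x ∈ G, lieForm 1 (T x) p = 0 := fun x hx => hTof x hx _ (econst p 0 hγp x hx)
  have t4 : ∀ x ∈ G, lieForm 1 (T x) q = 0 := fun x hx => hTof x hx _ (econst q _ hγq x hx)
  have t5 : ∀ x ∈ G, lieForm 1 (T x) (T x) = 1 := fun x hx => by
    have h0 := (hNpos x hx).ne'
    simp only [hT, map_smul, LinearMap.smul_apply, smul_eq_mul, ← hNsq x hx]
    field_simp
  have t6 : ∀ x ∈ G, arcDeriv γ k x = -lieForm 1 (T x) r := fun x hx => by
    have h1 : lieForm 1 (deriv γ x) r = -deriv k x := by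
      have h2 : HasDerivAt (fun y => lieForm 1 (γ y) r + k y) _ x :=
        ((dγ x hx).lieForm (hasDerivAt_const x r)).add (dk x hx)
      have := h2.eq_zero_of_eqOn_const (k := 0) hG hx (fun y hy => by rw [hγr y hy]; ring)
      simp only [map_zero, add_zero] at this
      linarith
    simp only [arcDeriv, hT, map_smul, LinearMap.smul_apply, smul_eq_mul, h1, hN]
    ring
  have d1 : lieForm 1 (deriv T u) (γ u) = -N u := by
    have := (dT.lieForm (dγ u hu)).eq_zero_of_eqOn_const hG hu t1
    rw [hγ'eq u hu, map_smul, t5 u hu] at this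
    simp only [smul_eq_mul, mul_one] at this
    linarith
  have d2 : lieForm 1 (deriv T u) (τ u) = k u * N u := by
    have := (dT.lieForm (dτ u hu)).eq_zero_of_eqOn_const hG hu t2
    rw [hγ'eq u hu, map_smul, map_smul, t5 u hu] at this
    simp only [smul_eq_mul, mul_one] at this
    linarith
  have d3 : lieForm 1 (deriv T u) p = 0 := by
    simpa using (dT.lieForm (hasDerivAt_const u p)).eq_zero_of_eqOn_const hG hu t3
  have d4 : lieForm 1 (deriv T u) q = 0 := by
    simpa using (dT.lieForm (hasDerivAt_const u q)).eq_zero_of_eqOn_const hG hu t4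
  have d5 : lieForm 1 (deriv T u) (T u) = 0 := by
    have := (dT.lieForm dT).eq_zero_of_eqOn_const hG hu t5
    rw [lieForm_comm (T u)] at this
    linarith
  have key : deriv T u - N u • (lieForm 1 q q • γ u + (-lieForm 1 p p * k u) • τ u
      - k u • p + q) = 0 := by
    have c1 := lieForm_comm p (γ u)
    have c2 := lieForm_comm q (γ u)
    have c3 := lieForm_comm p (τ u)
    have c4 := lieForm_comm q (τ u)
    have c5 := lieForm_comm (τ u) (γ u)
    have c6 := lieForm_comm q p
    refine hframe _ ?_ ?_ ?_ ?_ ?_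
    · simp only [map_sub, map_add, map_smul, LinearMap.sub_apply, LinearMap.add_apply,
        LinearMap.smul_apply, smul_eq_mul, d1, c1, c2, c5, hγγ u hu, hγτ u hu, hγp u hu, hγq u hu]
      ring
    · simp only [map_sub, map_add, map_smul, LinearMap.sub_apply, LinearMap.add_apply,
        LinearMap.smul_apply, smul_eq_mul, d2, c3, c4, hττ u hu, hγτ u hu, hτp u hu, hτq u hu]
      ring
    · rw [hγ'eq u hu]
      have s1 := lieForm_comm (γ u) (T u)
      have s2 := lieForm_comm (τ u) (T u)
      have s3 := lieForm_comm p (T u)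
      have s4 := lieForm_comm q (T u)
      simp only [map_sub, map_add, map_smul, LinearMap.sub_apply, LinearMap.add_apply,
        LinearMap.smul_apply, smul_eq_mul, d5, s1, s2, s3, s4, t1 u hu, t2 u hu, t3 u hu, t4 u hu]
      ring
    · simp only [map_sub, map_add, map_smul, LinearMap.sub_apply, LinearMap.add_apply,
        LinearMap.smul_apply, smul_eq_mul, d3, hγp u hu, hτp u hu, c6, hpq]
      ring
    · simp only [map_sub, map_add, map_smul, LinearMap.sub_apply, LinearMap.add_apply,
        LinearMap.smul_apply, smul_eq_mul, d4, hγq u hu, hτq u hu, hpq]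
      ring
  have hTr : lieForm 1 (deriv T u) r = N u * (-lieForm 1 q q * k u - lieForm 1 p p * k u ^ 3 / 2
      - k u * lieForm 1 p r + lieForm 1 q r) := by
    rw [sub_eq_zero.1 key]
    simp only [map_sub, map_add, map_smul, LinearMap.sub_apply, LinearMap.add_apply,
      LinearMap.smul_apply, smul_eq_mul, hγr u hu, hτr u hu]
    ring
  have hfinal : deriv (arcDeriv γ k) u = -lieForm 1 (deriv T u) r := by
    have h1 : arcDeriv γ k =ᶠ[nhds u] fun x => -lieForm 1 (T x) r := by
      filter_upwards [hG.mem_nhds hu] with x hx using t6 x hx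
    rw [h1.deriv_eq]
    simpa using (dT.lieForm (hasDerivAt_const u r)).neg.deriv
  have h0 := (hNpos u hu).ne'
  have : arcDeriv γ (arcDeriv γ k) u = (N u)⁻¹ * deriv (arcDeriv γ k) u := rfl
  rw [this, hfinal, hTr]
  field_simp
  ring

/-- Isolated zeros: at a zero of `(p, c)` also `(q, c)` vanishes, to first order only. -/
theorem exists_nhds_inter_subset_singleton {I : Set ℝ} {P Q : ℝ → ℝ} {Q' u : ℝ}
    (hQ : HasDerivAt Q Q' u) (hQ' : P u = 0 → Q' ≠ 0) (hPQ : ∀ x ∈ I, P x = 0 → Q x = 0)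
    (hP : ContinuousAt P u) :
    ∃ N ∈ nhds u, N ∩ {x ∈ I | P x = 0} ⊆ {u} := by
  by_cases h0 : P u = 0
  · have h1 := hQ.eventually_ne (c := 0) (hQ' h0)
    rw [eventually_nhdsWithin_iff] at h1
    refine ⟨_, h1, ?_⟩
    rintro x ⟨hx, hxI, hPx⟩
    by_contra hne
    exact hx hne (hPQ x hxI hPx)
  · exact ⟨_, hP.eventually_ne h0, fun x hx => (hx.1 hx.2.2).elim⟩

namespace IsLegendreFrame

variable {I : Set ℝ} {c : ℕ → ℝ → LieSpace 1}

/-- If the pairings of `p`, `q`, `r` with the curve lie on a conic, the curve projects to a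
constrained elastic curve in the space form of `p`, `q`, with curvature the quotient of the
pairings with `q` and `p`. -/
theorem projectsToConstrainedElastic (h : IsLegendreFrame I c) {p q r : LieSpace 1}
    (hpp : lieForm 1 p p = 1 ∨ lieForm 1 p p = -1) (hpq : lieForm 1 p q = 0)
    (hconic : ∀ u ∈ I, lieForm 1 q (c 0 u) ^ 2 = 2 * lieForm 1 p (c 0 u) * lieForm 1 r (c 0 u))
    (hdet : ∀ u ∈ I, jetDet c p q r u ≠ 0) (hI : I.Nonempty) :
    ProjectsToConstrainedElastic I (fun u => Submodule.span ℝ {c 0 u, c 1 u}) p q := by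
  set P : ℕ → ℝ → ℝ := fun i u => lieForm 1 p (c i u) with hPdef
  set Q : ℕ → ℝ → ℝ := fun i u => lieForm 1 q (c i u) with hQdef
  set R : ℕ → ℝ → ℝ := fun i u => lieForm 1 r (c i u) with hRdef
  set Δ : ℝ → ℝ := fun u => P 0 u * Q 1 u - Q 0 u * P 1 u with hΔ
  have dP : ∀ i, ∀ u ∈ I, HasDerivAt (P i) (P (i + 1) u) u := fun i u hu =>
    h.hasDerivAt_lieForm p i hu
  have dQ : ∀ i, ∀ u ∈ I, HasDerivAt (Q i) (Q (i + 1) u) u := fun i u hu =>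
    h.hasDerivAt_lieForm q i hu
  have dR : ∀ i, ∀ u ∈ I, HasDerivAt (R i) (R (i + 1) u) u := fun i u hu =>
    h.hasDerivAt_lieForm r i hu
  have sP : ∀ i, ContDiffOn ℝ ∞ (P i) I := fun i => contDiffOn_const.lieForm (h.smooth i)
  have sQ : ∀ i, ContDiffOn ℝ ∞ (Q i) I := fun i => contDiffOn_const.lieForm (h.smooth i)
  have r0 : ∀ u ∈ I, Q 0 u ^ 2 = 2 * P 0 u * R 0 u := hconic
  have r1 : ∀ u ∈ I, Q 0 u * Q 1 u = P 1 u * R 0 u + P 0 u * R 1 u := fun u hu => by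
    have h1 : HasDerivAt (fun x => Q 0 x ^ 2 - 2 * P 0 x * R 0 x) _ u :=
      ((dQ 0 u hu).pow 2).sub (((dP 0 u hu).const_mul 2).mul (dR 0 u hu))
    have h2 := h1.eq_zero_of_eqOn_const (k := 0) h.isOpen hu (fun x hx => by rw [r0 x hx]; ring)
    simp only [zero_add] at h2
    push_cast at h2
    linarith
  have hdet' : ∀ u ∈ I, (Q 0 u * R 1 u - R 0 u * Q 1 u) * P 2 u
      + (R 0 u * P 1 u - P 0 u * R 1 u) * Q 2 u + (P 0 u * Q 1 u - Q 0 u * P 1 u) * R 2 u ≠ 0 :=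
    hdet
  have z0 : ∀ u ∈ I, P 0 u = 0 → Q 0 u = 0 := fun u hu hP => by
    have := r0 u hu
    rw [hP] at this
    simpa using this
  have z1 : ∀ u ∈ I, P 0 u = 0 → P 1 u = 0 := fun u hu hP => by
    have hQ := z0 u hu hP
    have h1 := r1 u hu
    rw [hP, hQ] at h1
    have h2 : P 1 u * R 0 u = 0 := by linarith
    refine (mul_eq_zero.1 h2).resolve_right fun hR => hdet' u hu ?_
    rw [hP, hQ, hR]; ring
  have z2 : ∀ u ∈ I, P 0 u = 0 → Q 1 u ≠ 0 := fun u hu hP hQ1 => hdet' u hu (by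
    rw [hP, z0 u hu hP, z1 u hu hP, hQ1]; ring)
  have hΔ0 : ∀ u ∈ I, P 0 u ≠ 0 → Δ u ≠ 0 := fun u hu hP hD => hdet' u hu (by
    have e0 := r0 u hu
    have e1 := r1 u hu
    simp only [hΔ] at hD
    have hQ1 : Q 1 u = Q 0 u * P 1 u / P 0 u := by field_simp; linarith
    have hR0 : R 0 u = Q 0 u ^ 2 / (2 * P 0 u) := by field_simp; linarith
    have hR1 : R 1 u = (Q 0 u * Q 1 u - P 1 u * R 0 u) / P 0 u := by field_simp; linarith
    rw [hR1, hR0, hQ1]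
    field_simp
    ring)
  have hsing : projectionSingularSet I (fun u => Submodule.span ℝ {c 0 u, c 1 u}) p q =
      {u ∈ I | P 0 u = 0} := by
    ext u
    refine and_congr_right fun hu => ?_
    constructor
    · intro hnd
      by_contra hP
      apply hnd
      rw [Submodule.disjoint_def]
      intro v hv hv'
      obtain ⟨x, y, rfl⟩ := Submodule.mem_span_pair.1 hv
      have hp := mem_perp.1 hv' p (Submodule.subset_span (by simp))
      have hq := mem_perp.1 hv' q (Submodule.subset_span (by simp))
      simp only [map_add, map_smul, smul_eq_mul] at hp hq
      have hx : x * Δ u = 0 := by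
        simp only [hΔ, hPdef, hQdef]
        linear_combination lieForm 1 q (c 1 u) * hp - lieForm 1 p (c 1 u) * hq
      have hy : y * Δ u = 0 := by
        simp only [hΔ, hPdef, hQdef]
        linear_combination lieForm 1 p (c 0 u) * hq - lieForm 1 q (c 0 u) * hp
      rw [(mul_eq_zero.1 hx).resolve_right (hΔ0 u hu hP),
        (mul_eq_zero.1 hy).resolve_right (hΔ0 u hu hP)]
      simp
    · intro hP hd
      have h0 : c 0 u = 0 := by
        refine Submodule.disjoint_def.1 hd _ (Submodule.subset_span (by simp)) (mem_perp.2 ?_)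
        intro a ha
        obtain ⟨x, y, rfl⟩ := Submodule.mem_span_pair.1 ha
        have e1 : lieForm 1 p (c 0 u) = 0 := hP
        have e2 : lieForm 1 q (c 0 u) = 0 := z0 u hu hP
        simp [e1, e2]
      have := h.gram₀₄ hu
      rw [h0] at this
      exact (h.pos_two u hu).ne' (by simpa using this.symm)
  have hq0 : q ≠ 0 := by
    rintro rfl
    obtain ⟨u, hu⟩ := hI
    exact hdet u hu (by simp [jetDet])
  refine ⟨hpp, hq0, hpq, ?_, ?_⟩
  · intro u hu
    rw [hsing]
    exact exists_nhds_inter_subset_singleton (dQ 0 u hu) (z2 u hu) z0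
      (dP 0 u hu).continuousAt
  rw [hsing]
  set G : Set ℝ := I \ {u ∈ I | P 0 u = 0} with hGdef
  have hGI : G ⊆ I := Set.sdiff_subset
  have hGP : ∀ u ∈ G, P 0 u ≠ 0 := fun u hu h0 => hu.2 ⟨hu.1, h0⟩
  have hG : IsOpen G := by
    have : G = I ∩ P 0 ⁻¹' {0}ᶜ := by
      ext u
      constructor
      · exact fun hu => ⟨hu.1, hGP u hu⟩
      · exact fun hu => ⟨hu.1, fun h0 => hu.2 h0.2⟩
    rw [this]
    exact (sP 0).continuousOn.isOpen_inter_preimage h.isOpen isOpen_compl_singleton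
  have hGΔ : ∀ u ∈ G, Δ u ≠ 0 := fun u hu => hΔ0 u (hGI hu) (hGP u hu)
  have sΔ : ContDiffOn ℝ ∞ Δ I := ((sP 0).mul (sQ 1)).sub ((sQ 0).mul (sP 1))
  have dΔ : ∀ u ∈ I, HasDerivAt Δ (P 0 u * Q 2 u - Q 0 u * P 2 u) u := fun u hu =>
    (((dP 0 u hu).mul (dQ 1 u hu)).sub ((dQ 0 u hu).mul (dP 1 u hu))).congr_deriv (by
      simp only [zero_add, Nat.reduceAdd]; ring)
  -- The elements of the curve normalised by `(γ, q) = -1`, `(γ, p) = 0` and `(τ, p) = -1`,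
  -- `(τ, q) = 0`, from Cramer's rule.
  set γ : ℝ → LieSpace 1 := fun u => (P 1 u / Δ u) • c 0 u + (-(P 0 u / Δ u)) • c 1 u with hγ
  set τ : ℝ → LieSpace 1 := fun u => (-(Q 1 u / Δ u)) • c 0 u + (Q 0 u / Δ u) • c 1 u with hτ
  set k : ℝ → ℝ := fun u => Q 0 u / P 0 u with hk
  have sγ : ContDiffOn ℝ ∞ γ G :=
    ((((sP 1).mono hGI).div (sΔ.mono hGI) hGΔ).smul ((h.smooth 0).mono hGI)).add
      ((((sP 0).mono hGI).div (sΔ.mono hGI) hGΔ).neg.smul ((h.smooth 1).mono hGI))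
  have sτ : ContDiffOn ℝ ∞ τ G :=
    ((((sQ 1).mono hGI).div (sΔ.mono hGI) hGΔ).neg.smul ((h.smooth 0).mono hGI)).add
      ((((sQ 0).mono hGI).div (sΔ.mono hGI) hGΔ).smul ((h.smooth 1).mono hGI))
  have sk : ContDiffOn ℝ ∞ k G := ((sQ 0).mono hGI).div ((sP 0).mono hGI) hGP
  have dγ : ∀ u ∈ G, HasDerivAt γ
      ((P 2 u / Δ u - P 1 u * (P 0 u * Q 2 u - Q 0 u * P 2 u) / Δ u ^ 2) • c 0 u
        + (P 0 u * (P 0 u * Q 2 u - Q 0 u * P 2 u) / Δ u ^ 2) • c 1 u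
        - (P 0 u / Δ u) • c 2 u) u := fun u hu => by
    have hu' := hGI hu
    have hD := hGΔ u hu
    refine ((((dP 1 u hu').div (dΔ u hu') hD).smul (h.hasDerivAt 0 u hu')).add
      (((dP 0 u hu').div (dΔ u hu') hD).neg.smul (h.hasDerivAt 1 u hu'))).congr_deriv ?_
    simp only [zero_add, Nat.reduceAdd, Pi.div_apply, Pi.neg_apply]
    match_scalars <;> field_simp <;> ring
  have dτ : ∀ u ∈ G, HasDerivAt τ (-(k u) • deriv γ u) u := fun u hu => by
    have hu' := hGI hu
    have hD := hGΔ u hu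
    have hP := hGP u hu
    rw [(dγ u hu).deriv]
    refine ((((dQ 1 u hu').div (dΔ u hu') hD).neg.smul (h.hasDerivAt 0 u hu')).add
      (((dQ 0 u hu').div (dΔ u hu') hD).smul (h.hasDerivAt 1 u hu'))).congr_deriv ?_
    simp only [zero_add, Nat.reduceAdd, hk, Pi.div_apply, Pi.neg_apply]
    match_scalars
    · field_simp; ring
    · field_simp; simp only [hΔ]; ring
    · field_simp
  have hmγ : ∀ u, γ u ∈ Submodule.span ℝ {c 0 u, c 1 u} := fun u =>
    Submodule.mem_span_pair.2 ⟨_, _, rfl⟩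
  have hmτ : ∀ u, τ u ∈ Submodule.span ℝ {c 0 u, c 1 u} := fun u =>
    Submodule.mem_span_pair.2 ⟨_, _, rfl⟩
  have pair : ∀ (m : LieSpace 1) (x y u : ℝ), lieForm 1 (x • c 0 u + y • c 1 u) m =
      x * lieForm 1 m (c 0 u) + y * lieForm 1 m (c 1 u) := fun m x y u => by
    rw [lieForm_comm]; simp
  have hγq : ∀ u ∈ G, lieForm 1 (γ u) q = -1 := fun u hu => by
    have hD := hGΔ u hu
    rw [hγ, pair, ← div_self hD]
    simp only [hΔ]; ring
  have hγp : ∀ u ∈ G, lieForm 1 (γ u) p = 0 := fun u hu => by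
    rw [hγ, pair]; simp only [hPdef]; ring
  have hτp : ∀ u ∈ G, lieForm 1 (τ u) p = -1 := fun u hu => by
    have hD := hGΔ u hu
    rw [hτ, pair, ← div_self hD]
    simp only [hΔ]; ring
  have hτq : ∀ u ∈ G, lieForm 1 (τ u) q = 0 := fun u hu => by
    rw [hτ, pair]; simp only [hQdef]; ring
  have hγr : ∀ u ∈ G, lieForm 1 (γ u) r = -k u := fun u hu => by
    have hD := hGΔ u hu
    have hP := hGP u hu
    have e0 := r0 u (hGI hu)
    have e1 := r1 u (hGI hu)
    have : lieForm 1 (γ u) r = (P 1 u * R 0 u - P 0 u * R 1 u) / Δ u := by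
      rw [hγ, pair]; simp only [hRdef]; ring
    rw [this, hk, div_eq_iff hD]
    field_simp
    simp only [hΔ]
    linear_combination (-P 1 u) * e0 + P 0 u * e1
  have hτr : ∀ u ∈ G, lieForm 1 (τ u) r = k u ^ 2 / 2 := fun u hu => by
    have hD := hGΔ u hu
    have hP := hGP u hu
    have e0 := r0 u (hGI hu)
    have e1 := r1 u (hGI hu)
    have : lieForm 1 (τ u) r = (Q 0 u * R 1 u - Q 1 u * R 0 u) / Δ u := by
      rw [hτ, pair]; simp only [hRdef]; ring
    rw [this, hk, div_eq_iff hD]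
    field_simp
    simp only [hΔ]
    linear_combination (Q 0 u * P 1 u + P 0 u * Q 1 u) * e0 - 2 * Q 0 u * P 0 u * e1
  have hpos : ∀ u ∈ G, 0 < lieForm 1 (deriv γ u) (deriv γ u) := fun u hu => by
    have hu' := hGI hu
    have e : lieForm 1 (deriv γ u) (deriv γ u) =
        (P 0 u / Δ u) ^ 2 * lieForm 1 (c 2 u) (c 2 u) := by
      rw [(dγ u hu).deriv]
      simp only [map_sub, map_add, map_smul, LinearMap.sub_apply, LinearMap.add_apply,
        LinearMap.smul_apply, smul_eq_mul, h.null_zero u hu', h.null_one u hu', h.gram₀₁ hu',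
        h.gram₀₂ hu', h.gram₁₂ hu', lieForm_comm (c 1 u) (c 0 u), lieForm_comm (c 2 u) (c 0 u),
        lieForm_comm (c 2 u) (c 1 u)]
      ring
    rw [e]
    have := hGP u hu
    have := hGΔ u hu
    have := h.pos_two u hu'
    positivity
  refine ⟨γ, τ, k, lieForm 1 q r, -lieForm 1 p r, sγ, sτ, sk, fun u hu => ?_⟩
  have hu' := hGI hu
  have hP := hGP u hu
  have hD := hGΔ u hu
  refine ⟨⟨hmγ u, hγq u hu, hγp u hu⟩, ⟨hmτ u, hτp u hu, hτq u hu⟩, hpos u hu,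
    (dτ u hu).deriv, ?_⟩
  refine arcDeriv_arcDeriv_curvature hG sγ sτ sk hpq
    (fun x hx => h.isotropic_span (hGI hx) _ (hmγ x) _ (hmγ x))
    (fun x hx => h.isotropic_span (hGI hx) _ (hmγ x) _ (hmτ x))
    (fun x hx => h.isotropic_span (hGI hx) _ (hmτ x) _ (hmτ x))
    hγq hγp hτp hτq hpos (fun x hx => (dτ x hx).deriv) hγr hτr hu ?_
  intro X hXγ hXτ hXd hXp hXq
  have hc0 : c 0 u = (-Q 0 u) • γ u + (-P 0 u) • τ u := by
    simp only [hγ, hτ]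
    match_scalars
    · field_simp; simp only [hΔ]; ring
    · field_simp; ring
  have hc1 : c 1 u = (-Q 1 u) • γ u + (-P 1 u) • τ u := by
    simp only [hγ, hτ]
    match_scalars
    · field_simp; ring
    · field_simp; simp only [hΔ]; ring
  have x0 : lieForm 1 X (c 0 u) = 0 := by rw [hc0]; simp [hXγ, hXτ]
  have x1 : lieForm 1 X (c 1 u) = 0 := by rw [hc1]; simp [hXγ, hXτ]
  have x2 : lieForm 1 X (c 2 u) = 0 := by
    rw [(dγ u hu).deriv] at hXd
    simp only [map_sub, map_add, map_smul, x0, x1, mul_zero, add_zero, zero_sub, neg_eq_zero,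
      smul_eq_mul] at hXd
    exact (mul_eq_zero.1 hXd).resolve_left (div_ne_zero hP hD)
  have hmem := h.mem_span_of_perp hu' (x := X) (by rw [lieForm_comm, x0])
    (by rw [lieForm_comm, x1]) (by rw [lieForm_comm, x2])
  have hdis : Disjoint (Submodule.span ℝ {c 0 u, c 1 u}) (perp (Submodule.span ℝ {p, q})) := by
    by_contra hnd
    have : u ∈ projectionSingularSet I (fun u => Submodule.span ℝ {c 0 u, c 1 u}) p q := ⟨hu', hnd⟩
    rw [hsing] at this
    exact hP this.2
  refine Submodule.disjoint_def.1 hdis X hmem (mem_perp.2 fun a ha => ?_)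
  obtain ⟨x, y, rfl⟩ := Submodule.mem_span_pair.1 ha
  rw [lieForm_comm]
  simp [hXp, hXq]

end IsLegendreFrame

/-- A polarised Legendre frame with three conserved quantities whose pairings with the curve are
linearly independent spans a constrained elastic curve. -/
theorem IsPolarisedFrame.exists_constrainedElastic {I : Set ℝ} {c : ℕ → ℝ → LieSpace 1}
    {γ : ℕ → ℝ → ℝ} {ρ : ℝ} {e₁ e₂ e₃ : LieSpace 1}
    (h : IsPolarisedFrame I c γ ρ (Submodule.span ℝ {e₁, e₂, e₃}))
    (he₁ : ∀ u ∈ I, lieForm 1 e₁ (c 0 u) = -1) (he₂ : ∀ u ∈ I, lieForm 1 e₂ (c 1 u) ≠ 0)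
    (hw : ∃ u ∈ I, lieForm 1 e₂ (c 1 u) * lieForm 1 e₃ (c 2 u)
      - lieForm 1 e₂ (c 2 u) * lieForm 1 e₃ (c 1 u) ≠ 0)
    (hne : ρ ≠ 0 ∨ ∃ u ∈ I, γ 0 u ≠ 0) :
    IsConstrainedElasticWrt I (fun u => Submodule.span ℝ {c 0 u, c 1 u})
        (Submodule.span ℝ {e₁, e₂, e₃}) ∧
      ∃ p ∈ Submodule.span ℝ {e₁, e₂, e₃}, ∃ q ∈ Submodule.span ℝ {e₁, e₂, e₃},
        ProjectsToConstrainedElastic I (fun u => Submodule.span ℝ {c 0 u, c 1 u}) p q := by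
  have m₁ : e₁ ∈ Submodule.span ℝ {e₁, e₂, e₃} := Submodule.subset_span (by simp)
  have m₂ : e₂ ∈ Submodule.span ℝ {e₁, e₂, e₃} := Submodule.subset_span (by simp)
  have m₃ : e₃ ∈ Submodule.span ℝ {e₁, e₂, e₃} := Submodule.subset_span (by simp)
  obtain ⟨u₀, hu₀, -⟩ := id hw
  obtain ⟨hγ, hw₀⟩ := h.coeff_ne_zero_and_wronskian_ne_zero m₂ m₃ he₁ he₂ hw hne hu₀
  obtain ⟨k1, k2⟩ := h.pairing_eq_zero_of_const he₁
  have hdet : jetDet c e₁ e₂ e₃ u₀ ≠ 0 := by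
    have : jetDet c e₁ e₂ e₃ u₀ = -(lieForm 1 e₂ (c 1 u₀) * lieForm 1 e₃ (c 2 u₀)
        - lieForm 1 e₂ (c 2 u₀) * lieForm 1 e₃ (c 1 u₀)) := by
      simp only [jetDet, he₁ u₀ hu₀, k1 u₀ hu₀, k2 u₀ hu₀]
      ring
    rw [this]
    exact neg_ne_zero.2 hw₀
  have hrank : Module.finrank ℝ (Submodule.span ℝ {e₁, e₂, e₃}) = 3 := by
    have := finrank_span_eq_card (linearIndependent_of_jetDet_ne_zero hdet)
    have hr : Set.range ![e₁, e₂, e₃] = {e₁, e₂, e₃} := by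
      rw [Matrix.range_cons, Matrix.range_cons_cons_empty]; rfl
    rwa [hr, Fintype.card_fin] at this
  refine ⟨h.isConstrainedElasticWrt hrank hu₀ hγ, ?_⟩
  obtain ⟨p, hp, q, hq, r, -, hpp, hpq, hconic⟩ := h.exists_conic_frame m₁ m₂ m₃ hu₀ hγ
    (he₁ u₀ hu₀) (k1 u₀ hu₀) (k2 u₀ hu₀) hw₀
  exact ⟨p, hp, q, hq, h.toIsLegendreFrame.projectsToConstrainedElastic hpp hpq
    (fun u hu => (hconic u hu).1) (fun u hu => (hconic u hu).2) ⟨u₀, hu₀⟩⟩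

/-! ### Sections of smooth subbundles -/

section Sections

variable {n : ℕ} {E : Type*} [NormedAddCommGroup E] [NormedSpace ℝ E]

theorem ContDiffOn.differentiableAt_of_isOpen {G : Type*} [NormedAddCommGroup G]
    [NormedSpace ℝ G] {N : Set E} (hN : IsOpen N) {σ : E → G} (hσ : ContDiffOn ℝ ∞ σ N) {x : E}
    (hx : x ∈ N) : DifferentiableAt ℝ σ x :=
  (hσ.contDiffAt (hN.mem_nhds hx)).differentiableAt (by simp)

/-- Local sections agree with global ones near a given point. -/
theorem exists_isSmoothSection_eventuallyEq [FiniteDimensional ℝ E] {U N : Set E}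
    {F : E → Submodule ℝ (LieSpace n)} {σ : E → LieSpace n} {x : E} (hN : IsOpen N) (hx : x ∈ N)
    (hσ : ContDiffOn ℝ ∞ σ N) (hF : ∀ y ∈ N ∩ U, σ y ∈ F y) :
    ∃ τ, IsSmoothSection U F τ ∧ τ =ᶠ[nhds x] σ := by
  obtain ⟨ε, hε, hball⟩ := Metric.nhds_basis_closedBall.mem_iff.1 (hN.mem_nhds hx)
  let b : ContDiffBump x := ⟨ε / 2, ε, by positivity, by linarith⟩
  refine ⟨fun y => b y • σ y, ⟨fun y hy => ?_, fun y hy => ?_⟩, ?_⟩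
  · by_cases hyN : y ∈ N
    · exact (b.contDiff.contDiffAt.smul (hσ.contDiffAt (hN.mem_nhds hyN))).contDiffWithinAt
    · have h1 : (Metric.closedBall x ε)ᶜ ∈ nhds y :=
        Metric.isClosed_closedBall.isOpen_compl.mem_nhds fun h => hyN (hball h)
      have h2 : (fun y => b y • σ y) =ᶠ[nhds y] fun _ => 0 := by
        filter_upwards [h1] with z hz
        have : b z = 0 := b.zero_of_le_dist (le_of_lt (not_le.1 hz))
        rw [this, zero_smul]
      exact (contDiffAt_const.congr_of_eventuallyEq h2).contDiffWithinAt
  · by_cases hyN : y ∈ N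
    · exact Submodule.smul_mem _ _ (hF y ⟨hyN, hy⟩)
    · have : b y = 0 := b.zero_of_le_dist (le_of_lt (not_le.1 fun h => hyN (hball h)))
      simp [this]
  · filter_upwards [b.eventuallyEq_one] with y hy
    simp [hy]

theorem InCurvatureSpace.fderiv_mem [FiniteDimensional ℝ E] {U N : Set E}
    {f : E → Submodule ℝ (LieSpace n)} {s : Submodule ℝ (LieSpace n)} {x X : E}
    (h : InCurvatureSpace U f x s X) {σ : E → LieSpace n} (hN : IsOpen N) (hx : x ∈ N)
    (hσ : ContDiffOn ℝ ∞ σ N) (hF : ∀ y ∈ N ∩ U, σ y ∈ f y) (hs : σ x ∈ s) :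
    fderiv ℝ σ x X ∈ f x := by
  obtain ⟨τ, hτ, he⟩ := exists_isSmoothSection_eventuallyEq hN hx hσ hF
  rw [← he.fderiv_eq]
  exact h τ hτ (by rw [he.eq_of_nhds]; exact hs)

theorem exists_lieForm_ne_zero {x : LieSpace n} (hx : x ≠ 0) : ∃ z, lieForm n x z ≠ 0 := by
  by_contra h
  push Not at h
  exact hx (eq_zero_of_forall_lieForm h)

/-- A section of a line bundle which vanishes at a point has its derivatives there in the line. -/
theorem fderiv_mem_span_of_eq_zero {σ τ : E → LieSpace n} {x : E}
    (hσ : DifferentiableAt ℝ σ x) (hτ : DifferentiableAt ℝ τ x) (hσx : σ x ≠ 0)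
    (hmem : ∀ᶠ y in nhds x, τ y ∈ Submodule.span ℝ {σ y}) (hτx : τ x = 0) (X : E) :
    fderiv ℝ τ x X ∈ Submodule.span ℝ {σ x} := by
  obtain ⟨z, hz⟩ := exists_lieForm_ne_zero hσx
  have heq : (fun y => lieForm n (τ y) z • σ y) =ᶠ[nhds x] fun y => lieForm n (σ y) z • τ y := by
    filter_upwards [hmem] with y hy
    obtain ⟨t, ht⟩ := Submodule.mem_span_singleton.1 hy
    rw [← ht]
    simp only [map_smul, LinearMap.smul_apply, smul_eq_mul]
    module
  have dz := differentiableAt_const (𝕜 := ℝ) (E := E) (x := x) z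
  have hform : ∀ ρ : E → LieSpace n, DifferentiableAt ℝ ρ x →
      DifferentiableAt ℝ (fun y => lieForm n (ρ y) z) x := fun ρ hρ =>
    ((lieCLM n).differentiableAt.comp x hρ).clm_apply dz
  have h1 := congrArg (fun T : E →L[ℝ] LieSpace n => T X) heq.fderiv_eq
  simp only [fderiv_fun_smul (hform τ hτ) hσ, fderiv_fun_smul (hform σ hσ) hτ, add_apply,
    smul_apply, ContinuousLinearMap.smulRight_apply, fderiv_lieForm hτ dz,
    hτx, map_zero, LinearMap.zero_apply, zero_smul, zero_add, smul_zero, add_zero] at h1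
  rw [Submodule.mem_span_singleton]
  refine ⟨(lieForm n (σ x) z)⁻¹ * lieForm n (fderiv ℝ τ x X) z, ?_⟩
  have h2 : lieForm n (fderiv ℝ τ x X) z • σ x = lieForm n (σ x) z • fderiv ℝ τ x X := by
    simpa using h1
  rw [mul_smul, h2, smul_smul, inv_mul_cancel₀ hz, one_smul]

/-- If one nonvanishing section of a line bundle has its derivative in direction `X` in the line,
then all sections do. -/
theorem fderiv_mem_span_of_section {σ τ : E → LieSpace n} {x : E}
    (hσ : DifferentiableAt ℝ σ x) (hτ : DifferentiableAt ℝ τ x) (hσx : σ x ≠ 0)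
    (hmem : ∀ᶠ y in nhds x, τ y ∈ Submodule.span ℝ {σ y}) {X : E}
    (hX : fderiv ℝ σ x X ∈ Submodule.span ℝ {σ x}) :
    fderiv ℝ τ x X ∈ Submodule.span ℝ {σ x} := by
  obtain ⟨t, ht⟩ := Submodule.mem_span_singleton.1 hmem.self_of_nhds
  have h1 := fderiv_mem_span_of_eq_zero (τ := fun y => τ y - t • σ y) hσ
    (hτ.sub (hσ.const_smul t)) hσx (by
      filter_upwards [hmem] with y hy
      exact Submodule.sub_mem _ hy (Submodule.smul_mem _ _ (Submodule.mem_span_singleton_self _)))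
    (by simp [ht]) X
  have h3 : fderiv ℝ (fun y => τ y - t • σ y) x = fderiv ℝ τ x - t • fderiv ℝ σ x :=
    (hτ.hasFDerivAt.sub (hσ.hasFDerivAt.const_smul t)).fderiv
  rw [h3] at h1
  have h2 := Submodule.add_mem _ h1 (Submodule.smul_mem _ t hX)
  simpa using h2

theorem IsSmoothSubbundle.exists_local_section {U : Set E} {L : E → Submodule ℝ (LieSpace n)}
    (hL : IsSmoothSubbundle U 1 L) {x : E} (hx : x ∈ U) :
    ∃ N : Set E, IsOpen N ∧ x ∈ N ∧ ∃ σ : E → LieSpace n, ContDiffOn ℝ ∞ σ N ∧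
      ∀ y ∈ N ∩ U, σ y ≠ 0 ∧ L y = Submodule.span ℝ {σ y} := by
  obtain ⟨-, N, hN, hxN, σ, hσ, hspan⟩ := hL x hx
  refine ⟨N, hN, hxN, σ 0, hσ 0, fun y hy => ?_⟩
  have h1 : L y = Submodule.span ℝ {σ 0 y} := by
    rw [hspan y hy, Set.range_unique]
    rfl
  refine ⟨fun h0 => ?_, h1⟩
  have := (hL y hy.2).1
  rw [h1, h0, Submodule.span_zero_singleton, finrank_bot] at this
  omega

/-- A line bundle on which the functional `(·, φ)` vanishes nowhere has a unique section
normalised by this functional. -/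
theorem IsSmoothSubbundle.exists_normalised_section {U : Set E} (hU : IsOpen U)
    {L : E → Submodule ℝ (LieSpace n)} (hL : IsSmoothSubbundle U 1 L) {φ : E → LieSpace n}
    (hφ : ContDiffOn ℝ ∞ φ U) (hne : ∀ x ∈ U, ∀ y ∈ L x, y ≠ 0 → lieForm n y (φ x) ≠ 0) :
    ∃ s : E → LieSpace n, ContDiffOn ℝ ∞ s U ∧ ∀ x ∈ U, lieForm n (s x) (φ x) = -1 ∧
      L x = Submodule.span ℝ {s x} := by
  have hex : ∀ x, ∃ y, x ∈ U → lieForm n y (φ x) = -1 ∧ L x = Submodule.span ℝ {y} := by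
    intro x
    by_cases hx : x ∈ U
    · obtain ⟨N, -, hxN, σ, -, hspan⟩ := hL.exists_local_section hx
      obtain ⟨h0, h1⟩ := hspan x ⟨hxN, hx⟩
      have h2 := hne x hx (σ x) (by rw [h1]; exact Submodule.mem_span_singleton_self _) h0
      refine ⟨-(lieForm n (σ x) (φ x))⁻¹ • σ x, fun _ => ⟨?_, ?_⟩⟩
      · simp [h2]
      · rw [h1, Submodule.span_singleton_smul_eq (by simpa using h2)]
    · exact ⟨0, fun h => (hx h).elim⟩
  choose s hs using hex
  refine ⟨s, fun x hx => ?_, fun x hx => hs x hx⟩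
  obtain ⟨N, hN, hxN, σ, hσ, hspan⟩ := hL.exists_local_section hx
  have hne' : ∀ y ∈ N ∩ U, lieForm n (σ y) (φ y) ≠ 0 := fun y hy =>
    hne y hy.2 _ (by rw [(hspan y hy).2]; exact Submodule.mem_span_singleton_self _) (hspan y hy).1
  have hsm : ContDiffOn ℝ ∞ (fun y => -(lieForm n (σ y) (φ y))⁻¹ • σ y) (N ∩ U) :=
    (((hσ.mono Set.inter_subset_left).lieForm (hφ.mono Set.inter_subset_right)).inv
      hne').neg.smul (hσ.mono Set.inter_subset_left)
  have heq : s =ᶠ[nhds x] fun y => -(lieForm n (σ y) (φ y))⁻¹ • σ y := by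
    filter_upwards [(hN.inter hU).mem_nhds ⟨hxN, hx⟩] with y hy
    have h1 : s y ∈ Submodule.span ℝ {σ y} := by
      rw [← (hspan y hy).2, (hs y hy.2).2]
      exact Submodule.mem_span_singleton_self _
    obtain ⟨t, ht⟩ := Submodule.mem_span_singleton.1 h1
    have h2 := (hs y hy.2).1
    rw [← ht] at h2 ⊢
    simp only [map_smul, LinearMap.smul_apply, smul_eq_mul] at h2
    congr 1
    have ha := hne' y hy
    field_simp
    linarith
  exact ((hsm.contDiffAt ((hN.inter hU).mem_nhds ⟨hxN, hx⟩)).congr_of_eventuallyEq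
    heq).contDiffWithinAt

end Sections

/-! ### Spherical curvature lines -/

theorem DifferentiableAt.hasDerivAt_fst {G : Type*} [NormedAddCommGroup G] [NormedSpace ℝ G]
    {F : ℝ × ℝ → G} {u v : ℝ} (hF : DifferentiableAt ℝ F (u, v)) :
    HasDerivAt (fun t => F (t, v)) (fderiv ℝ F (u, v) (1, 0)) u :=
  hF.hasFDerivAt.comp_hasDerivAt u ((hasDerivAt_id u).prodMk (hasDerivAt_const u v))

theorem DifferentiableAt.hasDerivAt_snd {G : Type*} [NormedAddCommGroup G] [NormedSpace ℝ G]
    {F : ℝ × ℝ → G} {u v : ℝ} (hF : DifferentiableAt ℝ F (u, v)) :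
    HasDerivAt (fun t => F (u, t)) (fderiv ℝ F (u, v) (0, 1)) v :=
  hF.hasFDerivAt.comp_hasDerivAt v ((hasDerivAt_const v u).prodMk (hasDerivAt_id v))

theorem exists_mem_lieForm_ne_zero {n : ℕ} {F : Submodule ℝ (LieSpace n)}
    (hF : ∀ a ∈ F, ∀ b ∈ F, lieForm n a b = 0) (h2 : Module.finrank ℝ F = 2) {p : LieSpace n}
    (hp : lieForm n p p < 0) : ∃ a ∈ F, lieForm n a p ≠ 0 := by
  by_contra h
  push Not at h
  have := mem_of_perp_of_nonpos hF h2 h hp.le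
  exact hp.ne (hF p this p this)

/-- The point sphere of an isotropic two-plane is unique: two elements orthogonal to a timelike
vector are proportional. -/
theorem not_linearIndependent_of_isotropic_of_perp {n : ℕ} {a b p : LieSpace n}
    (hp : lieForm n p p < 0) (haa : lieForm n a a = 0) (hab : lieForm n a b = 0)
    (hbb : lieForm n b b = 0) (hap : lieForm n a p = 0) (hbp : lieForm n b p = 0) :
    ¬ LinearIndependent ℝ ![a, b] := by
  intro hli
  obtain ⟨x, hx, hxp⟩ := exists_mem_lieForm_ne_zero (isotropic_span_pair haa hab hbb)
    (finrank_span_pair_eq_two hli) hp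
  obtain ⟨s, t, rfl⟩ := Submodule.mem_span_pair.1 hx
  simp [hap, hbp] at hxp

theorem mem_span_singleton_of_not_linearIndependent {n : ℕ} {a b : LieSpace n} (ha : a ≠ 0)
    (h : ¬ LinearIndependent ℝ ![a, b]) : b ∈ Submodule.span ℝ {a} := by
  rw [LinearIndependent.pair_iff' ha] at h
  push Not at h
  exact Submodule.mem_span_singleton.2 h

theorem exists_mem_ne_zero_lieForm_eq_zero {n : ℕ} {F : Submodule ℝ (LieSpace n)}
    (h2 : Module.finrank ℝ F = 2) (p : LieSpace n) : ∃ a ∈ F, a ≠ 0 ∧ lieForm n a p = 0 := by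
  let ℓ : F →ₗ[ℝ] ℝ := (lieForm n p).domRestrict F
  have h : ¬ Function.Injective ℓ := fun hinj => by
    have := LinearMap.finrank_le_finrank_of_injective hinj
    rw [h2, Module.finrank_self] at this
    omega
  rw [← LinearMap.ker_eq_bot, Submodule.eq_bot_iff] at h
  push Not at h
  obtain ⟨a, ha, hne⟩ := h
  exact ⟨a, a.2, fun h0 => hne (Subtype.ext h0), by rw [lieForm_comm]; exact ha⟩

/-- A linear functional which does not vanish on the two-planes of a bundle is represented by a
section on the value of any other functional: there is a smooth `h` with
`(a, e) + h (a, p) = 0` whenever `(a, e) = 0` for all `a` in the bundle with `(a, p) = 0`. -/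
theorem IsSmoothSubbundle.exists_ratio {n : ℕ} {E : Type*} [NormedAddCommGroup E]
    [NormedSpace ℝ E] {U : Set E} (hU : IsOpen U) {k : ℕ} {f : E → Submodule ℝ (LieSpace n)}
    (hf : IsSmoothSubbundle U k f) {p : LieSpace n} {e : E → LieSpace n}
    (he : ContDiffOn ℝ ∞ e U) (hp : ∀ x ∈ U, ∃ a ∈ f x, lieForm n a p ≠ 0)
    (hpe : ∀ x ∈ U, ∀ a ∈ f x, lieForm n a p = 0 → lieForm n a (e x) = 0) :
    ∃ h : E → ℝ, ContDiffOn ℝ ∞ h U ∧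
      ∀ x ∈ U, ∀ a ∈ f x, lieForm n a (e x) + h x * lieForm n a p = 0 := by
  have hex : ∀ x, ∃ h : ℝ, x ∈ U → ∀ a ∈ f x, lieForm n a (e x) + h * lieForm n a p = 0 := by
    intro x
    by_cases hx : x ∈ U
    · obtain ⟨b, hb, hbp⟩ := hp x hx
      refine ⟨-(lieForm n b (e x) / lieForm n b p), fun _ a ha => ?_⟩
      have h1 := hpe x hx (a - (lieForm n a p / lieForm n b p) • b)
        (Submodule.sub_mem _ ha (Submodule.smul_mem _ _ hb)) (by
          simp only [map_sub, map_smul, LinearMap.sub_apply, LinearMap.smul_apply, smul_eq_mul]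
          field_simp
          ring)
      simp only [map_sub, map_smul, LinearMap.sub_apply, LinearMap.smul_apply, smul_eq_mul] at h1
      linear_combination h1
    · exact ⟨0, fun h => (hx h).elim⟩
  choose h hh using hex
  refine ⟨h, fun x hx => ?_, hh⟩
  obtain ⟨-, N, hN, hxN, σ, hσ, hspan⟩ := hf x hx
  obtain ⟨i, hi⟩ : ∃ i, lieForm n (σ i x) p ≠ 0 := by
    by_contra hcon
    push Not at hcon
    obtain ⟨a, ha, hap⟩ := hp x hx
    apply hap
    clear hap
    rw [hspan x ⟨hxN, hx⟩] at ha
    induction ha using Submodule.span_induction with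
    | mem a ha => obtain ⟨i, rfl⟩ := ha; exact hcon i
    | zero => simp
    | add a b _ _ ha hb => simp [ha, hb]
    | smul c a _ ha => simp [ha]
  have hσx : ContDiffAt ℝ ∞ (σ i) x := (hσ i).contDiffAt (hN.mem_nhds hxN)
  have hform : ∀ w : E → LieSpace n, ContDiffAt ℝ ∞ w x →
      ContDiffAt ℝ ∞ (fun y => lieForm n (σ i y) (w y)) x := fun w hw => by
    rw [← contDiffWithinAt_univ] at *
    exact ((lieCLM n).contDiff.contDiffAt.comp_contDiffWithinAt x hσx).clm_apply hw
  have hp1 := hform (fun _ => p) contDiffAt_const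
  have hcd := ((hform e (he.contDiffAt (hU.mem_nhds hx))).div hp1 hi).neg
  refine (hcd.congr_of_eventuallyEq ?_).contDiffWithinAt
  filter_upwards [hp1.continuousAt.eventually_ne hi, (hN.inter hU).mem_nhds ⟨hxN, hx⟩] with y hy hyN
  have h1 := hh y hyN.2 (σ i y) (by rw [hspan y hyN]; exact Submodule.subset_span ⟨i, rfl⟩)
  simp only [Pi.div_apply]
  field_simp
  linarith

/-- The spherical `u`-parameter line at `v` lies in the orthogonal complement of a unit spacelike
vector `q v`: the sphere `ν` and the point sphere complex `p` span a Lorentz plane, in which the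
bundle has a normal. Its direction does not vary along the line, because the line is a curvature
line whose curvature sphere is immersed (Joachimsthal's theorem). -/
theorem exists_unit_normal {I₁ I₂ : Set ℝ} (hI₁ : IsOpen I₁) (hI₁' : I₁.OrdConnected)
    (hI₂ : IsOpen I₂) {f s₁ s₂ : ℝ × ℝ → Submodule ℝ (LieSpace 2)} (hne : I₁.Nonempty)
    (hf : IsLegendreMap (I₁ ×ˢ I₂) f)
    (hcurv : IsCurvatureLineParametrisation (I₁ ×ˢ I₂) f s₁ s₂)
    (hreg₁ : IsImmersedBundle (I₁ ×ˢ I₂) s₁) (hsph : HasSphericalLines (I₁ ×ˢ I₂) f (1, 0)) :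
    ∃ q : ℝ → LieSpace 2, ContDiffOn ℝ ∞ q I₂ ∧ (∀ v ∈ I₂, lieForm 2 (q v) (q v) = 1) ∧
      ∀ u ∈ I₁, ∀ v ∈ I₂, ∀ a ∈ f (u, v), lieForm 2 a (q v) = 0 := by
  obtain ⟨u₀, hu₀⟩ := hne
  set U := I₁ ×ˢ I₂ with hUdef
  have hU : IsOpen U := hI₁.prod hI₂
  obtain ⟨p, hpp, ν, hνs, hνn, hνc, hνo, hνt⟩ := hsph
  have hp0 : lieForm 2 p p < 0 := by rw [hpp]; norm_num
  have hfr : ∀ x ∈ U, Module.finrank ℝ (f x) = 2 := fun x hx => (hf.smooth x hx).1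
  have hνp : ∀ x ∈ U, ∀ y ∈ ν x, y ≠ 0 → lieForm 2 y p ≠ 0 := by
    intro x hx y hy hy0 hyp
    obtain ⟨a, ha, ha0, hap⟩ := exists_mem_ne_zero_lieForm_eq_zero (hfr x hx) p
    have hli := not_linearIndependent_of_isotropic_of_perp hp0 (hνn x hx y hy y hy)
      (by rw [lieForm_comm]; exact hνo x hx a ha hap y hy) (hf.isotropic x hx a ha a ha) hyp hap
    have hmem := mem_span_singleton_of_not_linearIndependent hy0 hli
    obtain ⟨t, rfl⟩ := Submodule.mem_span_singleton.1 hmem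
    exact ha0 (Submodule.disjoint_def.1 (hνt x hx) _ ha
      (Submodule.mem_sup_left (Submodule.smul_mem _ _ hy)))
  obtain ⟨m, hms, hm⟩ := hνs.exists_normalised_section hU (contDiffOn_const (c := p)) hνp
  have hmν : ∀ x ∈ U, m x ∈ ν x := fun x hx => by
    rw [(hm x hx).2]; exact Submodule.mem_span_singleton_self _
  have hmm : ∀ x ∈ U, lieForm 2 (m x) (m x) = 0 := fun x hx => hνn x hx _ (hmν x hx) _ (hmν x hx)
  have hmc : ∀ u ∈ I₁, ∀ v ∈ I₂, m (u, v) = m (u₀, v) := by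
    intro u hu v hv
    have h1 := hνc (u₀, v) ⟨hu₀, hv⟩ (u - u₀) (by simpa [hUdef] using (⟨hu, hv⟩ : u ∈ I₁ ∧ v ∈ I₂))
    have h2 : m (u, v) ∈ ν (u₀, v) := by
      rw [← h1]
      simpa using hmν (u, v) ⟨hu, hv⟩
    rw [(hm _ ⟨hu₀, hv⟩).2] at h2
    obtain ⟨t, ht⟩ := Submodule.mem_span_singleton.1 h2
    have h3 := (hm (u, v) ⟨hu, hv⟩).1
    rw [← ht, map_smul, LinearMap.smul_apply, (hm _ ⟨hu₀, hv⟩).1] at h3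
    have ht1 : t = 1 := by simpa using h3
    rw [← ht, ht1, one_smul]
  -- `e` is the sphere as a vector of the conformal model `p^⊥`.
  set e : ℝ × ℝ → LieSpace 2 := fun x => m x - p with he
  have hes : ContDiffOn ℝ ∞ e U := hms.sub contDiffOn_const
  have hep : ∀ x ∈ U, lieForm 2 (e x) p = 0 := fun x hx => by
    simp [he, (hm x hx).1, hpp]
  have hee : ∀ x ∈ U, lieForm 2 (e x) (e x) = 1 := fun x hx => by
    simp only [he, map_sub, LinearMap.sub_apply, hmm x hx, (hm x hx).1, hpp,
      lieForm_comm p (m x)]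
    norm_num
  -- `e + h p` is the normal of `f` in the span of `ν` and `p`.
  obtain ⟨h, hhs, hh⟩ := hf.smooth.exists_ratio hU hes
    (fun x hx => exists_mem_lieForm_ne_zero (hf.isotropic x hx) (hfr x hx) hp0)
    (fun x hx a ha hap => by
      simp [he, hap, hνo x hx a ha hap _ (hmν x hx)])
  have hQ : ∀ x ∈ U, 0 < 1 - h x ^ 2 := by
    intro x hx
    have hQf : ∀ a ∈ f x, lieForm 2 a (e x + h x • p) = 0 := fun a ha => by
      rw [map_add, map_smul, smul_eq_mul]; exact hh x hx a ha
    have hQQ : lieForm 2 (e x + h x • p) (e x + h x • p) = 1 - h x ^ 2 := by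
      simp only [map_add, map_smul, LinearMap.add_apply, LinearMap.smul_apply, smul_eq_mul,
        hee x hx, hep x hx, lieForm_comm p (e x), hpp]
      ring
    rw [← hQQ]
    apply lieForm_self_pos_of_perp (hf.isotropic x hx) (hfr x hx) hQf
    intro hmem
    have h0 : e x + h x • p = 0 := by
      refine Submodule.disjoint_def.1 (hνt x hx) _ hmem ?_
      have : e x + h x • p = m x + (h x - 1) • p := by rw [he]; module
      rw [this]
      exact Submodule.add_mem_sup (hmν x hx)
        (Submodule.smul_mem _ _ (Submodule.mem_span_singleton_self _))
    have h1 : lieForm 2 (e x) (e x + h x • p) = 1 := by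
      rw [map_add, map_smul, hee x hx, hep x hx]; simp
    rw [h0] at h1
    simp at h1
  have hdiffe : ∀ x ∈ U, fderiv ℝ e x (1, 0) = 0 := by
    rintro ⟨u, v⟩ ⟨hu, hv⟩
    have h1 := (hes.differentiableAt_of_isOpen hU (x := (u, v)) ⟨hu, hv⟩).hasDerivAt_fst
    exact h1.eq_zero_of_eqOn_const hI₁ hu (k := m (u₀, v) - p) fun t ht => by
      simp only [he, hmc t ht v hv]
  -- Differentiating `(σ, e + h p) = 0` for a section `σ` of `s₁` gives `h_u (σ, p) = 0`. Were
  -- `h_u ≠ 0`, then `σ` would be the point sphere map near `x`, and `∂ᵤσ ∈ f ∩ p^⊥` a multiple of `σ`,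
  -- against the immersion property of `s₁`.
  have hhu : ∀ x ∈ U, fderiv ℝ h x (1, 0) = 0 := by
    intro x hx
    by_contra hne
    obtain ⟨N, hN, hxN, σ, hσ, hspan⟩ := hcurv.smooth₁.exists_local_section hx
    have hσf : ∀ y ∈ N ∩ U, σ y ∈ f y := fun y hy => hcurv.le₁ y hy.2 (by
      rw [(hspan y hy).2]; exact Submodule.mem_span_singleton_self _)
    have hσu : ∀ y ∈ N ∩ U, fderiv ℝ σ y (1, 0) ∈ f y := fun y hy =>
      (hcurv.curvature₁ y hy.2).fderiv_mem hN hy.1 hσ hσf (by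
        rw [(hspan y hy).2]; exact Submodule.mem_span_singleton_self _)
    have hNU : IsOpen (N ∩ U) := hN.inter hU
    have dσ : ∀ y ∈ N ∩ U, DifferentiableAt ℝ σ y := fun y hy =>
      hσ.differentiableAt_of_isOpen hN hy.1
    have hzero : ∀ y ∈ N ∩ U, fderiv ℝ h y (1, 0) * lieForm 2 (σ y) p = 0 := by
      intro y hy
      have de := hes.differentiableAt_of_isOpen hU hy.2
      have dh := hhs.differentiableAt_of_isOpen hU hy.2
      have h1 : (fun z => lieForm 2 (σ z) (e z + h z • p)) =ᶠ[nhds y] fun _ => 0 := by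
        filter_upwards [hNU.mem_nhds hy] with z hz
        rw [map_add, map_smul, smul_eq_mul]
        exact hh z hz.2 _ (hσf z hz)
      have h2 := congrArg (fun T : ℝ × ℝ →L[ℝ] ℝ => T (1, 0)) h1.fderiv_eq
      have h3 : fderiv ℝ (fun z => e z + h z • p) y (1, 0) = fderiv ℝ h y (1, 0) • p := by
        have h4 : HasFDerivAt (fun z => e z + h z • p) _ y :=
          de.hasFDerivAt.add (dh.hasFDerivAt.smul_const p)
        rw [h4.fderiv]
        simp [hdiffe y hy.2]
      have dQ : DifferentiableAt ℝ (fun z => e z + h z • p) y := de.add (dh.smul_const p)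
      simp only [fderiv_lieForm (dσ y hy) dQ, h3, fderiv_fun_const] at h2
      have h5 := hh y hy.2 _ (hσu y hy)
      simp only [map_add, map_smul, smul_eq_mul] at h2
      rw [h5, zero_add] at h2
      simpa using h2
    have hcont : ContinuousAt (fun y => fderiv ℝ h y (1, 0)) x :=
      ((hhs.contDiffAt (hU.mem_nhds hx)).fderiv_right (m := 0) (by simp)).continuousAt.clm_apply
        continuousAt_const
    have hσp : (fun y => lieForm 2 (σ y) p) =ᶠ[nhds x] fun _ => 0 := by
      filter_upwards [hcont.eventually_ne hne, hNU.mem_nhds ⟨hxN, hx⟩] with y hy hyN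
      exact (mul_eq_zero.1 (hzero y hyN)).resolve_left hy
    have hxNU : x ∈ N ∩ U := ⟨hxN, hx⟩
    have h1 := congrArg (fun T : ℝ × ℝ →L[ℝ] ℝ => T (1, 0)) hσp.fderiv_eq
    simp only [fderiv_lieForm (dσ x hxNU) (differentiableAt_const p), fderiv_fun_const] at h1
    have h2 : lieForm 2 (fderiv ℝ σ x (1, 0)) p = 0 := by simpa using h1
    have hσ0 := (hspan x hxNU).1
    have hiso := hf.isotropic x hx
    have hmem := mem_span_singleton_of_not_linearIndependent hσ0
      (not_linearIndependent_of_isotropic_of_perp hp0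
        (hiso _ (hσf x hxNU) _ (hσf x hxNU)) (hiso _ (hσf x hxNU) _ (hσu x hxNU))
        (hiso _ (hσu x hxNU) _ (hσu x hxNU)) hσp.self_of_nhds h2)
    have h3 := hreg₁ x hx (1, 0) fun τ hτ => by
      rw [(hspan x hxNU).2]
      refine fderiv_mem_span_of_section (dσ x hxNU) (hτ.1.differentiableAt_of_isOpen hU hx) hσ0
        ?_ hmem
      filter_upwards [hNU.mem_nhds hxNU] with y hy
      rw [← (hspan y hy).2]
      exact hτ.2 y hy.2
    simpa using congrArg Prod.fst h3
  have hhc : ∀ u ∈ I₁, ∀ v ∈ I₂, h (u, v) = h (u₀, v) := by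
    intro u hu v hv
    refine eq_of_hasDerivAt_zero hI₁' (F := fun t => h (t, v)) (fun t ht => ?_) u hu u₀ hu₀
    have := (hhs.differentiableAt_of_isOpen hU (x := (t, v)) ⟨ht, hv⟩).hasDerivAt_fst
    rwa [hhu (t, v) ⟨ht, hv⟩] at this
  have hline : ContDiffOn ℝ ∞ (fun v : ℝ => (u₀, v)) I₂ :=
    contDiffOn_const.prodMk contDiffOn_id
  have hmaps : Set.MapsTo (fun v : ℝ => (u₀, v)) I₂ U := fun v hv => ⟨hu₀, hv⟩
  have h1s : ContDiffOn ℝ ∞ (fun v => h (u₀, v)) I₂ := hhs.comp hline hmaps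
  have hes' : ContDiffOn ℝ ∞ (fun v => e (u₀, v)) I₂ := hes.comp hline hmaps
  refine ⟨fun v => (Real.sqrt (1 - h (u₀, v) ^ 2))⁻¹ • (e (u₀, v) + h (u₀, v) • p), ?_, ?_, ?_⟩
  · refine ContDiffOn.smul (ContDiffOn.inv (ContDiffOn.sqrt (contDiffOn_const.sub (h1s.pow 2))
      fun v hv => (hQ _ (hmaps hv)).ne') fun v hv => (Real.sqrt_pos.2 (hQ _ (hmaps hv))).ne')
      (hes'.add (h1s.smul contDiffOn_const))
  · intro v hv
    have hx := hmaps hv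
    have hpos := hQ _ hx
    have hs := Real.mul_self_sqrt hpos.le
    have hs0 := (Real.sqrt_pos.2 hpos).ne'
    simp only at hpos hs hs0
    simp only [map_add, map_smul, LinearMap.add_apply, LinearMap.smul_apply, smul_eq_mul,
      hee _ hx, hep _ hx, lieForm_comm p (e (u₀, v)), hpp]
    field_simp
    rw [sq (Real.sqrt _), hs]
    ring
  · intro u hu v hv a ha
    have h1 := hh (u, v) ⟨hu, hv⟩ a ha
    have h2 : e (u, v) = e (u₀, v) := by simp only [he, hmc u hu v hv]
    rw [h2, hhc u hu v hv] at h1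
    rw [map_smul, map_add, map_smul, smul_eq_mul, smul_eq_mul, h1, mul_zero]

/-! ### Partial derivatives on open subsets of the plane -/

section Partial

variable {G : Type*} [NormedAddCommGroup G] [NormedSpace ℝ G]

/-- The partial derivative of a map of the plane in the first variable. -/
noncomputable def du (F : ℝ × ℝ → G) (x : ℝ × ℝ) : G := fderiv ℝ F x (1, 0)

/-- The partial derivative of a map of the plane in the second variable. -/
noncomputable def dv (F : ℝ × ℝ → G) (x : ℝ × ℝ) : G := fderiv ℝ F x (0, 1)

variable {U : Set (ℝ × ℝ)} {F : ℝ × ℝ → G}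

theorem ContDiffOn.fderiv_dir (hU : IsOpen U) (hF : ContDiffOn ℝ ∞ F U) (X : ℝ × ℝ) :
    ContDiffOn ℝ ∞ (fun x => fderiv ℝ F x X) U :=
  (hF.fderiv_of_isOpen hU (by simp)).clm_apply contDiffOn_const

theorem ContDiffOn.du (hU : IsOpen U) (hF : ContDiffOn ℝ ∞ F U) : ContDiffOn ℝ ∞ (du F) U :=
  hF.fderiv_dir hU _

theorem ContDiffOn.dv (hU : IsOpen U) (hF : ContDiffOn ℝ ∞ F U) : ContDiffOn ℝ ∞ (dv F) U :=
  hF.fderiv_dir hU _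

theorem dv_du_eq (hU : IsOpen U) (hF : ContDiffOn ℝ ∞ F U) {x : ℝ × ℝ} (hx : x ∈ U) :
    dv (du F) x = du (dv F) x := by
  have hFx := hF.contDiffAt (hU.mem_nhds hx)
  have hd : DifferentiableAt ℝ (fderiv ℝ F) x :=
    (hFx.fderiv_right (m := ∞) (by simp)).differentiableAt (by simp)
  have hs : IsSymmSndFDerivAt ℝ F x :=
    hFx.isSymmSndFDerivAt (by
      rw [minSmoothness_of_isRCLikeNormedField]; exact WithTop.coe_le_coe.2 le_top)
  have h : ∀ X Y : ℝ × ℝ, fderiv ℝ (fun y => fderiv ℝ F y X) x Y =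
      fderiv ℝ (fderiv ℝ F) x Y X := fun X Y => by
    rw [(hd.hasFDerivAt.clm_apply (hasFDerivAt_const X x)).fderiv]
    simp
  exact (h _ _).trans ((hs.eq _ _).trans (h _ _).symm)

theorem du_congr (hU : IsOpen U) {F' : ℝ × ℝ → G} (h : ∀ x ∈ U, F x = F' x) {x : ℝ × ℝ}
    (hx : x ∈ U) : du F x = du F' x := by
  have : F =ᶠ[nhds x] F' := by filter_upwards [hU.mem_nhds hx] with y hy using h y hy
  simp only [du, this.fderiv_eq]

theorem dv_congr (hU : IsOpen U) {F' : ℝ × ℝ → G} (h : ∀ x ∈ U, F x = F' x) {x : ℝ × ℝ}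
    (hx : x ∈ U) : dv F x = dv F' x := by
  have : F =ᶠ[nhds x] F' := by filter_upwards [hU.mem_nhds hx] with y hy using h y hy
  simp only [dv, this.fderiv_eq]

theorem du_eq_zero_of_const (hU : IsOpen U) {k : G} (h : ∀ x ∈ U, F x = k) {x : ℝ × ℝ}
    (hx : x ∈ U) : du F x = 0 := by
  rw [du_congr hU h hx]; simp [du]

theorem dv_eq_zero_of_const (hU : IsOpen U) {k : G} (h : ∀ x ∈ U, F x = k) {x : ℝ × ℝ}
    (hx : x ∈ U) : dv F x = 0 := by
  rw [dv_congr hU h hx]; simp [dv]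

theorem du_lieForm {n : ℕ} (hU : IsOpen U) {F F' : ℝ × ℝ → LieSpace n} (hF : ContDiffOn ℝ ∞ F U)
    (hF' : ContDiffOn ℝ ∞ F' U) {x : ℝ × ℝ} (hx : x ∈ U) :
    du (fun y => lieForm n (F y) (F' y)) x = lieForm n (du F x) (F' x) + lieForm n (F x) (du F' x) :=
  fderiv_lieForm (hF.differentiableAt_of_isOpen hU hx) (hF'.differentiableAt_of_isOpen hU hx) _

theorem dv_lieForm {n : ℕ} (hU : IsOpen U) {F F' : ℝ × ℝ → LieSpace n} (hF : ContDiffOn ℝ ∞ F U)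
    (hF' : ContDiffOn ℝ ∞ F' U) {x : ℝ × ℝ} (hx : x ∈ U) :
    dv (fun y => lieForm n (F y) (F' y)) x = lieForm n (dv F x) (F' x) + lieForm n (F x) (dv F' x) :=
  fderiv_lieForm (hF.differentiableAt_of_isOpen hU hx) (hF'.differentiableAt_of_isOpen hU hx) _

theorem du_lieForm_eq_zero {n : ℕ} (hU : IsOpen U) {F F' : ℝ × ℝ → LieSpace n}
    (hF : ContDiffOn ℝ ∞ F U) (hF' : ContDiffOn ℝ ∞ F' U) {k : ℝ}
    (h : ∀ x ∈ U, lieForm n (F x) (F' x) = k) {x : ℝ × ℝ} (hx : x ∈ U) :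
    lieForm n (du F x) (F' x) + lieForm n (F x) (du F' x) = 0 := by
  rw [← du_lieForm hU hF hF' hx]
  exact du_eq_zero_of_const hU h hx

theorem dv_lieForm_eq_zero {n : ℕ} (hU : IsOpen U) {F F' : ℝ × ℝ → LieSpace n}
    (hF : ContDiffOn ℝ ∞ F U) (hF' : ContDiffOn ℝ ∞ F' U) {k : ℝ}
    (h : ∀ x ∈ U, lieForm n (F x) (F' x) = k) {x : ℝ × ℝ} (hx : x ∈ U) :
    lieForm n (dv F x) (F' x) + lieForm n (F x) (dv F' x) = 0 := by
  rw [← dv_lieForm hU hF hF' hx]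
  exact dv_eq_zero_of_const hU h hx

theorem du_sub (hU : IsOpen U) {F' : ℝ × ℝ → G} (hF : ContDiffOn ℝ ∞ F U)
    (hF' : ContDiffOn ℝ ∞ F' U) {x : ℝ × ℝ} (hx : x ∈ U) :
    du (fun y => F y - F' y) x = du F x - du F' x := by
  have : HasFDerivAt (fun y => F y - F' y) _ x :=
    (hF.differentiableAt_of_isOpen hU hx).hasFDerivAt.sub
      (hF'.differentiableAt_of_isOpen hU hx).hasFDerivAt
  simp only [du, this.fderiv]; rfl

theorem du_add (hU : IsOpen U) {F' : ℝ × ℝ → G} (hF : ContDiffOn ℝ ∞ F U)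
    (hF' : ContDiffOn ℝ ∞ F' U) {x : ℝ × ℝ} (hx : x ∈ U) :
    du (fun y => F y + F' y) x = du F x + du F' x := by
  have : HasFDerivAt (fun y => F y + F' y) _ x :=
    (hF.differentiableAt_of_isOpen hU hx).hasFDerivAt.add
      (hF'.differentiableAt_of_isOpen hU hx).hasFDerivAt
  simp only [du, this.fderiv]; rfl

theorem dv_add (hU : IsOpen U) {F' : ℝ × ℝ → G} (hF : ContDiffOn ℝ ∞ F U)
    (hF' : ContDiffOn ℝ ∞ F' U) {x : ℝ × ℝ} (hx : x ∈ U) :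
    dv (fun y => F y + F' y) x = dv F x + dv F' x := by
  have : HasFDerivAt (fun y => F y + F' y) _ x :=
    (hF.differentiableAt_of_isOpen hU hx).hasFDerivAt.add
      (hF'.differentiableAt_of_isOpen hU hx).hasFDerivAt
  simp only [dv, this.fderiv]; rfl

theorem du_smul (hU : IsOpen U) {φ : ℝ × ℝ → ℝ} (hφ : ContDiffOn ℝ ∞ φ U)
    (hF : ContDiffOn ℝ ∞ F U) {x : ℝ × ℝ} (hx : x ∈ U) :
    du (fun y => φ y • F y) x = du φ x • F x + φ x • du F x := by
  have : HasFDerivAt (fun y => φ y • F y) _ x :=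
    (hφ.differentiableAt_of_isOpen hU hx).hasFDerivAt.smul
      (hF.differentiableAt_of_isOpen hU hx).hasFDerivAt
  simp [du, this.fderiv, add_comm]

theorem dv_smul (hU : IsOpen U) {φ : ℝ × ℝ → ℝ} (hφ : ContDiffOn ℝ ∞ φ U)
    (hF : ContDiffOn ℝ ∞ F U) {x : ℝ × ℝ} (hx : x ∈ U) :
    dv (fun y => φ y • F y) x = dv φ x • F x + φ x • dv F x := by
  have : HasFDerivAt (fun y => φ y • F y) _ x :=
    (hφ.differentiableAt_of_isOpen hU hx).hasFDerivAt.smul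
      (hF.differentiableAt_of_isOpen hU hx).hasFDerivAt
  simp [dv, this.fderiv, add_comm]

variable {I₁ I₂ : Set ℝ}

theorem contDiffOn_comp_snd {q : ℝ → G} (hq : ContDiffOn ℝ ∞ q I₂) :
    ContDiffOn ℝ ∞ (fun x : ℝ × ℝ => q x.2) (I₁ ×ˢ I₂) :=
  hq.comp contDiff_snd.contDiffOn fun _ hx => hx.2

theorem contDiffOn_comp_fst {q : ℝ → G} (hq : ContDiffOn ℝ ∞ q I₁) :
    ContDiffOn ℝ ∞ (fun x : ℝ × ℝ => q x.1) (I₁ ×ˢ I₂) :=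
  hq.comp contDiff_fst.contDiffOn fun _ hx => hx.1

theorem du_comp_snd (q : ℝ → G) {x : ℝ × ℝ} (hq : DifferentiableAt ℝ q x.2) :
    du (fun y : ℝ × ℝ => q y.2) x = 0 := by
  have : HasFDerivAt (fun y : ℝ × ℝ => q y.2) _ x := hq.hasFDerivAt.comp x hasFDerivAt_snd
  simp [du, this.fderiv]

theorem dv_comp_snd (q : ℝ → G) {x : ℝ × ℝ} (hq : DifferentiableAt ℝ q x.2) :
    dv (fun y : ℝ × ℝ => q y.2) x = deriv q x.2 := by
  have : HasFDerivAt (fun y : ℝ × ℝ => q y.2) _ x := hq.hasFDerivAt.comp x hasFDerivAt_snd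
  simp [dv, this.fderiv]

theorem du_comp_fst (q : ℝ → G) {x : ℝ × ℝ} (hq : DifferentiableAt ℝ q x.1) :
    du (fun y : ℝ × ℝ => q y.1) x = deriv q x.1 := by
  have : HasFDerivAt (fun y : ℝ × ℝ => q y.1) _ x := hq.hasFDerivAt.comp x hasFDerivAt_fst
  simp [du, this.fderiv]

theorem dv_comp_fst (q : ℝ → G) {x : ℝ × ℝ} (hq : DifferentiableAt ℝ q x.1) :
    dv (fun y : ℝ × ℝ => q y.1) x = 0 := by
  have : HasFDerivAt (fun y : ℝ × ℝ => q y.1) _ x := hq.hasFDerivAt.comp x hasFDerivAt_fst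
  simp [dv, this.fderiv]

end Partial

/-! ### The normalised lift of the curvature sphere congruence -/

/-- `q` is a unit normal of `f` depending on the second variable only. -/
structure IsUnitNormal (I₁ I₂ : Set ℝ) (f : ℝ × ℝ → Submodule ℝ (LieSpace 2))
    (q : ℝ → LieSpace 2) : Prop where
  smooth : ContDiffOn ℝ ∞ q I₂
  unit : ∀ v ∈ I₂, lieForm 2 (q v) (q v) = 1
  normal : ∀ u ∈ I₁, ∀ v ∈ I₂, ∀ a ∈ f (u, v), lieForm 2 a (q v) = 0

/-- The lift `s` of the first curvature sphere congruence normalised by `(s, q') = -1`. Its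
derivative spans the second one, and `s_v = q + (s, q'') s`. -/
structure IsNormalisedLift (I₁ I₂ : Set ℝ) (f : ℝ × ℝ → Submodule ℝ (LieSpace 2))
    (q : ℝ → LieSpace 2) (s : ℝ × ℝ → LieSpace 2) : Prop where
  smooth : ContDiffOn ℝ ∞ s (I₁ ×ˢ I₂)
  norm : ∀ x ∈ I₁ ×ˢ I₂, lieForm 2 (s x) (deriv q x.2) = -1
  span : ∀ x ∈ I₁ ×ˢ I₂, f x = Submodule.span ℝ {s x, du s x}
  pos : ∀ x ∈ I₁ ×ˢ I₂, 0 < lieForm 2 (du (du s) x) (du (du s) x)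
  dv_eq : ∀ x ∈ I₁ ×ˢ I₂, dv s x = q x.2 + lieForm 2 (s x) (deriv (deriv q) x.2) • s x
  reg : ∀ x ∈ I₁ ×ˢ I₂, lieForm 2 (du s x) (deriv (deriv q) x.2) ≠ 0

namespace IsCurvatureLineParametrisation

variable {U : Set (ℝ × ℝ)} {f s₁ s₂ : ℝ × ℝ → Submodule ℝ (LieSpace 2)}

/-- A section that vanishes at a point has its coordinate derivatives there in `f`, because `0` lies
in both curvature spheres. -/
theorem fderiv_mem_of_eq_zero (h : IsCurvatureLineParametrisation U f s₁ s₂)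
    {τ : ℝ × ℝ → LieSpace 2} (hτ : IsSmoothSection U f τ) {x : ℝ × ℝ} (hx : x ∈ U)
    (h0 : τ x = 0) : fderiv ℝ τ x (1, 0) ∈ f x ∧ fderiv ℝ τ x (0, 1) ∈ f x :=
  ⟨h.curvature₁ x hx τ hτ (by rw [h0]; exact Submodule.zero_mem _),
    h.curvature₂ x hx τ hτ (by rw [h0]; exact Submodule.zero_mem _)⟩

/-- If the sections `σ₁`, `σ₂` span `f` at `x` and have their derivatives in direction `X` in `f`,
where `X` is a coordinate direction, then so do all sections, so `f` is not immersed. -/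
theorem eq_zero_of_fderiv_mem (h : IsCurvatureLineParametrisation U f s₁ s₂)
    (hU : IsOpen U) (himm : IsImmersedBundle U f) {x X : ℝ × ℝ} (hx : x ∈ U)
    (hX : X = (1, 0) ∨ X = (0, 1)) {σ₁ σ₂ : ℝ × ℝ → LieSpace 2} {N : Set (ℝ × ℝ)} (hN : IsOpen N)
    (hxN : x ∈ N) (hσ₁ : ContDiffOn ℝ ∞ σ₁ N) (hσ₂ : ContDiffOn ℝ ∞ σ₂ N)
    (hm₁ : ∀ y ∈ N ∩ U, σ₁ y ∈ f y) (hm₂ : ∀ y ∈ N ∩ U, σ₂ y ∈ f y)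
    (hspan : ∀ a ∈ f x, ∃ t₁ t₂ : ℝ, a = t₁ • σ₁ x + t₂ • σ₂ x)
    (hd₁ : fderiv ℝ σ₁ x X ∈ f x) (hd₂ : fderiv ℝ σ₂ x X ∈ f x) : X = 0 := by
  refine himm x hx X fun τ hτ => ?_
  obtain ⟨τ₁, hτ₁, he₁⟩ := exists_isSmoothSection_eventuallyEq hN hxN hσ₁ hm₁
  obtain ⟨τ₂, hτ₂, he₂⟩ := exists_isSmoothSection_eventuallyEq hN hxN hσ₂ hm₂
  obtain ⟨t₁, t₂, ht⟩ := hspan (τ x) (hτ.2 x hx)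
  have h₁ : ContDiffOn ℝ ∞ (fun y => t₁ • τ₁ y) U :=
    (contDiffOn_const (c := t₁)).smul hτ₁.1
  have h₂ : ContDiffOn ℝ ∞ (fun y => t₂ • τ₂ y) U :=
    (contDiffOn_const (c := t₂)).smul hτ₂.1
  have hρ : IsSmoothSection U f (fun y => τ y - (t₁ • τ₁ y + t₂ • τ₂ y)) :=
    ⟨hτ.1.sub (h₁.add h₂), fun y hy =>
      Submodule.sub_mem _ (hτ.2 y hy) (Submodule.add_mem _ (Submodule.smul_mem _ _ (hτ₁.2 y hy))
        (Submodule.smul_mem _ _ (hτ₂.2 y hy)))⟩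
  have h0 := h.fderiv_mem_of_eq_zero hρ hx (by
    simp only [he₁.eq_of_nhds, he₂.eq_of_nhds, ht, sub_self])
  have h1 : fderiv ℝ (fun y => τ y - (t₁ • τ₁ y + t₂ • τ₂ y)) x X ∈ f x := by
    rcases hX with rfl | rfl
    · exact h0.1
    · exact h0.2
  have hd : HasFDerivAt (fun y => τ y - (t₁ • τ₁ y + t₂ • τ₂ y)) _ x :=
    (hτ.1.differentiableAt_of_isOpen hU hx).hasFDerivAt.sub
      (((hτ₁.1.differentiableAt_of_isOpen hU hx).hasFDerivAt.const_smul t₁).add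
        ((hτ₂.1.differentiableAt_of_isOpen hU hx).hasFDerivAt.const_smul t₂))
  rw [hd.fderiv, he₁.fderiv_eq, he₂.fderiv_eq] at h1
  have h2 := Submodule.add_mem _ h1 (Submodule.add_mem _ (Submodule.smul_mem _ t₁ hd₁)
    (Submodule.smul_mem _ t₂ hd₂))
  simpa using h2

theorem span_eq_of_sections (h : IsCurvatureLineParametrisation U f s₁ s₂) {x : ℝ × ℝ}
    (hx : x ∈ U) (h2 : Module.finrank ℝ (f x) = 2) {a₁ a₂ : LieSpace 2}
    (h₁ : s₁ x = Submodule.span ℝ {a₁}) (h₂ : s₂ x = Submodule.span ℝ {a₂}) (ha₁ : a₁ ≠ 0)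
    (ha₂ : a₂ ≠ 0) : LinearIndependent ℝ ![a₁, a₂] ∧ f x = Submodule.span ℝ {a₁, a₂} := by
  have hli : LinearIndependent ℝ ![a₁, a₂] := by
    rw [LinearIndependent.pair_iff' ha₁]
    intro t ht
    refine ha₂ (Submodule.disjoint_def.1 (h.disjoint x hx) a₂ ?_ ?_)
    · rw [h₁, ← ht]
      exact Submodule.smul_mem _ _ (Submodule.mem_span_singleton_self _)
    · rw [h₂]; exact Submodule.mem_span_singleton_self _
  refine ⟨hli, (Submodule.eq_of_le_of_finrank_eq ?_ ?_).symm⟩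
  · rw [Submodule.span_le]
    rintro a (rfl | rfl)
    · exact h.le₁ x hx (by rw [h₁]; exact Submodule.mem_span_singleton_self _)
    · exact h.le₂ x hx (by rw [h₂]; exact Submodule.mem_span_singleton_self _)
  · rw [h2, finrank_span_pair_eq_two hli]

end IsCurvatureLineParametrisation

/-- Four independent vectors of `F^⊥`, for an isotropic two-plane `F` in `ℝ^{4,2}`: a basis of `F`
and two orthogonal spacelike vectors. -/
theorem linearIndependent_of_gram {a b m e : LieSpace 2} (hab : LinearIndependent ℝ ![a, b])
    (ham : lieForm 2 a m = 0) (hbm : lieForm 2 b m = 0) (hae : lieForm 2 a e = 0)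
    (hbe : lieForm 2 b e = 0) (hme : lieForm 2 m e = 0) (hmm : lieForm 2 m m ≠ 0)
    (hee : lieForm 2 e e ≠ 0) : LinearIndependent ℝ ![a, b, m, e] := by
  rw [Fintype.linearIndependent_iff]
  intro t ht
  simp only [Fin.sum_univ_four, Matrix.cons_val_zero, Matrix.cons_val_one,
    Matrix.cons_val] at ht
  have h2 : t 2 = 0 := by
    have := congrArg (fun z => lieForm 2 z m) ht
    simpa [ham, hbm, lieForm_comm e m, hme, hmm] using this
  have h3 : t 3 = 0 := by
    have := congrArg (fun z => lieForm 2 z e) ht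
    simpa [hae, hbe, hme, hee] using this
  rw [h2, h3, zero_smul, zero_smul, add_zero, add_zero] at ht
  obtain ⟨h0, h1⟩ := LinearIndependent.pair_iff.1 hab _ _ ht
  intro i
  fin_cases i
  · exact h0
  · exact h1
  · exact h2
  · exact h3

/-- A vector orthogonal to an isotropic two-plane and to two orthogonal spacelike vectors of
its orthogonal complement lies in the plane. -/
theorem mem_span_of_gram {a b m e : LieSpace 2} (hab : LinearIndependent ℝ ![a, b])
    (haa : lieForm 2 a a = 0) (hab' : lieForm 2 a b = 0) (hbb : lieForm 2 b b = 0)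
    (ham : lieForm 2 a m = 0) (hbm : lieForm 2 b m = 0) (hae : lieForm 2 a e = 0)
    (hbe : lieForm 2 b e = 0) (hme : lieForm 2 m e = 0) (hmm : lieForm 2 m m ≠ 0)
    (hee : lieForm 2 e e ≠ 0) {x : LieSpace 2} (hxa : lieForm 2 a x = 0)
    (hxb : lieForm 2 b x = 0) (hxm : lieForm 2 m x = 0) (hxe : lieForm 2 e x = 0) :
    x ∈ Submodule.span ℝ {a, b} := by
  refine mem_of_orthogonal_family (finrank_span_pair_eq_two hab)
    (linearIndependent_of_gram hab ham hbm hae hbe hme hmm hee) ?_ ?_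
  · intro i z hz
    obtain ⟨s, t, rfl⟩ := Submodule.mem_span_pair.1 hz
    fin_cases i
    · simp [haa, hab']
    · simp [hab', hbb, lieForm_comm b a]
    · simp [lieForm_comm m, ham, hbm]
    · simp [lieForm_comm e, hae, hbe]
  · intro i
    fin_cases i
    · exact hxa
    · exact hxb
    · exact hxm
    · exact hxe

section Lift

variable {I₁ I₂ : Set ℝ} {f s₁ s₂ : ℝ × ℝ → Submodule ℝ (LieSpace 2)} {q : ℝ → LieSpace 2}

theorem IsLegendreMap.form_eq_zero_of_section {U N : Set (ℝ × ℝ)} (hf : IsLegendreMap U f)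
    {σ : ℝ × ℝ → LieSpace 2} (hN : IsOpen N) (hσ : ContDiffOn ℝ ∞ σ N)
    (hm : ∀ y ∈ N ∩ U, σ y ∈ f y) {x : ℝ × ℝ} (hx : x ∈ N ∩ U) {a : LieSpace 2} (ha : a ∈ f x)
    (X : ℝ × ℝ) : lieForm 2 a (fderiv ℝ σ x X) = 0 := by
  obtain ⟨τ, hτ, he⟩ := exists_isSmoothSection_eventuallyEq hN hx.1 hσ hm
  rw [← he.fderiv_eq]
  exact mem_perp.1 (hf.contact τ hτ x hx.2 X) a ha

/-- The second curvature sphere congruence is orthogonal to `q'`. -/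
theorem IsUnitNormal.form_deriv_eq_zero (hI₁ : IsOpen I₁) (hI₂ : IsOpen I₂)
    (hq : IsUnitNormal I₁ I₂ f q) (hcurv : IsCurvatureLineParametrisation (I₁ ×ˢ I₂) f s₁ s₂)
    {x : ℝ × ℝ} (hx : x ∈ I₁ ×ˢ I₂) {a : LieSpace 2} (ha : a ∈ s₂ x) :
    lieForm 2 a (deriv q x.2) = 0 := by
  obtain ⟨N, hN, hxN, σ, hσ, hspan⟩ := hcurv.smooth₂.exists_local_section hx
  have hU : IsOpen (I₁ ×ˢ I₂) := hI₁.prod hI₂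
  have hNU := hN.inter hU
  have hσs : ∀ y ∈ N ∩ I₁ ×ˢ I₂, σ y ∈ s₂ y := fun y hy => by
    rw [(hspan y hy).2]; exact Submodule.mem_span_singleton_self _
  have hσf : ∀ y ∈ N ∩ I₁ ×ˢ I₂, σ y ∈ f y := fun y hy => hcurv.le₂ y hy.2 (hσs y hy)
  have h1 := (hcurv.curvature₂ x hx).fderiv_mem hN hxN hσ hσf (hσs x ⟨hxN, hx⟩)
  have h2 := dv_lieForm_eq_zero hNU (hσ.mono Set.inter_subset_left)
    ((contDiffOn_comp_snd hq.smooth).mono Set.inter_subset_right) (k := 0)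
    (fun y hy => hq.normal y.1 hy.2.1 y.2 hy.2.2 _ (hσf y hy)) ⟨hxN, hx⟩
  rw [dv_comp_snd q (hq.smooth.differentiableAt_of_isOpen hI₂ hx.2), dv,
    hq.normal x.1 hx.1 x.2 hx.2 _ h1, zero_add] at h2
  rw [(hspan x ⟨hxN, hx⟩).2] at ha
  obtain ⟨t, rfl⟩ := Submodule.mem_span_singleton.1 ha
  rw [map_smul, LinearMap.smul_apply, h2, smul_zero]

/-- The first curvature sphere congruence is nowhere orthogonal to `q'`: otherwise `q` would be
orthogonal to all of `f^⊥`, which is spanned by `f` and the derivatives of the curvature sphere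
congruences. -/
theorem IsUnitNormal.form_deriv_ne_zero (hI₁ : IsOpen I₁) (hI₂ : IsOpen I₂)
    (hq : IsUnitNormal I₁ I₂ f q) (hf : IsLegendreMap (I₁ ×ˢ I₂) f)
    (hcurv : IsCurvatureLineParametrisation (I₁ ×ˢ I₂) f s₁ s₂)
    {x : ℝ × ℝ} (hx : x ∈ I₁ ×ˢ I₂) {a : LieSpace 2} (ha : a ∈ s₁ x) (ha0 : a ≠ 0) :
    lieForm 2 a (deriv q x.2) ≠ 0 := by
  intro hzero
  obtain ⟨N₁, hN₁, hxN₁, σ₁, hσ₁, hspan₁⟩ := hcurv.smooth₁.exists_local_section hx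
  obtain ⟨N₂, hN₂, hxN₂, σ₂, hσ₂, hspan₂⟩ := hcurv.smooth₂.exists_local_section hx
  have hU : IsOpen (I₁ ×ˢ I₂) := hI₁.prod hI₂
  set N := N₁ ∩ N₂ ∩ I₁ ×ˢ I₂ with hNdef
  have hN : IsOpen N := (hN₁.inter hN₂).inter hU
  have hxN : x ∈ N := ⟨⟨hxN₁, hxN₂⟩, hx⟩
  have hNU : N ⊆ I₁ ×ˢ I₂ := Set.inter_subset_right
  have hσ₁ : ContDiffOn ℝ ∞ σ₁ N := hσ₁.mono fun y hy => hy.1.1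
  have hσ₂ : ContDiffOn ℝ ∞ σ₂ N := hσ₂.mono fun y hy => hy.1.2
  have hs₁ : ∀ y ∈ N, σ₁ y ∈ s₁ y := fun y hy => by
    rw [(hspan₁ y ⟨hy.1.1, hy.2⟩).2]; exact Submodule.mem_span_singleton_self _
  have hs₂ : ∀ y ∈ N, σ₂ y ∈ s₂ y := fun y hy => by
    rw [(hspan₂ y ⟨hy.1.2, hy.2⟩).2]; exact Submodule.mem_span_singleton_self _
  have hm₁ : ∀ y ∈ N, σ₁ y ∈ f y := fun y hy => hcurv.le₁ y hy.2 (hs₁ y hy)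
  have hm₂ : ∀ y ∈ N, σ₂ y ∈ f y := fun y hy => hcurv.le₂ y hy.2 (hs₂ y hy)
  have hm₁' : ∀ y ∈ N ∩ I₁ ×ˢ I₂, σ₁ y ∈ f y := fun y hy => hm₁ y hy.1
  have hm₂' : ∀ y ∈ N ∩ I₁ ×ˢ I₂, σ₂ y ∈ f y := fun y hy => hm₂ y hy.1
  have hiso := fun y (hy : y ∈ N) => hf.isotropic y (hNU hy)
  have hu₁ : ∀ y ∈ N, du σ₁ y ∈ f y := fun y hy =>
    (hcurv.curvature₁ y hy.2).fderiv_mem hN hy hσ₁ hm₁' (hs₁ y hy)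
  have hv₂ : ∀ y ∈ N, dv σ₂ y ∈ f y := fun y hy =>
    (hcurv.curvature₂ y hy.2).fderiv_mem hN hy hσ₂ hm₂' (hs₂ y hy)
  have hperp₁ : ∀ y ∈ N, ∀ b ∈ f y, lieForm 2 b (dv σ₁ y) = 0 := fun y hy b hb =>
    hf.form_eq_zero_of_section hN hσ₁ hm₁' ⟨hy, hy.2⟩ hb _
  have hperp₂ : ∀ y ∈ N, ∀ b ∈ f y, lieForm 2 b (du σ₂ y) = 0 := fun y hy b hb =>
    hf.form_eq_zero_of_section hN hσ₂ hm₂' ⟨hy, hy.2⟩ hb _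
  obtain ⟨hli, hfspan⟩ := hcurv.span_eq_of_sections hx (hf.smooth x hx).1
    (hspan₁ x ⟨hxN₁, hx⟩).2 (hspan₂ x ⟨hxN₂, hx⟩).2 (hspan₁ x ⟨hxN₁, hx⟩).1
    (hspan₂ x ⟨hxN₂, hx⟩).1
  have hcoef : ∀ b ∈ f x, ∃ t₁ t₂ : ℝ, b = t₁ • σ₁ x + t₂ • σ₂ x := fun b hb => by
    rw [hfspan] at hb
    obtain ⟨t₁, t₂, h⟩ := Submodule.mem_span_pair.1 hb
    exact ⟨t₁, t₂, h.symm⟩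
  have hnv : dv σ₁ x ∉ f x := fun hmem => by
    have := hcurv.eq_zero_of_fderiv_mem hU hf.immersed hx (Or.inr rfl) hN hxN hσ₁ hσ₂ hm₁' hm₂'
      hcoef hmem (hv₂ x hxN)
    simpa using congrArg Prod.snd this
  have hnu : du σ₂ x ∉ f x := fun hmem => by
    have := hcurv.eq_zero_of_fderiv_mem hU hf.immersed hx (Or.inl rfl) hN hxN hσ₁ hσ₂ hm₁' hm₂'
      hcoef (hu₁ x hxN) hmem
    simpa using congrArg Prod.fst this
  have hfr := (hf.smooth x hx).1
  have pos₁ := lieForm_self_pos_of_perp (hiso x hxN) hfr (hperp₁ x hxN) hnv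
  have pos₂ := lieForm_self_pos_of_perp (hiso x hxN) hfr (hperp₂ x hxN) hnu
  have horth : lieForm 2 (dv σ₁ x) (du σ₂ x) = 0 := by
    have e1 := dv_lieForm_eq_zero hN hσ₁ (hσ₂.du hN)
      (fun y hy => hperp₂ y hy _ (hm₁ y hy)) hxN
    have e2 := du_lieForm_eq_zero hN hσ₁ (hσ₂.dv hN)
      (fun y hy => hiso y hy _ (hm₁ y hy) _ (hv₂ y hy)) hxN
    rw [hiso x hxN _ (hu₁ x hxN) _ (hv₂ x hxN), zero_add, ← dv_du_eq hN hσ₂ hxN] at e2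
    rwa [e2, add_zero] at e1
  have hqs : ContDiffOn ℝ ∞ (fun y : ℝ × ℝ => q y.2) N := (contDiffOn_comp_snd hq.smooth).mono hNU
  have hqd := hq.smooth.differentiableAt_of_isOpen hI₂ hx.2
  have hq₁ : lieForm 2 (dv σ₁ x) (q x.2) = 0 := by
    have e1 := dv_lieForm_eq_zero hN hσ₁ hqs
      (fun y hy => hq.normal y.1 hy.2.1 y.2 hy.2.2 _ (hm₁ y hy)) hxN
    obtain ⟨t, rfl⟩ := Submodule.mem_span_singleton.1 ((hspan₁ x ⟨hxN₁, hx⟩).2 ▸ ha)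
    have ht : t ≠ 0 := fun h => ha0 (by rw [h, zero_smul])
    rw [map_smul, LinearMap.smul_apply, smul_eq_mul] at hzero
    rwa [dv_comp_snd q hqd, (mul_eq_zero.1 hzero).resolve_left ht, add_zero] at e1
  have hq₂ : lieForm 2 (du σ₂ x) (q x.2) = 0 := by
    have e1 := du_lieForm_eq_zero hN hσ₂ hqs
      (fun y hy => hq.normal y.1 hy.2.1 y.2 hy.2.2 _ (hm₂ y hy)) hxN
    rwa [du_comp_snd q hqd, map_zero, add_zero] at e1
  have f₁ := hm₁ x hxN
  have f₂ := hm₂ x hxN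
  have hmem := mem_span_of_gram hli (hiso x hxN _ f₁ _ f₁) (hiso x hxN _ f₁ _ f₂)
    (hiso x hxN _ f₂ _ f₂) (hperp₁ x hxN _ f₁) (hperp₁ x hxN _ f₂) (hperp₂ x hxN _ f₁)
    (hperp₂ x hxN _ f₂) horth pos₁.ne' pos₂.ne' (hq.normal x.1 hx.1 x.2 hx.2 _ f₁)
    (hq.normal x.1 hx.1 x.2 hx.2 _ f₂) hq₁ hq₂
  rw [← hfspan] at hmem
  have := hq.unit x.2 hx.2
  rw [hiso x hxN _ hmem _ hmem] at this
  exact zero_ne_one this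

/-- The section `s` of the curvature spheres with `(s, q') = -1` satisfies `∂ᵥs = q + (s, q'') s`:
both sides have the same inner products with `f`, `q`, `q'` and `∂ᵤ²s`, and the same derivative in
direction `u` modulo `f`. -/
theorem IsUnitNormal.exists_normalisedLift (hI₁ : IsOpen I₁) (hI₂ : IsOpen I₂)
    (hq : IsUnitNormal I₁ I₂ f q) (hf : IsLegendreMap (I₁ ×ˢ I₂) f)
    (hcurv : IsCurvatureLineParametrisation (I₁ ×ˢ I₂) f s₁ s₂)
    (hreg₁ : IsImmersedBundle (I₁ ×ˢ I₂) s₁) (hreg₂ : IsImmersedBundle (I₁ ×ˢ I₂) s₂) :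
    ∃ s, IsNormalisedLift I₁ I₂ f q s := by
  have hU : IsOpen (I₁ ×ˢ I₂) := hI₁.prod hI₂
  have hq1 : ContDiffOn ℝ ∞ (deriv q) I₂ := hq.smooth.deriv_of_isOpen hI₂ (by simp)
  have hq2 : ContDiffOn ℝ ∞ (deriv (deriv q)) I₂ := hq1.deriv_of_isOpen hI₂ (by simp)
  have sq0 : ContDiffOn ℝ ∞ (fun x : ℝ × ℝ => q x.2) (I₁ ×ˢ I₂) := contDiffOn_comp_snd hq.smooth
  have sq1 : ContDiffOn ℝ ∞ (fun x : ℝ × ℝ => deriv q x.2) (I₁ ×ˢ I₂) := contDiffOn_comp_snd hq1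
  have sq2 : ContDiffOn ℝ ∞ (fun x : ℝ × ℝ => deriv (deriv q) x.2) (I₁ ×ˢ I₂) :=
    contDiffOn_comp_snd hq2
  have dq0 : ∀ x ∈ I₁ ×ˢ I₂, DifferentiableAt ℝ q x.2 := fun x hx =>
    hq.smooth.differentiableAt_of_isOpen hI₂ hx.2
  have dq1 : ∀ x ∈ I₁ ×ˢ I₂, DifferentiableAt ℝ (deriv q) x.2 := fun x hx =>
    hq1.differentiableAt_of_isOpen hI₂ hx.2
  obtain ⟨s, hs, hs'⟩ := hcurv.smooth₁.exists_normalised_section hU sq1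
    (fun x hx a ha ha0 => hq.form_deriv_ne_zero hI₁ hI₂ hf hcurv hx ha ha0)
  have hnorm : ∀ x ∈ I₁ ×ˢ I₂, lieForm 2 (s x) (deriv q x.2) = -1 := fun x hx => (hs' x hx).1
  have hspan₁ : ∀ x ∈ I₁ ×ˢ I₂, s₁ x = Submodule.span ℝ {s x} := fun x hx => (hs' x hx).2
  have hss₁ : ∀ x ∈ I₁ ×ˢ I₂, s x ∈ s₁ x := fun x hx => by
    rw [hspan₁ x hx]; exact Submodule.mem_span_singleton_self _
  have hsf : ∀ x ∈ I₁ ×ˢ I₂, s x ∈ f x := fun x hx => hcurv.le₁ x hx (hss₁ x hx)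
  have hs0 : ∀ x ∈ I₁ ×ˢ I₂, s x ≠ 0 := fun x hx h0 => by
    have := hnorm x hx
    rw [h0] at this
    simp at this
  have hsec : IsSmoothSection (I₁ ×ˢ I₂) f s := ⟨hs, hsf⟩
  have hiso := hf.isotropic
  set b := du s with hb
  have hbs : ContDiffOn ℝ ∞ b (I₁ ×ˢ I₂) := hs.du hU
  have hbf : ∀ x ∈ I₁ ×ˢ I₂, b x ∈ f x := fun x hx => hcurv.curvature₁ x hx s hsec (hss₁ x hx)
  have hbq1 : ∀ x ∈ I₁ ×ˢ I₂, lieForm 2 (b x) (deriv q x.2) = 0 := fun x hx => by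
    have := du_lieForm_eq_zero hU hs sq1 hnorm hx
    rwa [du_comp_snd _ (dq1 x hx), map_zero, add_zero] at this
  have hb0 : ∀ x ∈ I₁ ×ˢ I₂, b x ≠ 0 := fun x hx h0 => by
    have := hreg₁ x hx (1, 0) fun τ hτ => by
      rw [hspan₁ x hx]
      refine fderiv_mem_span_of_section (hs.differentiableAt_of_isOpen hU hx)
        (hτ.1.differentiableAt_of_isOpen hU hx) (hs0 x hx) ?_ ?_
      · filter_upwards [hU.mem_nhds hx] with y hy
        rw [← hspan₁ y hy]
        exact hτ.2 y hy
      · have : fderiv ℝ s x (1, 0) = 0 := h0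
        rw [this]
        exact Submodule.zero_mem _
    simpa using congrArg Prod.fst this
  have hspan₂ : ∀ x ∈ I₁ ×ˢ I₂, s₂ x = Submodule.span ℝ {b x} := by
    intro x hx
    obtain ⟨N, hN, hxN, σ, hσ, hσspan⟩ := hcurv.smooth₂.exists_local_section hx
    obtain ⟨hσ0, hσs⟩ := hσspan x ⟨hxN, hx⟩
    obtain ⟨-, hfspan⟩ := hcurv.span_eq_of_sections hx (hf.smooth x hx).1 (hspan₁ x hx) hσs
      (hs0 x hx) hσ0
    have h1 := hbf x hx
    rw [hfspan] at h1
    obtain ⟨t₁, t₂, ht⟩ := Submodule.mem_span_pair.1 h1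
    have h2 := hq.form_deriv_eq_zero hI₁ hI₂ hcurv hx
      (a := σ x) (by rw [hσs]; exact Submodule.mem_span_singleton_self _)
    have h3 := hbq1 x hx
    rw [← ht] at h3
    simp only [map_add, map_smul, LinearMap.add_apply, LinearMap.smul_apply, h2, hnorm x hx,
      smul_eq_mul, mul_zero, add_zero] at h3
    have ht1 : t₁ = 0 := by linarith
    rw [ht1, zero_smul, zero_add] at ht
    have ht2 : t₂ ≠ 0 := fun h => hb0 x hx (by rw [← ht, h, zero_smul])
    rw [hσs, ← ht, Submodule.span_singleton_smul_eq (IsUnit.mk0 _ ht2)]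
  have hbs₂ : ∀ x ∈ I₁ ×ˢ I₂, b x ∈ s₂ x := fun x hx => by
    rw [hspan₂ x hx]; exact Submodule.mem_span_singleton_self _
  have hpair : ∀ x ∈ I₁ ×ˢ I₂, LinearIndependent ℝ ![s x, b x] ∧
      f x = Submodule.span ℝ {s x, b x} := fun x hx =>
    hcurv.span_eq_of_sections hx (hf.smooth x hx).1 (hspan₁ x hx) (hspan₂ x hx) (hs0 x hx)
      (hb0 x hx)
  have hbsec : IsSmoothSection (I₁ ×ˢ I₂) f b := ⟨hbs, hbf⟩
  have hbv : ∀ x ∈ I₁ ×ˢ I₂, dv b x ∈ f x := fun x hx =>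
    hcurv.curvature₂ x hx b hbsec (hbs₂ x hx)
  have hcontact : ∀ τ, IsSmoothSection (I₁ ×ˢ I₂) f τ → ∀ x ∈ I₁ ×ˢ I₂, ∀ X, ∀ a ∈ f x,
      lieForm 2 a (fderiv ℝ τ x X) = 0 := fun τ hτ x hx X a ha =>
    mem_perp.1 (hf.contact τ hτ x hx X) a ha
  have hnotmem : ∀ x ∈ I₁ ×ˢ I₂, du b x ∉ f x := fun x hx hmem => by
    have := hcurv.eq_zero_of_fderiv_mem hU hf.immersed hx (Or.inl rfl) hU hx hs hbs
      (fun y hy => hsf y hy.1) (fun y hy => hbf y hy.1)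
      (fun a ha => by
        rw [(hpair x hx).2] at ha
        obtain ⟨t₁, t₂, h⟩ := Submodule.mem_span_pair.1 ha
        exact ⟨t₁, t₂, h.symm⟩) (hbf x hx) hmem
    simpa using congrArg Prod.fst this
  set m := du b with hm
  have hms : ContDiffOn ℝ ∞ m (I₁ ×ˢ I₂) := hbs.du hU
  have hpos : ∀ x ∈ I₁ ×ˢ I₂, 0 < lieForm 2 (m x) (m x) := fun x hx =>
    lieForm_self_pos_of_perp (hiso x hx) (hf.smooth x hx).1
      (fun a ha => hcontact b hbsec x hx _ a ha) (hnotmem x hx)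
  have hsm : ∀ x ∈ I₁ ×ˢ I₂, lieForm 2 (s x) (m x) = 0 := fun x hx =>
    hcontact b hbsec x hx _ _ (hsf x hx)
  have hbm : ∀ x ∈ I₁ ×ˢ I₂, lieForm 2 (b x) (m x) = 0 := fun x hx =>
    hcontact b hbsec x hx _ _ (hbf x hx)
  have hqf : ∀ x ∈ I₁ ×ˢ I₂, ∀ a ∈ f x, lieForm 2 a (q x.2) = 0 := fun x hx a ha =>
    hq.normal x.1 hx.1 x.2 hx.2 a ha
  have hmq : ∀ x ∈ I₁ ×ˢ I₂, lieForm 2 (m x) (q x.2) = 0 := fun x hx => by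
    have := du_lieForm_eq_zero hU hbs sq0 (fun y hy => hqf y hy _ (hbf y hy)) hx
    rwa [du_comp_snd q (dq0 x hx), map_zero, add_zero] at this
  have hqq1 : ∀ x ∈ I₁ ×ˢ I₂, lieForm 2 (q x.2) (deriv q x.2) = 0 := fun x hx => by
    have := ((dq0 x hx).hasDerivAt.lieForm (dq0 x hx).hasDerivAt).eq_zero_of_eqOn_const hI₂ hx.2
      hq.unit
    rw [lieForm_comm (deriv q x.2)] at this
    linarith
  have hsvs : ContDiffOn ℝ ∞ (dv s) (I₁ ×ˢ I₂) := hs.dv hU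
  have hsvq : ∀ x ∈ I₁ ×ˢ I₂, lieForm 2 (dv s x) (q x.2) = 1 := fun x hx => by
    have := dv_lieForm_eq_zero hU hs sq0 (fun y hy => hqf y hy _ (hsf y hy)) hx
    rw [dv_comp_snd q (dq0 x hx), hnorm x hx] at this
    linarith
  have hsvm : ∀ x ∈ I₁ ×ˢ I₂, lieForm 2 (dv s x) (m x) = 0 := fun x hx => by
    have := du_lieForm_eq_zero hU hsvs hbs
      (fun y hy => by rw [lieForm_comm]; exact hcontact s hsec y hy _ _ (hbf y hy)) hx
    rwa [← dv_du_eq hU hs hx, hiso x hx _ (hbv x hx) _ (hbf x hx), zero_add] at this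
  have hsvq1 : ∀ x ∈ I₁ ×ˢ I₂, lieForm 2 (dv s x) (deriv q x.2) =
      -lieForm 2 (s x) (deriv (deriv q) x.2) := fun x hx => by
    have := dv_lieForm_eq_zero hU hs sq1 hnorm hx
    rw [dv_comp_snd _ (dq1 x hx)] at this
    linarith
  -- `g` is orthogonal to `f`, `∂ᵤ²s` and `q`, so it lies in `f`.
  set g : ℝ × ℝ → LieSpace 2 := fun x =>
    dv s x - (q x.2 + lieForm 2 (s x) (deriv (deriv q) x.2) • s x) with hg
  have hφ : ContDiffOn ℝ ∞ (fun x : ℝ × ℝ => lieForm 2 (s x) (deriv (deriv q) x.2)) (I₁ ×ˢ I₂) :=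
    hs.lieForm sq2
  have hφs : ContDiffOn ℝ ∞ (fun x : ℝ × ℝ => lieForm 2 (s x) (deriv (deriv q) x.2) • s x)
      (I₁ ×ˢ I₂) := hφ.smul hs
  have hqφ : ContDiffOn ℝ ∞
      (fun x : ℝ × ℝ => q x.2 + lieForm 2 (s x) (deriv (deriv q) x.2) • s x) (I₁ ×ˢ I₂) :=
    sq0.add hφs
  have hgs : ContDiffOn ℝ ∞ g (I₁ ×ˢ I₂) := hsvs.sub hqφ
  have hgm : ∀ x ∈ I₁ ×ˢ I₂, lieForm 2 (g x) (m x) = 0 := fun x hx => by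
    simp [hg, hsvm x hx, hsm x hx, lieForm_comm (q x.2), hmq x hx]
  have hgu : ∀ x ∈ I₁ ×ˢ I₂, du g x ∈ f x := fun x hx => by
    rw [hg, du_sub hU hsvs hqφ hx, du_add hU sq0 hφs hx,
      du_smul hU hφ hs hx, du_comp_snd q (dq0 x hx), ← dv_du_eq hU hs hx, zero_add]
    exact Submodule.sub_mem _ (hbv x hx) (Submodule.add_mem _
      (Submodule.smul_mem _ _ (hsf x hx)) (Submodule.smul_mem _ _ (hbf x hx)))
  have hg0 : ∀ x ∈ I₁ ×ˢ I₂, g x = 0 := by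
    intro x hx
    have hga : ∀ a ∈ f x, lieForm 2 a (g x) = 0 := fun a ha => by
      simp [hg, hqf x hx a ha, hiso x hx a ha _ (hsf x hx),
        show lieForm 2 a (dv s x) = 0 from hcontact s hsec x hx _ a ha]
    have hmem : g x ∈ Submodule.span ℝ {s x, b x} := by
      refine mem_span_of_gram (hpair x hx).1 (hiso x hx _ (hsf x hx) _ (hsf x hx))
        (hiso x hx _ (hsf x hx) _ (hbf x hx)) (hiso x hx _ (hbf x hx) _ (hbf x hx)) (hsm x hx)
        (hbm x hx) (hqf x hx _ (hsf x hx)) (hqf x hx _ (hbf x hx)) (hmq x hx) (hpos x hx).ne'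
        (by rw [hq.unit x.2 hx.2]; norm_num) (hga _ (hsf x hx)) (hga _ (hbf x hx))
        (by rw [lieForm_comm]; exact hgm x hx) ?_
      rw [lieForm_comm]
      simp [hg, hsvq x hx, hq.unit x.2 hx.2, hqf x hx _ (hsf x hx)]
    obtain ⟨t₁, t₂, ht⟩ := Submodule.mem_span_pair.1 hmem
    have h1 : lieForm 2 (g x) (deriv q x.2) = 0 := by
      simp only [hg, map_sub, map_add, map_smul, LinearMap.sub_apply, LinearMap.add_apply,
        LinearMap.smul_apply, smul_eq_mul, hsvq1 x hx, hqq1 x hx, hnorm x hx]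
      ring
    have ht1 : t₁ = 0 := by
      rw [← ht] at h1
      simp only [map_add, map_smul, LinearMap.add_apply, LinearMap.smul_apply, hnorm x hx,
        hbq1 x hx, smul_eq_mul, mul_zero, add_zero] at h1
      linarith
    -- The component along `s_u` vanishes because `g_u` lies in `f`.
    have h2 := du_lieForm_eq_zero hU hgs hms hgm hx
    rw [lieForm_comm, hm, show lieForm 2 (du b x) (du g x) = 0 by
      rw [lieForm_comm]; exact hcontact b hbsec x hx _ _ (hgu x hx), zero_add] at h2
    have h3 := du_lieForm_eq_zero hU hbs hms hbm hx
    rw [← ht, ht1, zero_smul, zero_add, map_smul, LinearMap.smul_apply, smul_eq_mul] at h2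
    have h4 : t₂ * lieForm 2 (m x) (m x) = 0 := by
      linear_combination t₂ * h3 - h2
    rw [← ht, ht1, (mul_eq_zero.1 h4).resolve_right (hpos x hx).ne']
    simp
  have hdv : ∀ x ∈ I₁ ×ˢ I₂, dv s x = q x.2 + lieForm 2 (s x) (deriv (deriv q) x.2) • s x :=
    fun x hx => sub_eq_zero.1 (hg0 x hx)
  -- If `(∂ᵤs, q'')` vanished at `x`, then `∂ᵥ∂ᵤs` would be a multiple of `∂ᵤs`, although `s₂`, which
  -- is spanned by `∂ᵤs`, is immersed.
  refine ⟨s, hs, hnorm, fun x hx => (hpair x hx).2, hpos, hdv, fun x hx h0 => ?_⟩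
  have h1 : dv b x = lieForm 2 (s x) (deriv (deriv q) x.2) • b x := by
    rw [hb, dv_du_eq hU hs hx, du_congr hU hdv hx, du_add hU sq0 hφs hx,
      du_smul hU hφ hs hx, du_comp_snd q (dq0 x hx), du_lieForm hU hs sq2 hx,
      du_comp_snd _ (hq2.differentiableAt_of_isOpen hI₂ hx.2), h0]
    simp
  have h2 := hreg₂ x hx (0, 1) fun τ hτ => by
    rw [hspan₂ x hx]
    refine fderiv_mem_span_of_section (hbs.differentiableAt_of_isOpen hU hx)
      (hτ.1.differentiableAt_of_isOpen hU hx) (hb0 x hx) ?_ ?_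
    · filter_upwards [hU.mem_nhds hx] with y hy
      rw [← hspan₂ y hy]
      exact hτ.2 y hy
    · have : fderiv ℝ b x (0, 1) = _ := h1
      rw [this]
      exact Submodule.smul_mem _ _ (Submodule.mem_span_singleton_self _)
  simpa using congrArg Prod.snd h2

end Lift

/-! ### Parallel transport along the normal -/

/-- Fundamental solutions of a linear differential equation `F' = A F` for which enough solutions
are known: their initial values span the space. -/
theorem exists_fundamental_solution {V : Type*} [NormedAddCommGroup V] [NormedSpace ℝ V]
    [FiniteDimensional ℝ V] {I : Set ℝ} {A : ℝ → V →L[ℝ] V} {v₀ : ℝ} {Z : Set V}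
    (hZ : ∀ z ∈ Z, ∃ F : ℝ → V, F v₀ = z ∧ ∀ v ∈ I, HasDerivAt F (A v (F v)) v)
    (hspan : Submodule.span ℝ Z = ⊤) :
    ∃ B : ℝ → V →L[ℝ] V, B v₀ = ContinuousLinearMap.id ℝ V ∧
      ∀ v ∈ I, HasDerivAt B ((A v).comp (B v)) v := by
  have hall : ∀ z : V, ∃ F : ℝ → V, F v₀ = z ∧ ∀ v ∈ I, HasDerivAt F (A v (F v)) v := by
    intro z
    have hz : z ∈ Submodule.span ℝ Z := hspan ▸ Submodule.mem_top
    induction hz using Submodule.span_induction with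
    | mem z hz => exact hZ z hz
    | zero => exact ⟨fun _ => 0, rfl, fun v _ => by simpa using hasDerivAt_const v (0 : V)⟩
    | add x y _ _ hx hy =>
      obtain ⟨F, hF0, hF⟩ := hx
      obtain ⟨G, hG0, hG⟩ := hy
      exact ⟨fun v => F v + G v, by simp [hF0, hG0], fun v hv => by
        rw [map_add]; exact (hF v hv).add (hG v hv)⟩
    | smul t x _ hx =>
      obtain ⟨F, hF0, hF⟩ := hx
      exact ⟨fun v => t • F v, by simp [hF0], fun v hv => by
        rw [map_smul]; exact (hF v hv).const_smul t⟩
  let b := Module.finBasis ℝ V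
  choose F hF0 hF using fun i => hall (b i)
  let ℓ := fun i => LinearMap.toContinuousLinearMap (b.coord i)
  have hℓ : ∀ z : V, ∑ i, ℓ i z • b i = z := fun z => b.sum_repr z
  refine ⟨fun v => ∑ i, (ℓ i).smulRight (F i v), ?_, fun v hv => ?_⟩
  · ext1 z
    simpa [hF0] using hℓ z
  · have h := HasDerivAt.fun_sum (u := Finset.univ) fun i _ =>
      ((ContinuousLinearMap.smulRightL ℝ V V (ℓ i)).hasFDerivAt.comp_hasDerivAt v (hF i v hv))
    refine (h.congr_deriv ?_).congr_of_eventuallyEq (Filter.Eventually.of_forall fun _ => ?_)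
    · ext1 z
      simp
    · simp

theorem contDiffOn_of_hasDerivAt_comp {V : Type*} [NormedAddCommGroup V] [NormedSpace ℝ V]
    {I : Set ℝ} (hI : IsOpen I) {A B : ℝ → V →L[ℝ] V} (hA : ContDiffOn ℝ ∞ A I)
    (hB : ∀ v ∈ I, HasDerivAt B ((A v).comp (B v)) v) : ContDiffOn ℝ ∞ B I := by
  rw [contDiffOn_infty]
  intro n
  induction n with
  | zero =>
    exact contDiffOn_zero.2 fun v hv => (hB v hv).continuousAt.continuousWithinAt
  | succ n ih =>
    push_cast
    rw [contDiffOn_succ_iff_deriv_of_isOpen hI]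
    refine ⟨fun v hv => (hB v hv).differentiableAt.differentiableWithinAt, by simp, ?_⟩
    exact ((hA.of_le (by exact_mod_cast le_top)).clm_comp ih).congr fun v hv => (hB v hv).deriv

theorem exists_hasDerivAt_eq {I : Set ℝ} (hI : IsOpen I) (hI' : I.OrdConnected) {φ : ℝ → ℝ}
    (hφ : ContinuousOn φ I) {v₀ : ℝ} (hv₀ : v₀ ∈ I) :
    ∃ Φ : ℝ → ℝ, Φ v₀ = 0 ∧ ∀ v ∈ I, HasDerivAt Φ (φ v) v := by
  refine ⟨fun v => ∫ t in v₀..v, φ t, by simp, fun v hv => ?_⟩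
  refine intervalIntegral.integral_hasDerivAt_right ?_
    (hφ.stronglyMeasurableAtFilter hI v hv) (hφ.continuousAt (hI.mem_nhds hv))
  exact (hφ.mono (hI'.uIcc_subset hv₀ hv)).intervalIntegrable

/-- The surface `f` is swept out by the Legendre curve of the frame `c` in `q(v₀)^⊥`: `f(u, v)` is
the image of the plane of the curve at `u` under the parallel transport `B v` of `d - q ∧ q'`. -/
structure IsSweptFrame (I₁ I₂ : Set ℝ) (f : ℝ × ℝ → Submodule ℝ (LieSpace 2))
    (q : ℝ → LieSpace 2) (v₀ : ℝ) (B : ℝ → LieSpace 2 →L[ℝ] LieSpace 2)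
    (c : ℕ → ℝ → LieSpace 2) : Prop extends IsLegendreFrame I₁ c where
  smooth_transport : ContDiffOn ℝ ∞ B I₂
  hasDerivAt_transport : ∀ v ∈ I₂, HasDerivAt B ((wedge (q v) (deriv q v)).comp (B v)) v
  isometry : ∀ v ∈ I₂, ∀ x y, lieForm 2 (B v x) (B v y) = lieForm 2 x y
  transport_init : B v₀ = ContinuousLinearMap.id ℝ _
  transport_normal : ∀ v ∈ I₂, B v (q v₀) = q v
  normal : ∀ i, ∀ u ∈ I₁, lieForm 2 (c i u) (q v₀) = 0
  norm : ∀ u ∈ I₁, lieForm 2 (c 0 u) (deriv q v₀) = -1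
  transversal : ∀ u ∈ I₁, ∀ v ∈ I₂, lieForm 2 (deriv q v) (B v (c 0 u)) ≠ 0
  reg : ∀ u ∈ I₁, lieForm 2 (c 1 u) (deriv (deriv q) v₀) ≠ 0
  span : ∀ u ∈ I₁, ∀ v ∈ I₂, f (u, v) = Submodule.span ℝ {B v (c 0 u), B v (c 1 u)}

/-- Solutions of a skew linear equation have constant inner products. -/
theorem lieForm_eq_of_wedge {n : ℕ} {I : Set ℝ} (hI' : I.OrdConnected) {a b F G : ℝ → LieSpace n}
    (hF : ∀ v ∈ I, HasDerivAt F (wedge (a v) (b v) (F v)) v)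
    (hG : ∀ v ∈ I, HasDerivAt G (wedge (a v) (b v) (G v)) v) {v w : ℝ} (hv : v ∈ I) (hw : w ∈ I) :
    lieForm n (F v) (G v) = lieForm n (F w) (G w) := by
  refine eq_of_hasDerivAt_zero hI' (F := fun v => lieForm n (F v) (G v)) (fun t ht => ?_) v hv w hw
  refine ((hF t ht).lieForm (hG t ht)).congr_deriv ?_
  simp only [wedge_apply, map_sub, map_smul, LinearMap.sub_apply, LinearMap.smul_apply,
    smul_eq_mul, lieForm_comm (F t)]
  ring

/-- A frame in `ℝ^{4,2}` orthogonal to a unit vector spans its orthogonal complement. -/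
theorem IsLegendreFrame.eq_zero_of_forall {I : Set ℝ} {c : ℕ → ℝ → LieSpace 2}
    (h : IsLegendreFrame I c) {e : LieSpace 2} (he : lieForm 2 e e ≠ 0) {u : ℝ} (hu : u ∈ I)
    (hce : ∀ i, lieForm 2 (c i u) e = 0) {k : LieSpace 2} (hke : lieForm 2 e k = 0)
    (hk : ∀ i, lieForm 2 (c i u) k = 0) : k = 0 := by
  have hmem := mem_span_of_gram (h.linearIndependent_pair hu) (h.null_zero u hu) (h.gram₀₁ hu)
    (h.null_one u hu) (h.gram₀₂ hu) (h.gram₁₂ hu) (hce 0) (hce 1) (hce 2) (h.pos_two u hu).ne' he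
    (hk 0) (hk 1) (hk 2) hke
  obtain ⟨x, y, rfl⟩ := Submodule.mem_span_pair.1 hmem
  obtain ⟨rfl, rfl⟩ := h.coeff_eq_zero hu (by rw [lieForm_comm]; exact hk 3)
    (by rw [lieForm_comm]; exact hk 4)
  simp

theorem ContDiffOn.iteratedDeriv_of_isOpen {G : Type*} [NormedAddCommGroup G] [NormedSpace ℝ G]
    {I : Set ℝ} (hI : IsOpen I) {F : ℝ → G} (hF : ContDiffOn ℝ ∞ F I) (i : ℕ) :
    ContDiffOn ℝ ∞ (iteratedDeriv i F) I := by
  induction i with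
  | zero => simpa using hF
  | succ i ih =>
    rw [iteratedDeriv_succ]
    exact ih.deriv_of_isOpen hI (by simp)

theorem ContDiffOn.hasDerivAt_iteratedDeriv {G : Type*} [NormedAddCommGroup G] [NormedSpace ℝ G]
    {I : Set ℝ} (hI : IsOpen I) {F : ℝ → G} (hF : ContDiffOn ℝ ∞ F I) (i : ℕ) {u : ℝ}
    (hu : u ∈ I) : HasDerivAt (iteratedDeriv i F) (iteratedDeriv (i + 1) F u) u := by
  rw [iteratedDeriv_succ]
  exact ((hF.iteratedDeriv_of_isOpen hI i).differentiableAt_of_isOpen hI hu).hasDerivAt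

section Sweep

variable {I₁ I₂ : Set ℝ} {f : ℝ × ℝ → Submodule ℝ (LieSpace 2)} {q : ℝ → LieSpace 2}
  {s : ℝ × ℝ → LieSpace 2} {v₀ : ℝ}

/-- A parameter line of the normalised lift is a Legendre frame. -/
theorem IsNormalisedLift.isLegendreFrame (hs : IsNormalisedLift I₁ I₂ f q s) (hI₁ : IsOpen I₁)
    (hI₂ : IsOpen I₂) (hf : IsNullOn (I₁ ×ˢ I₂) f) (hv₀ : v₀ ∈ I₂) :
    IsLegendreFrame I₁ (fun i => iteratedDeriv i fun t => s (t, v₀)) ∧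
      ∀ u ∈ I₁, iteratedDeriv 1 (fun t => s (t, v₀)) u = du s (u, v₀) := by
  have hU := hI₁.prod hI₂
  have hsm : ∀ {F : ℝ × ℝ → LieSpace 2}, ContDiffOn ℝ ∞ F (I₁ ×ˢ I₂) →
      ContDiffOn ℝ ∞ (fun t => F (t, v₀)) I₁ := fun hF =>
    hF.comp (contDiff_id.prodMk contDiff_const).contDiffOn fun t ht => ⟨ht, hv₀⟩
  have hd : ∀ {F : ℝ × ℝ → LieSpace 2}, ContDiffOn ℝ ∞ F (I₁ ×ˢ I₂) → ∀ u ∈ I₁,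
      HasDerivAt (fun t => F (t, v₀)) (du F (u, v₀)) u := fun hF u hu =>
    (hF.differentiableAt_of_isOpen hU ⟨hu, hv₀⟩).hasDerivAt_fst
  have h1 : ∀ u ∈ I₁, iteratedDeriv 1 (fun t => s (t, v₀)) u = du s (u, v₀) := fun u hu => by
    rw [iteratedDeriv_one]; exact (hd hs.smooth u hu).deriv
  have h2 : ∀ u ∈ I₁, iteratedDeriv 2 (fun t => s (t, v₀)) u = du (du s) (u, v₀) := fun u hu => by
    rw [iteratedDeriv_succ, ← (hd (hs.smooth.du hU) u hu).deriv]
    refine Filter.EventuallyEq.deriv_eq ?_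
    filter_upwards [hI₁.mem_nhds hu] with x hx using h1 x hx
  have hmem : ∀ u ∈ I₁, s (u, v₀) ∈ f (u, v₀) ∧ du s (u, v₀) ∈ f (u, v₀) := fun u hu => by
    rw [hs.span _ ⟨hu, hv₀⟩]
    exact ⟨Submodule.subset_span (by simp), Submodule.subset_span (by simp)⟩
  refine ⟨⟨hI₁, fun i u hu => (hsm hs.smooth).hasDerivAt_iteratedDeriv hI₁ i hu,
    fun i => (hsm hs.smooth).iteratedDeriv_of_isOpen hI₁ i, fun u hu => ?_, fun u hu => ?_,
    fun u hu => ?_⟩, h1⟩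
  · simp only [iteratedDeriv_zero]
    exact hf _ ⟨hu, hv₀⟩ _ (hmem u hu).1 _ (hmem u hu).1
  · rw [h1 u hu]
    exact hf _ ⟨hu, hv₀⟩ _ (hmem u hu).2 _ (hmem u hu).2
  · rw [h2 u hu]
    exact hs.pos _ ⟨hu, hv₀⟩

/-- For fixed `u`, a suitable multiple of `s` solves the linear equation `F' = (q ∧ q') F`. -/
theorem IsNormalisedLift.exists_solution (hs : IsNormalisedLift I₁ I₂ f q s) (hI₁ : IsOpen I₁)
    (hI₂ : IsOpen I₂) (hI₂' : I₂.OrdConnected) (hq : IsUnitNormal I₁ I₂ f q) (hv₀ : v₀ ∈ I₂)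
    {u : ℝ} (hu : u ∈ I₁) :
    ∃ w : ℝ → ℝ, w v₀ = 1 ∧
      ∀ v ∈ I₂, HasDerivAt (fun v => w v • s (u, v)) (wedge (q v) (deriv q v) (w v • s (u, v))) v := by
  have hU := hI₁.prod hI₂
  have hq2 : ContDiffOn ℝ ∞ (deriv (deriv q)) I₂ :=
    (hq.smooth.deriv_of_isOpen (m := ∞) hI₂ (by simp)).deriv_of_isOpen hI₂ (by simp)
  have hsm : ContDiffOn ℝ ∞ (fun t => s (u, t)) I₂ :=
    hs.smooth.comp (contDiff_const.prodMk contDiff_id).contDiffOn fun t ht => ⟨hu, ht⟩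
  obtain ⟨Φ, hΦ0, hΦ⟩ := exists_hasDerivAt_eq hI₂ hI₂' (hsm.lieForm hq2).continuousOn hv₀
  refine ⟨fun v => Real.exp (-Φ v), by simp [hΦ0], fun v hv => ?_⟩
  have hx : (u, v) ∈ I₁ ×ˢ I₂ := ⟨hu, hv⟩
  have hds : HasDerivAt (fun t => s (u, t)) (dv s (u, v)) v :=
    (hs.smooth.differentiableAt_of_isOpen hU hx).hasDerivAt_snd
  refine ((hΦ v hv).neg.exp.smul hds).congr_deriv ?_
  have hsq : lieForm 2 (q v) (s (u, v)) = 0 := by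
    rw [lieForm_comm]
    exact hq.normal u hu v hv _ (by
      rw [hs.span _ hx]; exact Submodule.subset_span (by simp))
  have hsq1 : lieForm 2 (deriv q v) (s (u, v)) = -1 := by rw [lieForm_comm]; exact hs.norm _ hx
  rw [hs.dv_eq _ hx, wedge_apply]
  simp only [map_smul, hsq, hsq1, smul_eq_mul, mul_zero, zero_smul, zero_sub]
  module

theorem IsUnitNormal.hasDerivAt_wedge (hI₂ : IsOpen I₂) (hq : IsUnitNormal I₁ I₂ f q) {v : ℝ}
    (hv : v ∈ I₂) : HasDerivAt q (wedge (q v) (deriv q v) (q v)) v := by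
  have hd := (hq.smooth.differentiableAt_of_isOpen hI₂ hv).hasDerivAt
  refine hd.congr_deriv ?_
  have := (hd.lieForm hd).eq_zero_of_eqOn_const hI₂ hv hq.unit
  rw [lieForm_comm (q v)] at this
  rw [wedge_apply, hq.unit v hv, show lieForm 2 (deriv q v) (q v) = 0 by linarith]
  simp

/-- The normal `q` and the rescaled lifts `s(u, ·)`, for `u ∈ I₁`, solve `F' = (q ∧ q') F`. As their
values at `v₀` span `ℝ^{4,2}`, they determine the transport `B`. -/
theorem IsNormalisedLift.exists_isSweptFrame (hs : IsNormalisedLift I₁ I₂ f q s) (hI₁ : IsOpen I₁)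
    (hI₂ : IsOpen I₂) (hI₂' : I₂.OrdConnected) (hq : IsUnitNormal I₁ I₂ f q)
    (hf : IsLegendreMap (I₁ ×ˢ I₂) f) (hne : I₁.Nonempty) (hv₀ : v₀ ∈ I₂) :
    ∃ B c, IsSweptFrame I₁ I₂ f q v₀ B c := by
  obtain ⟨hfr, hc1⟩ := hs.isLegendreFrame hI₁ hI₂ hf.isotropic hv₀
  set c : ℕ → ℝ → LieSpace 2 := fun i => iteratedDeriv i fun t => s (t, v₀) with hc
  have hc0 : ∀ u, c 0 u = s (u, v₀) := fun u => by simp [hc]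
  have hnormal : ∀ i, ∀ u ∈ I₁, lieForm 2 (c i u) (q v₀) = 0 := by
    intro i
    induction i with
    | zero =>
      intro u hu
      rw [hc0]
      exact hq.normal u hu v₀ hv₀ _ (by
        rw [hs.span _ ⟨hu, hv₀⟩]; exact Submodule.subset_span (by simp))
    | succ i ih =>
      intro u hu
      have := ((hfr.hasDerivAt i u hu).lieForm (hasDerivAt_const u (q v₀))).eq_zero_of_eqOn_const
        hI₁ hu ih
      simpa using this
  have hq1 : ContDiffOn ℝ ∞ (deriv q) I₂ := hq.smooth.deriv_of_isOpen hI₂ (by simp)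
  -- The vectors `q(v₀)` and `s(u, v₀)` span the whole space.
  have hspan : Submodule.span ℝ (insert (q v₀) ((fun u => s (u, v₀)) '' I₁)) = ⊤ := by
    have hperp : perp (Submodule.span ℝ (insert (q v₀) ((fun u => s (u, v₀)) '' I₁))) = ⊥ := by
      rw [Submodule.eq_bot_iff]
      intro k hk
      rw [mem_perp] at hk
      have hk0 : ∀ i, ∀ u ∈ I₁, lieForm 2 (c i u) k = 0 := by
        intro i
        induction i with
        | zero =>
          intro u hu
          rw [hc0]
          exact hk _ (Submodule.subset_span (Or.inr ⟨u, hu, rfl⟩))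
        | succ i ih =>
          intro u hu
          have := ((hfr.hasDerivAt i u hu).lieForm (hasDerivAt_const u k)).eq_zero_of_eqOn_const
            hI₁ hu ih
          simpa using this
      obtain ⟨u, hu⟩ := hne
      exact hfr.eq_zero_of_forall (by rw [hq.unit v₀ hv₀]; exact one_ne_zero) hu
        (fun i => hnormal i u hu) (hk _ (Submodule.subset_span (Or.inl rfl)))
        (fun i => hk0 i u hu)
    have h1 := finrank_perp (Submodule.span ℝ (insert (q v₀) ((fun u => s (u, v₀)) '' I₁)))
    rw [hperp, finrank_bot] at h1
    apply Submodule.eq_top_of_finrank_eq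
    have h2 := Submodule.finrank_le (Submodule.span ℝ (insert (q v₀) ((fun u => s (u, v₀)) '' I₁)))
    rw [finrank_lieSpace] at h2 ⊢
    omega
  obtain ⟨B, hB0, hB⟩ := exists_fundamental_solution (I := I₂) (v₀ := v₀)
    (A := fun v => wedge (q v) (deriv q v)) (by
      rintro z (rfl | ⟨u, hu, rfl⟩)
      · exact ⟨q, rfl, fun v hv => hq.hasDerivAt_wedge hI₂ hv⟩
      · obtain ⟨w, hw0, hw⟩ := hs.exists_solution hI₁ hI₂ hI₂' hq hv₀ hu
        exact ⟨_, by simp [hw0], hw⟩) hspan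
  have hBs := contDiffOn_of_hasDerivAt_comp hI₂ (hq.smooth.wedge hq1) hB
  have hBx : ∀ x : LieSpace 2, ∀ v ∈ I₂,
      HasDerivAt (fun v => B v x) (wedge (q v) (deriv q v) (B v x)) v := fun x v hv => by
    simpa using (hB v hv).clm_apply (hasDerivAt_const v x)
  have hiso : ∀ v ∈ I₂, ∀ x y, lieForm 2 (B v x) (B v y) = lieForm 2 x y := fun v hv x y => by
    rw [lieForm_eq_of_wedge hI₂' (hBx x) (hBx y) hv hv₀, hB0]
    rfl
  have hinj : ∀ v ∈ I₂, Function.Injective (B v) := fun v hv => by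
    rw [injective_iff_map_eq_zero]
    intro x hx
    refine eq_zero_of_forall_lieForm fun y => ?_
    rw [← hiso v hv, hx]
    simp
  -- Solutions are determined by their initial values, because `B` is isometric.
  have huniq : ∀ F : ℝ → LieSpace 2, (∀ v ∈ I₂, HasDerivAt F (wedge (q v) (deriv q v) (F v)) v) →
      ∀ v ∈ I₂, B v (F v₀) = F v := fun F hF v hv => by
    rw [← sub_eq_zero]
    refine eq_zero_of_forall_lieForm fun y => ?_
    obtain ⟨y, rfl⟩ := LinearMap.surjective_of_injective (f := (B v).toLinearMap) (hinj v hv) y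
    have := lieForm_eq_of_wedge hI₂' hF (hBx y) hv hv₀
    rw [hB0] at this
    rw [ContinuousLinearMap.coe_coe, map_sub, LinearMap.sub_apply, hiso v hv, this]
    exact sub_self _
  have hU := hI₁.prod hI₂
  have hfac : ∀ v ∈ I₂, ∀ x ∈ I₁, ∃ w : ℝ, B v (s (x, v₀)) = w • s (x, v) := fun v hv x hx => by
    obtain ⟨w, hw0, hw⟩ := hs.exists_solution hI₁ hI₂ hI₂' hq hv₀ hx
    have := huniq _ hw v hv
    simp only [hw0, one_smul] at this
    exact ⟨w v, this⟩
  have hq1v : ∀ v ∈ I₂, ∀ x ∈ I₁,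
      B v (s (x, v₀)) = -lieForm 2 (B v (s (x, v₀))) (deriv q v) • s (x, v) := fun v hv x hx => by
    obtain ⟨w, hw⟩ := hfac v hv x hx
    rw [hw, map_smul, LinearMap.smul_apply, hs.norm _ ⟨hx, hv⟩]
    simp
  refine ⟨B, c, hfr, hBs, hB, hiso, hB0, fun v hv => huniq q (fun v hv => hq.hasDerivAt_wedge hI₂ hv)
    v hv, hnormal, fun u hu => ?_, fun u hu v hv h0 => ?_, fun u hu => ?_,
    fun u hu v hv => ?_⟩
  · rw [hc0]; exact hs.norm _ ⟨hu, hv₀⟩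
  · rw [hc0, lieForm_comm] at h0
    have h1 := hq1v v hv u hu
    rw [h0, neg_zero, zero_smul, ← map_zero (B v)] at h1
    have h2 := hs.norm _ (show (u, v₀) ∈ I₁ ×ˢ I₂ from ⟨hu, hv₀⟩)
    rw [hinj v hv h1] at h2
    simp at h2
  · rw [show c 1 u = _ from hc1 u hu]; exact hs.reg _ ⟨hu, hv₀⟩
  · have hmem0 : ∀ x ∈ I₁, B v (s (x, v₀)) ∈ f (x, v) := fun x hx => by
      obtain ⟨w, hw⟩ := hfac v hv x hx
      rw [hw, hs.span _ ⟨hx, hv⟩]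
      exact Submodule.smul_mem _ _ (Submodule.subset_span (by simp))
    have hdB : ∀ x ∈ I₁, HasDerivAt (fun x => B v (s (x, v₀))) (B v (c 1 x)) x := fun x hx => by
      have := (B v).hasFDerivAt.comp_hasDerivAt x (hfr.hasDerivAt 0 x hx)
      simpa [hc, Function.comp_def] using this
    have hmem1 : B v (c 1 u) ∈ f (u, v) := by
      have h1 : HasDerivAt (fun x => -lieForm 2 (B v (s (x, v₀))) (deriv q v) • s (x, v)) _ u :=
        ((hdB u hu).lieForm (hasDerivAt_const u (deriv q v))).neg.smul
          (hs.smooth.differentiableAt_of_isOpen hU (show (u, v) ∈ _ from ⟨hu, hv⟩)).hasDerivAt_fst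
      have h2 : (fun x => B v (s (x, v₀))) =ᶠ[nhds u]
          fun x => -lieForm 2 (B v (s (x, v₀))) (deriv q v) • s (x, v) := by
        filter_upwards [hI₁.mem_nhds hu] with x hx using hq1v v hv x hx
      rw [(hdB u hu).unique (h1.congr_of_eventuallyEq h2), hs.span _ ⟨hu, hv⟩]
      exact Submodule.add_mem _
        (Submodule.smul_mem _ _ (Submodule.subset_span (Or.inr rfl)))
        (Submodule.smul_mem _ _ (Submodule.subset_span (by simp)))
    refine (Submodule.eq_of_le_of_finrank_eq ?_ ?_).symm
    · rw [Submodule.span_le]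
      rintro a (rfl | rfl)
      · rw [hc0]; exact hmem0 u hu
      · exact hmem1
    · rw [(hf.smooth _ ⟨hu, hv⟩).1]
      apply finrank_span_pair_eq_two
      rw [LinearIndependent.pair_iff]
      intro x y hxy
      refine LinearIndependent.pair_iff.1 (hfr.linearIndependent_pair hu) x y (hinj v hv ?_)
      rw [map_add, map_smul, map_smul, hxy, map_zero]

end Sweep

/-! ### Gauge potentials of swept surfaces -/

/-- The moving frame of a swept surface. -/
noncomputable def sweep (B : ℝ → LieSpace 2 →L[ℝ] LieSpace 2) (c : ℕ → ℝ → LieSpace 2) (i : ℕ)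
    (x : ℝ × ℝ) : LieSpace 2 := B x.2 (c i x.1)

namespace IsSweptFrame

variable {I₁ I₂ : Set ℝ} {f : ℝ × ℝ → Submodule ℝ (LieSpace 2)} {q : ℝ → LieSpace 2} {v₀ : ℝ}
  {B : ℝ → LieSpace 2 →L[ℝ] LieSpace 2} {c : ℕ → ℝ → LieSpace 2}

theorem contDiffOn_sweep (h : IsSweptFrame I₁ I₂ f q v₀ B c) (i : ℕ) :
    ContDiffOn ℝ ∞ (sweep B c i) (I₁ ×ˢ I₂) :=
  (contDiffOn_comp_snd h.smooth_transport).clm_apply (contDiffOn_comp_fst (h.smooth i))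

theorem hasDerivAt_sweep_fst (h : IsSweptFrame I₁ I₂ f q v₀ B c) (i : ℕ) {u v : ℝ} (hu : u ∈ I₁) :
    HasDerivAt (fun t => sweep B c i (t, v)) (sweep B c (i + 1) (u, v)) u :=
  (B v).hasFDerivAt.comp_hasDerivAt u (h.hasDerivAt i u hu)

theorem du_sweep (h : IsSweptFrame I₁ I₂ f q v₀ B c) (hI₂ : IsOpen I₂) (i : ℕ) {x : ℝ × ℝ}
    (hx : x ∈ I₁ ×ˢ I₂) : du (sweep B c i) x = sweep B c (i + 1) x :=
  ((h.contDiffOn_sweep i).differentiableAt_of_isOpen (h.isOpen.prod hI₂)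
    hx).hasDerivAt_fst.unique (h.hasDerivAt_sweep_fst i hx.1)

theorem lieForm_sweep (h : IsSweptFrame I₁ I₂ f q v₀ B c) {x : ℝ × ℝ} (hx : x ∈ I₁ ×ˢ I₂)
    (i j : ℕ) : lieForm 2 (sweep B c i x) (sweep B c j x) = lieForm 2 (c i x.1) (c j x.1) :=
  h.isometry x.2 hx.2 _ _

theorem lieForm_sweep_normal (h : IsSweptFrame I₁ I₂ f q v₀ B c) {x : ℝ × ℝ} (hx : x ∈ I₁ ×ˢ I₂)
    (i : ℕ) : lieForm 2 (sweep B c i x) (q x.2) = 0 := by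
  rw [← h.transport_normal x.2 hx.2, sweep, h.isometry x.2 hx.2, h.normal i x.1 hx.1]

theorem dv_sweep (h : IsSweptFrame I₁ I₂ f q v₀ B c) (hI₂ : IsOpen I₂) (i : ℕ) {x : ℝ × ℝ}
    (hx : x ∈ I₁ ×ˢ I₂) :
    dv (sweep B c i) x = -lieForm 2 (deriv q x.2) (sweep B c i x) • q x.2 := by
  have h1 : HasDerivAt (fun t => sweep B c i (x.1, t)) _ x.2 :=
    (h.hasDerivAt_transport x.2 hx.2).clm_apply (hasDerivAt_const x.2 (c i x.1))
  refine (((h.contDiffOn_sweep i).differentiableAt_of_isOpen (h.isOpen.prod hI₂)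
    hx).hasDerivAt_snd.unique h1).trans ?_
  have h2 : lieForm 2 (q x.2) (B x.2 (c i x.1)) = 0 := by
    rw [lieForm_comm]; exact h.lieForm_sweep_normal hx i
  simp [wedge_apply, h2, sweep]

end IsSweptFrame

/-- Gram relations of a frame `a, b, n, k, l` of a Legendre curve together with a unit normal `e`;
`k` and `l` are the third and fourth derivatives. -/
structure IsFrameGram (a b n k l e : LieSpace 2) (g g' : ℝ) : Prop where
  aa : lieForm 2 a a = 0
  ab : lieForm 2 a b = 0
  bb : lieForm 2 b b = 0
  an : lieForm 2 a n = 0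
  bn : lieForm 2 b n = 0
  ak : lieForm 2 a k = 0
  bk : lieForm 2 b k = -g
  al : lieForm 2 a l = g
  bl : lieForm 2 b l = -3 * g'
  nn : lieForm 2 n n = g
  nk : lieForm 2 n k = g'
  ae : lieForm 2 a e = 0
  be : lieForm 2 b e = 0
  ne : lieForm 2 n e = 0
  ke : lieForm 2 k e = 0
  le : lieForm 2 l e = 0
  ee : lieForm 2 e e = 1
  pos : 0 < g

/-- Elements of `f ∧ f^⊥` in terms of the frame. -/
noncomputable def frameWedge (a b n e : LieSpace 2) (α β γ δ ε : ℝ) :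
    LieSpace 2 →L[ℝ] LieSpace 2 :=
  α • wedge a b + β • wedge a n + γ • wedge b n + δ • wedge a e + ε • wedge b e

theorem frameWedge_apply (a b n e z : LieSpace 2) (α β γ δ ε : ℝ) :
    frameWedge a b n e α β γ δ ε z =
      α • (lieForm 2 a z • b - lieForm 2 b z • a) + β • (lieForm 2 a z • n - lieForm 2 n z • a)
        + γ • (lieForm 2 b z • n - lieForm 2 n z • b) + δ • (lieForm 2 a z • e - lieForm 2 e z • a)
        + ε • (lieForm 2 b z • e - lieForm 2 e z • b) := by
  simp [frameWedge, wedge_apply]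

namespace IsFrameGram

variable {a b n k l e : LieSpace 2} {g g' : ℝ}

theorem coeff_eq_zero (H : IsFrameGram a b n k l e g g') {x y : ℝ} {z : LieSpace 2}
    (hz : x • a + y • b = z) (hk : lieForm 2 z k = 0) (hl : lieForm 2 z l = 0) : x = 0 ∧ y = 0 := by
  have hg := H.pos.ne'
  subst hz
  simp only [map_add, map_smul, LinearMap.add_apply, LinearMap.smul_apply, smul_eq_mul, H.ak, H.bk,
    H.al] at hk hl
  have hy : y = 0 := by
    have : y * g = 0 := by linarith
    exact (mul_eq_zero.1 this).resolve_right hg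
  subst hy
  exact ⟨(mul_eq_zero.1 (by linarith : x * g = 0)).resolve_right hg, rfl⟩

theorem linearIndependent (H : IsFrameGram a b n k l e g g') : LinearIndependent ℝ ![a, b] := by
  rw [LinearIndependent.pair_iff]
  intro x y hxy
  exact H.coeff_eq_zero hxy (by simp) (by simp)

theorem exists_eq_frameWedge (H : IsFrameGram a b n k l e g g')
    {T : LieSpace 2 →L[ℝ] LieSpace 2}
    (hT : T ∈ wedgeSpace (Submodule.span ℝ {a, b}) (perp (Submodule.span ℝ {a, b}))) :
    ∃ α β γ δ ε : ℝ, T = frameWedge a b n e α β γ δ ε := by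
  have hg := H.pos.ne'
  induction hT using Submodule.span_induction with
  | mem T hT =>
    obtain ⟨x, hx, y, hy, rfl⟩ := hT
    obtain ⟨x₁, x₂, rfl⟩ := Submodule.mem_span_pair.1 hx
    rw [mem_perp] at hy
    have hya := hy a (Submodule.subset_span (by simp))
    have hyb := hy b (Submodule.subset_span (by simp))
    have hmem : y - (lieForm 2 n y / g) • n - lieForm 2 e y • e ∈ Submodule.span ℝ {a, b} := by
      refine mem_span_of_gram H.linearIndependent H.aa H.ab H.bb H.an H.bn H.ae H.be H.ne
        (by rw [H.nn]; exact hg) (by rw [H.ee]; exact one_ne_zero) ?_ ?_ ?_ ?_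
      · simp [hya, H.an, H.ae]
      · simp [hyb, H.bn, H.be]
      · simp [H.nn, H.ne, hg]
      · simp [lieForm_comm e n, H.ne, H.ee]
    obtain ⟨y₁, y₂, hy'⟩ := Submodule.mem_span_pair.1 hmem
    have hy2 : y = y₁ • a + y₂ • b + (lieForm 2 n y / g) • n + lieForm 2 e y • e := by
      rw [hy']; abel
    generalize lieForm 2 n y / g = y₃ at hy2
    generalize lieForm 2 e y = y₄ at hy2
    subst hy2
    refine ⟨x₁ * y₂ - x₂ * y₁, x₁ * y₃, x₂ * y₃, x₁ * y₄, x₂ * y₄, ?_⟩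
    ext1 z
    simp only [frameWedge_apply, wedge_apply, map_add, map_smul, LinearMap.add_apply,
      LinearMap.smul_apply, smul_eq_mul]
    module
  | zero => exact ⟨0, 0, 0, 0, 0, by simp [frameWedge]⟩
  | add T T' _ _ h h' =>
    obtain ⟨α, β, γ, δ, ε, rfl⟩ := h
    obtain ⟨α', β', γ', δ', ε', rfl⟩ := h'
    exact ⟨α + α', β + β', γ + γ', δ + δ', ε + ε', by simp only [frameWedge]; module⟩
  | smul t T _ h =>
    obtain ⟨α, β, γ, δ, ε, rfl⟩ := h
    exact ⟨t * α, t * β, t * γ, t * δ, t * ε, by simp only [frameWedge]; module⟩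

variable {α β γ δ ε : ℝ}

theorem frameWedge_a (H : IsFrameGram a b n k l e g g') : frameWedge a b n e α β γ δ ε a = 0 := by
  simp [frameWedge_apply, H.aa, lieForm_comm b a, H.ab, lieForm_comm n a, H.an, lieForm_comm e a,
    H.ae]

theorem frameWedge_b (H : IsFrameGram a b n k l e g g') : frameWedge a b n e α β γ δ ε b = 0 := by
  simp [frameWedge_apply, H.bb, H.ab, lieForm_comm n b, H.bn, lieForm_comm e b, H.be]

theorem frameWedge_n (H : IsFrameGram a b n k l e g g') :
    frameWedge a b n e α β γ δ ε n = -g • (β • a + γ • b) := by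
  simp only [frameWedge_apply, H.an, H.bn, H.nn, lieForm_comm e n, H.ne]
  module

theorem frameWedge_e (H : IsFrameGram a b n k l e g g') :
    frameWedge a b n e α β γ δ ε e = -(δ • a + ε • b) := by
  simp only [frameWedge_apply, H.ae, H.be, H.ne, H.ee]
  module

theorem frameWedge_k (H : IsFrameGram a b n k l e g g') :
    frameWedge a b n e α β γ δ ε k =
      (α * g - β * g') • a - (γ * g') • b - (γ * g) • n - (ε * g) • e := by
  simp only [frameWedge_apply, H.ak, H.bk, H.nk, lieForm_comm e k, H.ke]
  module

theorem frameWedge_l (H : IsFrameGram a b n k l e g g') (hβ : β = 0) (hγ : γ = 0) :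
    frameWedge a b n e α β γ δ ε l =
      (3 * α * g') • a + (α * g) • b + (δ * g - 3 * ε * g') • e := by
  simp only [frameWedge_apply, H.al, H.bl, lieForm_comm e l, H.le, hβ, hγ]
  module

end IsFrameGram

theorem IsSweptFrame.isFrameGram {I₁ I₂ : Set ℝ} {f : ℝ × ℝ → Submodule ℝ (LieSpace 2)}
    {q : ℝ → LieSpace 2} {v₀ : ℝ} {B : ℝ → LieSpace 2 →L[ℝ] LieSpace 2} {c : ℕ → ℝ → LieSpace 2}
    (h : IsSweptFrame I₁ I₂ f q v₀ B c) (hq : IsUnitNormal I₁ I₂ f q) {x : ℝ × ℝ}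
    (hx : x ∈ I₁ ×ˢ I₂) :
    IsFrameGram (sweep B c 0 x) (sweep B c 1 x) (sweep B c 2 x) (sweep B c 3 x) (sweep B c 4 x)
      (q x.2) (lieForm 2 (c 2 x.1) (c 2 x.1)) (lieForm 2 (c 2 x.1) (c 3 x.1)) := by
  have hg : lieForm 2 (c 1 x.1) (c 4 x.1) = -3 * lieForm 2 (c 2 x.1) (c 3 x.1) := by
    have := (((h.hasDerivAt 1 x.1 hx.1).lieForm (h.hasDerivAt 3 x.1 hx.1)).add
      ((h.hasDerivAt 2 x.1 hx.1).lieForm (h.hasDerivAt 2 x.1 hx.1))).eq_zero_of_eqOn_const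
      h.isOpen hx.1 (k := 0) fun u hu => by
        simp only [Pi.add_apply]; rw [h.gram₁₃ hu]; ring
    rw [lieForm_comm (c (2 + 1) x.1)] at this
    linarith
  constructor <;> (try rw [h.lieForm_sweep hx]) <;> (try rw [h.lieForm_sweep_normal hx])
  · exact h.null_zero _ hx.1
  · exact h.gram₀₁ hx.1
  · exact h.null_one _ hx.1
  · exact h.gram₀₂ hx.1
  · exact h.gram₁₂ hx.1
  · exact h.gram₀₃ hx.1
  · exact h.gram₁₃ hx.1
  · exact h.gram₀₄ hx.1
  · exact hg
  · exact hq.unit _ hx.2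
  · exact h.pos_two _ hx.1

theorem IsFrameGram.coeff_eq_zero₄ {a b n k l e : LieSpace 2} {g g' x y z w : ℝ}
    (H : IsFrameGram a b n k l e g g') (h : x • a + y • b + z • n + w • e = 0) :
    x = 0 ∧ y = 0 ∧ z = 0 ∧ w = 0 := by
  have hg := H.pos.ne'
  have hz : z = 0 := by
    have := congrArg (fun t => lieForm 2 t n) h
    simpa [H.an, H.bn, H.nn, lieForm_comm e n, H.ne, hg] using this
  have hw : w = 0 := by
    have := congrArg (fun t => lieForm 2 t e) h
    simpa [H.ae, H.be, H.ne, H.ee] using this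
  subst hz hw
  have hxy : x • a + y • b = 0 := by simpa using h
  obtain ⟨hx, hy⟩ := H.coeff_eq_zero hxy (by simp) (by simp)
  exact ⟨hx, hy, rfl, rfl⟩

section Product

variable {U : Set (ℝ × ℝ)} {φ ψ : ℝ × ℝ → ℝ}

theorem du_mul (hU : IsOpen U) (hφ : ContDiffOn ℝ ∞ φ U) (hψ : ContDiffOn ℝ ∞ ψ U) {x : ℝ × ℝ}
    (hx : x ∈ U) : du (fun y => φ y * ψ y) x = du φ x * ψ x + φ x * du ψ x :=
  du_smul hU hφ hψ hx

theorem dv_mul (hU : IsOpen U) (hφ : ContDiffOn ℝ ∞ φ U) (hψ : ContDiffOn ℝ ∞ ψ U) {x : ℝ × ℝ}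
    (hx : x ∈ U) : dv (fun y => φ y * ψ y) x = dv φ x * ψ x + φ x * dv ψ x :=
  dv_smul hU hφ hψ hx

/-- A closed one-form `η` with values in the endomorphisms, applied to a moving vector. -/
theorem du_apply_sub_eq {G : Type*} [NormedAddCommGroup G] [NormedSpace ℝ G] (hU : IsOpen U)
    {η : ℝ × ℝ → ℝ × ℝ →L[ℝ] G →L[ℝ] G} (hη : ContDiffOn ℝ ∞ η U)
    (hcl : ∀ x ∈ U, ∀ X Y : ℝ × ℝ, fderiv ℝ η x X Y - fderiv ℝ η x Y X = 0) {F : ℝ × ℝ → G}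
    (hF : ContDiffOn ℝ ∞ F U) {x : ℝ × ℝ} (hx : x ∈ U) :
    du (fun y => η y (0, 1) (F y)) x - η x (0, 1) (du F x) =
      dv (fun y => η y (1, 0) (F y)) x - η x (1, 0) (dv F x) := by
  have hηd := (hη.differentiableAt_of_isOpen hU hx).hasFDerivAt
  have hFd := (hF.differentiableAt_of_isOpen hU hx).hasFDerivAt
  have key : ∀ Y X : ℝ × ℝ, fderiv ℝ (fun y => η y Y (F y)) x X =
      fderiv ℝ η x X Y (F x) + η x Y (fderiv ℝ F x X) := fun Y X => by
    have h1 : HasFDerivAt (fun y => η y Y (F y)) _ x :=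
      (hηd.clm_apply (hasFDerivAt_const Y x)).clm_apply hFd
    rw [h1.fderiv]
    simp [add_comm]
  have h2 := congrArg (fun T : G →L[ℝ] G => T (F x)) (hcl x hx (1, 0) (0, 1))
  simp only [sub_apply, zero_apply, sub_eq_zero] at h2
  simp only [du, dv, key, h2]
  abel

end Product

namespace IsSweptFrame

variable {I₁ I₂ : Set ℝ} {f : ℝ × ℝ → Submodule ℝ (LieSpace 2)} {q : ℝ → LieSpace 2} {v₀ : ℝ}
  {B : ℝ → LieSpace 2 →L[ℝ] LieSpace 2} {c : ℕ → ℝ → LieSpace 2}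

/-- The coefficients of a smooth map into `f ∧ f^⊥` with respect to the moving frame are smooth. -/
theorem exists_contDiffOn_coeff (h : IsSweptFrame I₁ I₂ f q v₀ B c)
    (hq : IsUnitNormal I₁ I₂ f q) {T : ℝ × ℝ → LieSpace 2 →L[ℝ] LieSpace 2}
    (hT : ContDiffOn ℝ ∞ T (I₁ ×ˢ I₂))
    (hval : ∀ x ∈ I₁ ×ˢ I₂, T x ∈ wedgeSpace (f x) (perp (f x))) :
    ∃ α β γ δ ε : ℝ × ℝ → ℝ, ContDiffOn ℝ ∞ α (I₁ ×ˢ I₂) ∧ ContDiffOn ℝ ∞ β (I₁ ×ˢ I₂) ∧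
      ContDiffOn ℝ ∞ γ (I₁ ×ˢ I₂) ∧ ContDiffOn ℝ ∞ δ (I₁ ×ˢ I₂) ∧ ContDiffOn ℝ ∞ ε (I₁ ×ˢ I₂) ∧
      ∀ x ∈ I₁ ×ˢ I₂, T x = frameWedge (sweep B c 0 x) (sweep B c 1 x) (sweep B c 2 x) (q x.2)
        (α x) (β x) (γ x) (δ x) (ε x) := by
  have hex : ∀ x, ∃ α β γ δ ε : ℝ, x ∈ I₁ ×ˢ I₂ → T x = frameWedge (sweep B c 0 x) (sweep B c 1 x)
      (sweep B c 2 x) (q x.2) α β γ δ ε := by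
    intro x
    by_cases hx : x ∈ I₁ ×ˢ I₂
    · have hTx := hval x hx
      rw [h.span x.1 hx.1 x.2 hx.2] at hTx
      obtain ⟨α, β, γ, δ, ε, hT⟩ := (h.isFrameGram hq hx).exists_eq_frameWedge hTx
      exact ⟨α, β, γ, δ, ε, fun _ => hT⟩
    · exact ⟨0, 0, 0, 0, 0, fun hx' => absurd hx' hx⟩
  choose α β γ δ ε hform using hex
  have S := h.contDiffOn_sweep
  have qs : ContDiffOn ℝ ∞ (fun x : ℝ × ℝ => q x.2) (I₁ ×ˢ I₂) := contDiffOn_comp_snd hq.smooth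
  have gs : ContDiffOn ℝ ∞ (fun x : ℝ × ℝ => lieForm 2 (c 2 x.1) (c 2 x.1)) (I₁ ×ˢ I₂) :=
    contDiffOn_comp_fst ((h.smooth 2).lieForm (h.smooth 2))
  have gs' : ContDiffOn ℝ ∞ (fun x : ℝ × ℝ => lieForm 2 (c 2 x.1) (c 3 x.1)) (I₁ ×ˢ I₂) :=
    contDiffOn_comp_fst ((h.smooth 2).lieForm (h.smooth 3))
  have hg : ∀ x ∈ I₁ ×ˢ I₂, lieForm 2 (c 2 x.1) (c 2 x.1) ≠ 0 := fun x hx =>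
    (h.pos_two x.1 hx.1).ne'
  have ap := fun {F : ℝ × ℝ → LieSpace 2} (hF : ContDiffOn ℝ ∞ F (I₁ ×ˢ I₂)) (i : ℕ) =>
    (hT.clm_apply hF).lieForm (S i)
  have hγ : ContDiffOn ℝ ∞ γ (I₁ ×ˢ I₂) := by
    refine ((ap (S 2) 3).div (gs.pow 2) fun x hx => pow_ne_zero 2 (hg x hx)).congr fun x hx => ?_
    have H := h.isFrameGram hq hx
    have := hg x hx
    simp only [Pi.div_apply]
    rw [hform x hx, H.frameWedge_n]
    simp only [map_add, map_smul, LinearMap.add_apply, LinearMap.smul_apply, smul_eq_mul, H.ak,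
      H.bk]
    field_simp
    ring
  have hβ : ContDiffOn ℝ ∞ β (I₁ ×ˢ I₂) := by
    refine (((contDiffOn_const (c := (3 : ℝ))).mul (gs'.mul hγ)).sub
      ((ap (S 2) 4).div gs hg)).div gs hg |>.congr fun x hx => ?_
    have H := h.isFrameGram hq hx
    have := hg x hx
    simp only [Pi.div_apply]
    rw [hform x hx, H.frameWedge_n]
    simp only [map_add, map_smul, LinearMap.add_apply, LinearMap.smul_apply, smul_eq_mul, H.al,
      H.bl]
    field_simp
    ring
  have hε : ContDiffOn ℝ ∞ ε (I₁ ×ˢ I₂) := by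
    refine ((ap qs 3).div gs hg).congr fun x hx => ?_
    have H := h.isFrameGram hq hx
    have := hg x hx
    simp only [Pi.div_apply]
    rw [hform x hx, H.frameWedge_e]
    simp only [map_add, map_smul, map_neg, LinearMap.add_apply, LinearMap.smul_apply,
      LinearMap.neg_apply, smul_eq_mul, H.ak, H.bk]
    field_simp
    ring
  have hδ : ContDiffOn ℝ ∞ δ (I₁ ×ˢ I₂) := by
    refine (((contDiffOn_const (c := (3 : ℝ))).mul (gs'.mul hε)).sub
      (ap qs 4)).div gs hg |>.congr fun x hx => ?_
    have H := h.isFrameGram hq hx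
    have := hg x hx
    simp only [Pi.div_apply]
    rw [hform x hx, H.frameWedge_e]
    simp only [map_add, map_smul, map_neg, LinearMap.add_apply, LinearMap.smul_apply,
      LinearMap.neg_apply, smul_eq_mul, H.al, H.bl]
    field_simp
    ring
  have hα : ContDiffOn ℝ ∞ α (I₁ ×ˢ I₂) := by
    refine ((((((ap (S 3) 4).add ((gs'.mul gs).mul hβ)).sub
      ((contDiffOn_const (c := (3 : ℝ))).mul ((gs'.pow 2).mul hγ))).add
      ((gs.mul hγ).mul ((S 2).lieForm (S 4)))).div (gs.pow 2)
      fun x hx => pow_ne_zero 2 (hg x hx))).congr fun x hx => ?_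
    have H := h.isFrameGram hq hx
    have := hg x hx
    simp only [Pi.div_apply]
    rw [hform x hx, H.frameWedge_k]
    simp only [map_sub, map_smul, LinearMap.sub_apply, LinearMap.smul_apply, smul_eq_mul,
      H.al, H.bl, lieForm_comm (q x.2) (sweep B c 4 x), H.le]
    field_simp
    ring
  exact ⟨α, β, γ, δ, ε, hα, hβ, hγ, hδ, hε, hform⟩

/-- Closedness of a gauge potential in terms of its coefficients, where `μᵢ = (q', ∂ᵤⁱ S)`. -/
theorem exists_potential_coeff (h : IsSweptFrame I₁ I₂ f q v₀ B c) (hI₂ : IsOpen I₂)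
    (hq : IsUnitNormal I₁ I₂ f q) {η : ℝ × ℝ → ℝ × ℝ →L[ℝ] LieSpace 2 →L[ℝ] LieSpace 2}
    (hη : IsGaugePotential (I₁ ×ˢ I₂) f η) :
    ∃ α β γ δ ε : ℝ × ℝ → ℝ, ContDiffOn ℝ ∞ α (I₁ ×ˢ I₂) ∧ ContDiffOn ℝ ∞ β (I₁ ×ˢ I₂) ∧
      ContDiffOn ℝ ∞ γ (I₁ ×ˢ I₂) ∧ ContDiffOn ℝ ∞ δ (I₁ ×ˢ I₂) ∧ ContDiffOn ℝ ∞ ε (I₁ ×ˢ I₂) ∧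
      ∀ x ∈ I₁ ×ˢ I₂,
        η x (1, 0) = frameWedge (sweep B c 0 x) (sweep B c 1 x) (sweep B c 2 x) (q x.2)
          (α x) (β x) (γ x) 0 0 ∧
        η x (0, 1) = frameWedge (sweep B c 0 x) (sweep B c 1 x) (sweep B c 2 x) (q x.2)
          (dv β x) 0 0 (δ x) (ε x) ∧
        dv γ x = 0 ∧
        ε x = β x * lieForm 2 (deriv q x.2) (sweep B c 0 x)
          + γ x * lieForm 2 (deriv q x.2) (sweep B c 1 x) ∧
        δ x + du ε x = α x * lieForm 2 (deriv q x.2) (sweep B c 0 x)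
          - γ x * lieForm 2 (deriv q x.2) (sweep B c 2 x) ∧
        du δ x = -α x * lieForm 2 (deriv q x.2) (sweep B c 1 x)
          - β x * lieForm 2 (deriv q x.2) (sweep B c 2 x) ∧
        dv α x = du (dv β) x := by
  have hU : IsOpen (I₁ ×ˢ I₂) := h.isOpen.prod hI₂
  have hηs := fun X : ℝ × ℝ => hη.smooth.clm_apply (contDiffOn_const (c := X))
  obtain ⟨α, β, γ, δ₁, ε₁, hα, hβ, hγ, -, -, h₁⟩ := h.exists_contDiffOn_coeff hq (hηs (1, 0))
    fun x hx => hη.values x hx _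
  obtain ⟨α₂, β₂, γ₂, δ, ε, -, -, -, hδ, hε, h₂⟩ := h.exists_contDiffOn_coeff hq (hηs (0, 1))
    fun x hx => hη.values x hx _
  have S := h.contDiffOn_sweep
  have qs : ContDiffOn ℝ ∞ (fun x : ℝ × ℝ => q x.2) (I₁ ×ˢ I₂) := contDiffOn_comp_snd hq.smooth
  have duS := fun (i : ℕ) {x : ℝ × ℝ} (hx : x ∈ I₁ ×ˢ I₂) => h.du_sweep hI₂ i hx
  have dvS := fun (i : ℕ) {x : ℝ × ℝ} (hx : x ∈ I₁ ×ˢ I₂) => h.dv_sweep hI₂ i hx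
  have H := fun {x : ℝ × ℝ} (hx : x ∈ I₁ ×ˢ I₂) => h.isFrameGram hq hx
  have dq0 := fun {x : ℝ × ℝ} (hx : x ∈ I₁ ×ˢ I₂) =>
    hq.smooth.differentiableAt_of_isOpen hI₂ hx.2
  have closed := fun {F : ℝ × ℝ → LieSpace 2} (hF : ContDiffOn ℝ ∞ F (I₁ ×ˢ I₂)) {x : ℝ × ℝ}
    (hx : x ∈ I₁ ×ˢ I₂) => du_apply_sub_eq hU hη.smooth hη.closed hF hx
  have hg : ∀ x ∈ I₁ ×ˢ I₂, lieForm 2 (c 2 x.1) (c 2 x.1) ≠ 0 := fun x hx =>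
    (h.pos_two x.1 hx.1).ne'
  -- Closedness applied to the first two frame vectors, which both components annihilate.
  have e0 : ∀ x ∈ I₁ ×ˢ I₂, η x (1, 0) (q x.2) = 0 := by
    intro x hx
    have := closed (S 0) hx
    rw [du_eq_zero_of_const hU (k := 0) (fun y hy => by rw [h₂ y hy, (H hy).frameWedge_a]) hx,
      dv_eq_zero_of_const hU (k := 0) (fun y hy => by rw [h₁ y hy, (H hy).frameWedge_a]) hx,
      duS 0 hx, dvS 0 hx, h₂ x hx, (H hx).frameWedge_b, map_smul, sub_self, zero_sub, eq_comm,
      neg_eq_zero, smul_eq_zero] at this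
    exact this.resolve_left (neg_ne_zero.2 (h.transversal x.1 hx.1 x.2 hx.2))
  have hδε : ∀ x ∈ I₁ ×ˢ I₂, δ₁ x = 0 ∧ ε₁ x = 0 := by
    intro x hx
    have := e0 x hx
    rw [h₁ x hx, (H hx).frameWedge_e, neg_eq_zero] at this
    exact (H hx).coeff_eq_zero this (by simp) (by simp)
  have hβγ : ∀ x ∈ I₁ ×ˢ I₂, β₂ x = 0 ∧ γ₂ x = 0 := by
    intro x hx
    have := closed (S 1) hx
    rw [du_eq_zero_of_const hU (k := 0) (fun y hy => by rw [h₂ y hy, (H hy).frameWedge_b]) hx,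
      dv_eq_zero_of_const hU (k := 0) (fun y hy => by rw [h₁ y hy, (H hy).frameWedge_b]) hx,
      duS 1 hx, dvS 1 hx, map_smul, e0 x hx, smul_zero, sub_self, zero_sub, neg_eq_zero, h₂ x hx,
      (H hx).frameWedge_n, smul_eq_zero] at this
    exact (H hx).coeff_eq_zero (this.resolve_left (neg_ne_zero.2 (hg x hx))) (by simp) (by simp)
  have h₁ : ∀ x ∈ I₁ ×ˢ I₂, η x (1, 0) = frameWedge (sweep B c 0 x) (sweep B c 1 x)
      (sweep B c 2 x) (q x.2) (α x) (β x) (γ x) 0 0 := fun x hx => by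
    rw [h₁ x hx, (hδε x hx).1, (hδε x hx).2]
  have h₂ : ∀ x ∈ I₁ ×ˢ I₂, η x (0, 1) = frameWedge (sweep B c 0 x) (sweep B c 1 x)
      (sweep B c 2 x) (q x.2) (α₂ x) 0 0 (δ x) (ε x) := fun x hx => by
    rw [h₂ x hx, (hβγ x hx).1, (hβγ x hx).2]
  set g : ℝ × ℝ → ℝ := fun x => lieForm 2 (c 2 x.1) (c 2 x.1) with hgdef
  set g' : ℝ × ℝ → ℝ := fun x => lieForm 2 (c 2 x.1) (c 3 x.1) with hgdef'
  have gs : ContDiffOn ℝ ∞ g (I₁ ×ˢ I₂) :=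
    contDiffOn_comp_fst ((h.smooth 2).lieForm (h.smooth 2))
  have gs' : ContDiffOn ℝ ∞ g' (I₁ ×ˢ I₂) :=
    contDiffOn_comp_fst ((h.smooth 2).lieForm (h.smooth 3))
  have dvg : ∀ x ∈ I₁ ×ˢ I₂, dv g x = 0 := fun x hx =>
    dv_comp_fst (fun u => lieForm 2 (c 2 u) (c 2 u))
      (((h.smooth 2).lieForm (h.smooth 2)).differentiableAt_of_isOpen h.isOpen hx.1)
  have dvg' : ∀ x ∈ I₁ ×ˢ I₂, dv g' x = 0 := fun x hx =>
    dv_comp_fst (fun u => lieForm 2 (c 2 u) (c 3 u))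
      (((h.smooth 2).lieForm (h.smooth 3)).differentiableAt_of_isOpen h.isOpen hx.1)
  have dug : ∀ x ∈ I₁ ×ˢ I₂, du g x = 2 * g' x := fun x hx => by
    have hd := (h.hasDerivAt 2 x.1 hx.1).lieForm (h.hasDerivAt 2 x.1 hx.1)
    refine (du_comp_fst (fun u => lieForm 2 (c 2 u) (c 2 u)) hd.differentiableAt).trans ?_
    rw [hd.deriv, lieForm_comm (c (2 + 1) x.1)]
    simp only [hgdef', Nat.reduceAdd]
    ring
  -- Closedness applied to the third frame vector.
  have eq₂ : ∀ x ∈ I₁ ×ˢ I₂, α₂ x = dv β x ∧ dv γ x = 0 ∧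
      ε x = β x * lieForm 2 (deriv q x.2) (sweep B c 0 x)
        + γ x * lieForm 2 (deriv q x.2) (sweep B c 1 x) := by
    intro x hx
    have hβS : ContDiffOn ℝ ∞ (fun y => β y • sweep B c 0 y) (I₁ ×ˢ I₂) := hβ.smul (S 0)
    have hγS : ContDiffOn ℝ ∞ (fun y => γ y • sweep B c 1 y) (I₁ ×ˢ I₂) := hγ.smul (S 1)
    have hsum : ContDiffOn ℝ ∞ (fun y => β y • sweep B c 0 y + γ y • sweep B c 1 y) (I₁ ×ˢ I₂) :=
      hβS.add hγS
    have hdv : dv (fun y => η y (1, 0) (sweep B c 2 y)) x =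
        -g x • (dv β x • sweep B c 0 x + dv γ x • sweep B c 1 x
          - (β x * lieForm 2 (deriv q x.2) (sweep B c 0 x)
            + γ x * lieForm 2 (deriv q x.2) (sweep B c 1 x)) • q x.2) := by
      have hneg : dv (fun y => -g y) x = 0 := by
        have hd : HasFDerivAt (fun y => -g y) _ x :=
          (gs.differentiableAt_of_isOpen hU hx).hasFDerivAt.neg
        have := dvg x hx
        rw [dv] at this ⊢
        rw [hd.fderiv]
        simp [this]
      rw [dv_congr hU (fun y hy => by rw [h₁ y hy, (H hy).frameWedge_n]) hx,
        dv_smul hU gs.neg hsum hx, hneg, dv_add hU hβS hγS hx, dv_smul hU hβ (S 0) hx,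
        dv_smul hU hγ (S 1) hx, dvS 0 hx, dvS 1 hx]
      module
    have := closed (S 2) hx
    rw [du_eq_zero_of_const hU (k := 0) (fun y hy => by rw [h₂ y hy, (H hy).frameWedge_n]; simp) hx,
      hdv, duS 2 hx, dvS 2 hx, map_smul, e0 x hx, h₂ x hx, (H hx).frameWedge_k] at this
    obtain ⟨h1, h2, -, h3⟩ := (H hx).coeff_eq_zero₄ (x := g x * (dv β x - α₂ x))
      (y := g x * dv γ x) (z := 0)
      (w := g x * (ε x - (β x * lieForm 2 (deriv q x.2) (sweep B c 0 x)
            + γ x * lieForm 2 (deriv q x.2) (sweep B c 1 x)))) (by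
        rw [← sub_eq_zero] at this
        rw [← this]
        module)
    refine ⟨?_, (mul_eq_zero.1 h2).resolve_left (hg x hx), ?_⟩
    · exact (sub_eq_zero.1 ((mul_eq_zero.1 h1).resolve_left (hg x hx))).symm
    · exact sub_eq_zero.1 ((mul_eq_zero.1 h3).resolve_left (hg x hx))
  -- Closedness applied to the normal.
  have eq₃ : ∀ x ∈ I₁ ×ˢ I₂, δ x + du ε x = α x * lieForm 2 (deriv q x.2) (sweep B c 0 x)
        - γ x * lieForm 2 (deriv q x.2) (sweep B c 2 x) ∧
      du δ x = -α x * lieForm 2 (deriv q x.2) (sweep B c 1 x)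
        - β x * lieForm 2 (deriv q x.2) (sweep B c 2 x) := by
    intro x hx
    have hδS : ContDiffOn ℝ ∞ (fun y => -δ y • sweep B c 0 y) (I₁ ×ˢ I₂) := hδ.neg.smul (S 0)
    have hεS : ContDiffOn ℝ ∞ (fun y => -ε y • sweep B c 1 y) (I₁ ×ˢ I₂) := hε.neg.smul (S 1)
    have hneg : ∀ φ : ℝ × ℝ → ℝ, du (fun y => -φ y) x = -du φ x := fun φ => by
      simp [du]
    have hdu : du (fun y => η y (0, 1) (q y.2)) x =
        -du δ x • sweep B c 0 x - (δ x + du ε x) • sweep B c 1 x - ε x • sweep B c 2 x := by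
      rw [du_congr hU (F' := fun y => -δ y • sweep B c 0 y + -ε y • sweep B c 1 y)
          (fun y hy => by rw [h₂ y hy, (H hy).frameWedge_e]; module) hx,
        du_add hU hδS hεS hx, du_smul hU hδ.neg (S 0) hx, du_smul hU hε.neg (S 1) hx, duS 0 hx,
        duS 1 hx, hneg, hneg]
      module
    have := closed qs hx
    rw [dv_eq_zero_of_const hU e0 hx, hdu, du_comp_snd q (dq0 hx), dv_comp_snd q (dq0 hx), map_zero,
      h₁ x hx, frameWedge_apply] at this
    simp only [lieForm_comm (sweep B c _ x) (deriv q x.2)] at this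
    obtain ⟨h1, h2, -⟩ := (H hx).coeff_eq_zero₄
      (x := -α x * lieForm 2 (deriv q x.2) (sweep B c 1 x)
        - β x * lieForm 2 (deriv q x.2) (sweep B c 2 x) - du δ x)
      (y := α x * lieForm 2 (deriv q x.2) (sweep B c 0 x)
        - γ x * lieForm 2 (deriv q x.2) (sweep B c 2 x) - (δ x + du ε x))
      (z := β x * lieForm 2 (deriv q x.2) (sweep B c 0 x)
        + γ x * lieForm 2 (deriv q x.2) (sweep B c 1 x) - ε x) (w := 0) (by
        rw [← sub_eq_zero] at this
        rw [← this]
        module)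
    exact ⟨(sub_eq_zero.1 h2).symm, (sub_eq_zero.1 h1).symm⟩
  have hβv := hβ.dv hU
  have h₂ : ∀ x ∈ I₁ ×ˢ I₂, η x (0, 1) = frameWedge (sweep B c 0 x) (sweep B c 1 x)
      (sweep B c 2 x) (q x.2) (dv β x) 0 0 (δ x) (ε x) := fun x hx => by
    rw [h₂ x hx, (eq₂ x hx).1]
  refine ⟨α, β, γ, δ, ε, hα, hβ, hγ, hδ, hε, fun x hx => ⟨h₁ x hx, h₂ x hx, (eq₂ x hx).2.1,
    (eq₂ x hx).2.2, (eq₃ x hx).1, (eq₃ x hx).2, ?_⟩⟩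
  -- Closedness applied to the fourth derivative.
  have hφ : ContDiffOn ℝ ∞ (fun y => dv β y * g y) (I₁ ×ˢ I₂) := hβv.mul gs
  have hψ : ContDiffOn ℝ ∞ (fun y => -ε y * g y) (I₁ ×ˢ I₂) := hε.neg.mul gs
  have hαβ : ContDiffOn ℝ ∞ (fun y => α y * g y + -β y * g' y) (I₁ ×ˢ I₂) :=
    (hα.mul gs).add (hβ.neg.mul gs')
  have hγ₁ : ContDiffOn ℝ ∞ (fun y => γ y * g' y) (I₁ ×ˢ I₂) := hγ.mul gs'
  have hγ₂ : ContDiffOn ℝ ∞ (fun y => γ y * g y) (I₁ ×ˢ I₂) := hγ.mul gs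
  have hφS : ContDiffOn ℝ ∞ (fun y => (dv β y * g y) • sweep B c 0 y) (I₁ ×ˢ I₂) := hφ.smul (S 0)
  have hψS : ContDiffOn ℝ ∞ (fun y => (-ε y * g y) • q y.2) (I₁ ×ˢ I₂) := hψ.smul qs
  have hαS : ContDiffOn ℝ ∞ (fun y => (α y * g y + -β y * g' y) • sweep B c 0 y) (I₁ ×ˢ I₂) :=
    hαβ.smul (S 0)
  have hγS₁ : ContDiffOn ℝ ∞ (fun y => (γ y * g' y) • sweep B c 1 y) (I₁ ×ˢ I₂) := hγ₁.smul (S 1)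
  have hγS₂ : ContDiffOn ℝ ∞ (fun y => (γ y * g y) • sweep B c 2 y) (I₁ ×ˢ I₂) := hγ₂.smul (S 2)
  have hγS : ContDiffOn ℝ ∞ (fun y => (γ y * g' y) • sweep B c 1 y + (γ y * g y) • sweep B c 2 y)
    (I₁ ×ˢ I₂) := hγS₁.add hγS₂
  have hnegβ : dv (fun y => -β y) x = -dv β x := by simp [dv]
  have hdu : ∃ t : ℝ, du (fun y => η y (0, 1) (sweep B c 3 y)) x =
      (du (dv β) x * g x + dv β x * (2 * g' x)) • sweep B c 0 x
        + (dv β x * g x) • sweep B c 1 x + t • q x.2 := by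
    refine ⟨du (fun y => -ε y * g y) x, ?_⟩
    rw [du_congr hU (F' := fun y => (dv β y * g y) • sweep B c 0 y + (-ε y * g y) • q y.2)
        (fun y hy => by rw [h₂ y hy, (H hy).frameWedge_k]; module) hx,
      du_add hU hφS hψS hx, du_smul hU hφ (S 0) hx, du_smul hU hψ qs hx, duS 0 hx,
      du_mul hU hβv gs hx, dug x hx, du_comp_snd q (dq0 hx)]
    module
  have hdv : ∃ t : ℝ, dv (fun y => η y (1, 0) (sweep B c 3 y)) x =
      (dv α x * g x - dv β x * g' x) • sweep B c 0 x + t • q x.2 := by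
    refine ⟨(α x * g x + -β x * g' x) * -lieForm 2 (deriv q x.2) (sweep B c 0 x)
      - (γ x * g' x) * -lieForm 2 (deriv q x.2) (sweep B c 1 x)
      - (γ x * g x) * -lieForm 2 (deriv q x.2) (sweep B c 2 x), ?_⟩
    have hsub : ∀ {F F' : ℝ × ℝ → LieSpace 2}, ContDiffOn ℝ ∞ F (I₁ ×ˢ I₂) →
        ContDiffOn ℝ ∞ F' (I₁ ×ˢ I₂) → dv (fun y => F y - F' y) x = dv F x - dv F' x := by
      intro F F' hF hF'
      have hd : HasFDerivAt (fun y => F y - F' y) _ x :=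
        (hF.differentiableAt_of_isOpen hU hx).hasFDerivAt.sub
          (hF'.differentiableAt_of_isOpen hU hx).hasFDerivAt
      simp [dv, hd.fderiv]
    rw [dv_congr hU (F' := fun y => (α y * g y + -β y * g' y) • sweep B c 0 y
          - ((γ y * g' y) • sweep B c 1 y + (γ y * g y) • sweep B c 2 y))
        (fun y hy => by rw [h₁ y hy, (H hy).frameWedge_k]; module) hx,
      hsub hαS hγS, dv_add hU hγS₁ hγS₂ hx, dv_smul hU hαβ (S 0) hx, dv_smul hU hγ₁ (S 1) hx,
      dv_smul hU hγ₂ (S 2) hx, dvS 0 hx, dvS 1 hx, dvS 2 hx, dv_mul hU hγ gs' hx,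
      dv_mul hU hγ gs hx, dv_add hU (hα.mul gs) (hβ.neg.mul gs') hx, dv_mul hU hα gs hx,
      dv_mul hU hβ.neg gs' hx, hnegβ, dvg x hx, dvg' x hx, (eq₂ x hx).2.1]
    module
  obtain ⟨t, ht⟩ := hdu
  obtain ⟨t', ht'⟩ := hdv
  have := closed (S 3) hx
  rw [ht, ht', duS 3 hx, dvS 3 hx, map_smul, e0 x hx, smul_zero, sub_zero, h₂ x hx,
    (H hx).frameWedge_l rfl rfl] at this
  obtain ⟨h1, -⟩ := (H hx).coeff_eq_zero₄ (x := g x * (du (dv β) x - dv α x)) (y := 0) (z := 0)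
    (w := t - t' - (δ x * g x - 3 * ε x * g' x)) (by
      rw [← sub_eq_zero] at this
      rw [← this]
      module)
  exact (sub_eq_zero.1 ((mul_eq_zero.1 h1).resolve_left (hg x hx))).symm

end IsSweptFrame

namespace IsSweptFrame

variable {I₁ I₂ : Set ℝ} {f : ℝ × ℝ → Submodule ℝ (LieSpace 2)} {q : ℝ → LieSpace 2} {v₀ : ℝ}
  {B : ℝ → LieSpace 2 →L[ℝ] LieSpace 2} {c : ℕ → ℝ → LieSpace 2}

theorem hasDerivAt_lieForm_sweep (h : IsSweptFrame I₁ I₂ f q v₀ B c) (z : LieSpace 2) (i : ℕ)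
    {u v : ℝ} (hu : u ∈ I₁) : HasDerivAt (fun t => lieForm 2 z (sweep B c i (t, v)))
      (lieForm 2 z (sweep B c (i + 1) (u, v))) u := by
  simpa using (hasDerivAt_const u z).lieForm (h.hasDerivAt_sweep_fst i hu)

/-- The trace of `σ ↦ η(X) d_Y σ` for a gauge potential in terms of its coefficients. -/
theorem quadDiff_eq (h : IsSweptFrame I₁ I₂ f q v₀ B c) (hI₂ : IsOpen I₂)
    (hq : IsUnitNormal I₁ I₂ f q) {η : ℝ × ℝ → ℝ × ℝ →L[ℝ] LieSpace 2 →L[ℝ] LieSpace 2}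
    {x X Y : ℝ × ℝ} (hx : x ∈ I₁ ×ˢ I₂) {k α β γ α' δ ε : ℝ}
    (h₁ : η x (1, 0) = frameWedge (sweep B c 0 x) (sweep B c 1 x) (sweep B c 2 x) (q x.2)
      α β γ 0 0)
    (h₂ : η x (0, 1) = frameWedge (sweep B c 0 x) (sweep B c 1 x) (sweep B c 2 x) (q x.2)
      α' 0 0 δ ε)
    (hk : HasQuadDiffValue (I₁ ×ˢ I₂) f η x X Y k) :
    k = X.2 * Y.2 * (lieForm 2 (deriv q x.2) (sweep B c 0 x) * δ
      + lieForm 2 (deriv q x.2) (sweep B c 1 x) * ε)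
      - X.1 * Y.1 * (lieForm 2 (c 2 x.1) (c 2 x.1) * γ) := by
  obtain ⟨T, hT, rfl⟩ := hk
  have hspan : ∀ y ∈ I₁ ×ˢ I₂, f y = Submodule.span ℝ {sweep B c 0 y, sweep B c 1 y} :=
    fun y hy => h.span y.1 hy.1 y.2 hy.2
  have H := h.isFrameGram hq hx
  have hU : IsOpen (I₁ ×ˢ I₂) := h.isOpen.prod hI₂
  have ha : ∀ y ∈ I₁ ×ˢ I₂, sweep B c 0 y ∈ f y := fun y hy => by
    rw [hspan y hy]; exact Submodule.subset_span (by simp)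
  have hb : ∀ y ∈ I₁ ×ˢ I₂, sweep B c 1 y ∈ f y := fun y hy => by
    rw [hspan y hy]; exact Submodule.subset_span (by simp)
  have hX : η x X = X.1 • η x (1, 0) + X.2 • η x (0, 1) := by
    rw [← map_smul, ← map_smul, ← map_add]; simp
  have hY : ∀ i, fderiv ℝ (sweep B c i) x Y = Y.1 • sweep B c (i + 1) x
      - (Y.2 * lieForm 2 (deriv q x.2) (sweep B c i x)) • q x.2 := fun i => by
    have : Y = Y.1 • ((1 : ℝ), (0 : ℝ)) + Y.2 • ((0 : ℝ), (1 : ℝ)) := by simp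
    conv_lhs => rw [this]
    have h1 := h.du_sweep hI₂ i hx
    have h2 := h.dv_sweep hI₂ i hx
    rw [du] at h1
    rw [dv] at h2
    rw [map_add, map_smul, map_smul, h1, h2]
    module
  have hTa : (T ⟨sweep B c 0 x, ha x hx⟩ : LieSpace 2) =
      (X.2 * Y.2 * lieForm 2 (deriv q x.2) (sweep B c 0 x) * δ) • sweep B c 0 x
        + (X.2 * Y.2 * lieForm 2 (deriv q x.2) (sweep B c 0 x) * ε) • sweep B c 1 x := by
    rw [hT (sweep B c 0) ⟨h.contDiffOn_sweep 0, ha⟩ _ rfl, hX, hY, h₁, h₂]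
    simp only [_root_.add_apply, _root_.smul_apply, map_sub, map_smul,
      zero_add, H.frameWedge_b, H.frameWedge_e]
    module
  have hTb : (T ⟨sweep B c 1 x, hb x hx⟩ : LieSpace 2) =
      (X.2 * Y.2 * lieForm 2 (deriv q x.2) (sweep B c 1 x) * δ
        - X.1 * Y.1 * (lieForm 2 (c 2 x.1) (c 2 x.1) * β)) • sweep B c 0 x
        + (X.2 * Y.2 * lieForm 2 (deriv q x.2) (sweep B c 1 x) * ε
        - X.1 * Y.1 * (lieForm 2 (c 2 x.1) (c 2 x.1) * γ)) • sweep B c 1 x := by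
    rw [hT (sweep B c 1) ⟨h.contDiffOn_sweep 1, hb⟩ _ rfl, hX, hY, h₁, h₂]
    simp only [_root_.add_apply, _root_.smul_apply, map_sub, map_smul,
      Nat.reduceAdd, H.frameWedge_n, H.frameWedge_e]
    module
  rw [trace_eq_add_of_pair (hspan x hx) H.linearIndependent T (ha x hx) (hb x hx) hTa hTb]
  ring

/-- A gauge potential of a swept surface yields a function `γ` on the generating curve and a
constant `ρ`, such that the third order equation of a polarised frame holds for the pairings with
all the vectors `B(v)⁻¹ q'(v)`. -/
theorem exists_polarisation (h : IsSweptFrame I₁ I₂ f q v₀ B c) (hI₁' : I₁.OrdConnected)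
    (hI₂ : IsOpen I₂) (hI₂' : I₂.OrdConnected) (hv₀ : v₀ ∈ I₂)
    (hq : IsUnitNormal I₁ I₂ f q) {η : ℝ × ℝ → ℝ × ℝ →L[ℝ] LieSpace 2 →L[ℝ] LieSpace 2}
    (hη : IsGaugePotential (I₁ ×ˢ I₂) f η) :
    ∃ (γ : ℝ → ℝ) (ρ : ℝ), ContDiffOn ℝ ∞ γ I₁ ∧ (ρ ≠ 0 ∨ ∃ u ∈ I₁, γ u ≠ 0) ∧
      ∀ u ∈ I₁, ∀ v ∈ I₂, 2 * γ u * lieForm 2 (deriv q v) (sweep B c 3 (u, v))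
        + 3 * deriv γ u * lieForm 2 (deriv q v) (sweep B c 2 (u, v))
        + (deriv (deriv γ) u - 2 * ρ) * lieForm 2 (deriv q v) (sweep B c 1 (u, v)) = 0 := by
  have hU : IsOpen (I₁ ×ˢ I₂) := h.isOpen.prod hI₂
  obtain ⟨x₀, hx₀, X, Y, k, hk0, hk⟩ := hη.quadDiff_ne_zero
  obtain ⟨α, β, γ, δ, ε, hα, hβ, hγ, hδ, hε, heq⟩ := h.exists_potential_coeff hI₂ hq hη
  have fst := fun {φ : ℝ × ℝ → ℝ} (hφ : ContDiffOn ℝ ∞ φ (I₁ ×ˢ I₂)) {u v : ℝ} (hu : u ∈ I₁)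
    (hv : v ∈ I₂) => show HasDerivAt (fun t => φ (t, v)) (du φ (u, v)) u from
      (hφ.differentiableAt_of_isOpen hU ⟨hu, hv⟩).hasDerivAt_fst
  have snd := fun {φ : ℝ × ℝ → ℝ} (hφ : ContDiffOn ℝ ∞ φ (I₁ ×ˢ I₂)) {u v : ℝ} (hu : u ∈ I₁)
    (hv : v ∈ I₂) => show HasDerivAt (fun t => φ (u, t)) (dv φ (u, v)) v from
      (hφ.differentiableAt_of_isOpen hU ⟨hu, hv⟩).hasDerivAt_snd
  -- `γ` and `α - β_u` do not depend on `v`.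
  have hγv : ∀ u ∈ I₁, ∀ v ∈ I₂, γ (u, v) = γ (u, v₀) := fun u hu v hv =>
    eq_of_hasDerivAt_zero hI₂' (F := fun t => γ (u, t)) (fun t ht =>
      (snd hγ hu ht).congr_deriv (heq (u, t) ⟨hu, ht⟩).2.2.1) v hv v₀ hv₀
  have hκv : ∀ u ∈ I₁, ∀ v ∈ I₂,
      α (u, v) - du β (u, v) = α (u, v₀) - du β (u, v₀) := fun u hu v hv =>
    eq_of_hasDerivAt_zero hI₂' (F := fun t => α (u, t) - du β (u, t)) (fun t ht =>
      ((snd hα hu ht).sub (snd (hβ.du hU) hu ht)).congr_deriv (by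
        rw [(heq (u, t) ⟨hu, ht⟩).2.2.2.2.2.2, dv_du_eq hU hβ ⟨hu, ht⟩, sub_self])) v hv v₀ hv₀
  have μ0 : ∀ u ∈ I₁, lieForm 2 (deriv q v₀) (sweep B c 0 (u, v₀)) = -1 := fun u hu => by
    rw [lieForm_comm, sweep, h.transport_init]
    exact h.norm u hu
  have μ1 : ∀ u ∈ I₁, lieForm 2 (deriv q v₀) (sweep B c 1 (u, v₀)) = 0 := fun u hu =>
    (h.hasDerivAt_lieForm_sweep _ 0 hu).eq_zero_of_eqOn_const h.isOpen hu μ0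
  have μ2 : ∀ u ∈ I₁, lieForm 2 (deriv q v₀) (sweep B c 2 (u, v₀)) = 0 := fun u hu =>
    (h.hasDerivAt_lieForm_sweep _ 1 hu).eq_zero_of_eqOn_const h.isOpen hu μ1
  -- Along `v = v₀`, where `μ = -1`, the function `α - β_u = -δ` is constant.
  have hδ₀ : ∀ u ∈ I₁, α (u, v₀) - du β (u, v₀) = -δ (u, v₀) := fun u hu => by
    have h1 : du ε (u, v₀) + du β (u, v₀) = 0 :=
      ((fst hε hu hv₀).add (fst hβ hu hv₀)).eq_zero_of_eqOn_const h.isOpen hu (k := 0)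
        fun t ht => by
          rw [Pi.add_apply, (heq (t, v₀) ⟨ht, hv₀⟩).2.2.2.1, μ0 t ht, μ1 t ht]; ring
    have h2 := (heq (u, v₀) ⟨hu, hv₀⟩).2.2.2.2.1
    rw [μ0 u hu, μ2 u hu] at h2
    linarith
  have hδc : ∀ u ∈ I₁, ∀ u' ∈ I₁, δ (u, v₀) = δ (u', v₀) :=
    eq_of_hasDerivAt_zero hI₁' (F := fun t => δ (t, v₀)) fun t ht =>
      (fst hδ ht hv₀).congr_deriv (by
        rw [(heq (t, v₀) ⟨ht, hv₀⟩).2.2.2.2.2.1, μ1 t ht, μ2 t ht]; ring)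
  set γ₀ : ℝ → ℝ := fun u => γ (u, v₀) with hγ₀
  obtain ⟨ρ, hρ⟩ : ∃ ρ, ρ = -δ (x₀.1, v₀) := ⟨_, rfl⟩
  have hαρ : ∀ u ∈ I₁, ∀ v ∈ I₂, α (u, v) = ρ + du β (u, v) := fun u hu v hv => by
    have := hκv u hu v hv
    rw [hδ₀ u hu, hδc u hu x₀.1 hx₀.1, ← hρ] at this
    linarith
  have γs : ContDiffOn ℝ ∞ γ₀ I₁ :=
    hγ.comp (contDiff_id.prodMk contDiff_const).contDiffOn fun t ht => ⟨ht, hv₀⟩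
  have dγ : ∀ u ∈ I₁, HasDerivAt γ₀ (deriv γ₀ u) u := fun u hu =>
    (γs.differentiableAt_of_isOpen h.isOpen hu).hasDerivAt
  have dγ' : ∀ u ∈ I₁, HasDerivAt (deriv γ₀) (deriv (deriv γ₀) u) u := fun u hu =>
    ((γs.deriv_of_isOpen (m := ∞) h.isOpen (by simp)).differentiableAt_of_isOpen
      h.isOpen hu).hasDerivAt
  have hε' : ∀ u ∈ I₁, ∀ v ∈ I₂, ε (u, v) = β (u, v) * lieForm 2 (deriv q v) (sweep B c 0 (u, v))
      + γ₀ u * lieForm 2 (deriv q v) (sweep B c 1 (u, v)) := fun u hu v hv => by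
    rw [(heq (u, v) ⟨hu, hv⟩).2.2.2.1, hγv u hu v hv]
  have hδ' : ∀ u ∈ I₁, ∀ v ∈ I₂, δ (u, v) = ρ * lieForm 2 (deriv q v) (sweep B c 0 (u, v))
      - (β (u, v) + deriv γ₀ u) * lieForm 2 (deriv q v) (sweep B c 1 (u, v))
      - 2 * γ₀ u * lieForm 2 (deriv q v) (sweep B c 2 (u, v)) := fun u hu v hv => by
    have d := fun i => h.hasDerivAt_lieForm_sweep (deriv q v) i (v := v) hu
    have h1 := (fst hε hu hv).sub (((fst hβ hu hv).mul (d 0)).add ((dγ u hu).mul (d 1)))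
    have h2 := h1.eq_zero_of_eqOn_const h.isOpen hu (k := 0) fun t ht => by
      simp only [Pi.sub_apply, Pi.add_apply, Pi.mul_apply, hε' t ht v hv, sub_self]
    have h3 := (heq (u, v) ⟨hu, hv⟩).2.2.2.2.1
    rw [hγv u hu v hv, hαρ u hu v hv] at h3
    simp only [zero_add, Nat.reduceAdd] at h2
    linear_combination h3 - h2
  refine ⟨γ₀, ρ, γs, ?_, fun u hu v hv => ?_⟩
  · by_contra! hcon
    obtain ⟨hρ0, hγ0⟩ := hcon
    refine hk0 ?_
    have hd : deriv γ₀ x₀.1 = 0 := (dγ x₀.1 hx₀.1).eq_zero_of_eqOn_const h.isOpen hx₀.1 hγ0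
    have e1 := hδ' x₀.1 hx₀.1 x₀.2 hx₀.2
    have e2 := hε' x₀.1 hx₀.1 x₀.2 hx₀.2
    rw [h.quadDiff_eq hI₂ hq hx₀ (heq x₀ hx₀).1 (heq x₀ hx₀).2.1 hk, e1, e2,
      hγv x₀.1 hx₀.1 x₀.2 hx₀.2, hd, hρ0, show γ (x₀.1, v₀) = 0 from hγ0 _ hx₀.1, hγ0 _ hx₀.1]
    ring
  · have d := fun i => h.hasDerivAt_lieForm_sweep (deriv q v) i (v := v) hu
    have h1 := (fst hδ hu hv).sub ((((d 0).const_mul ρ).sub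
      (((fst hβ hu hv).add (dγ' u hu)).mul (d 1))).sub (((dγ u hu).const_mul 2).mul (d 2)))
    have h2 := h1.eq_zero_of_eqOn_const h.isOpen hu (k := 0) fun t ht => by
      simp only [Pi.sub_apply, Pi.add_apply, Pi.mul_apply, hδ' t ht v hv]
      ring
    have h3 := (heq (u, v) ⟨hu, hv⟩).2.2.2.2.2.1
    rw [hαρ u hu v hv] at h3
    simp only [zero_add, Nat.reduceAdd, Pi.add_apply] at h2
    linear_combination h2 - h3

end IsSweptFrame

/-! ### Spherical parameter lines -/

/-- If a spacelike vector `r(u)`, depending on `u` only, is normal to `f`, then the `v`-parameter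
lines are spherical: one of the two null lines in the span of `r(u)` and a unit timelike vector
`p` that are orthogonal to `f ∩ p^⊥` serves as `ν`. -/
theorem hasSphericalLines_of_normal {I₁ I₂ : Set ℝ} {f : ℝ × ℝ → Submodule ℝ (LieSpace 2)}
    (hI₁ : IsOpen I₁) (hI₂ : IsOpen I₂) (hf : IsNullOn (I₁ ×ˢ I₂) f) {r : ℝ → LieSpace 2}
    (hr : ContDiffOn ℝ ∞ r I₁) (hpos : ∀ u ∈ I₁, 0 < lieForm 2 (r u) (r u))
    (hperp : ∀ u ∈ I₁, ∀ v ∈ I₂, ∀ a ∈ f (u, v), lieForm 2 a (r u) = 0) :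
    HasSphericalLines (I₁ ×ˢ I₂) f (0, 1) := by
  obtain ⟨p, hp⟩ : ∃ p : LieSpace 2, lieForm 2 p p = -1 :=
    ⟨Pi.single (Sum.inr 0) 1, by rw [lieForm_apply]; simp [Fin.sum_univ_succ]⟩
  set N : ℝ → ℝ := fun u => lieForm 2 (r u) (r u) + lieForm 2 (r u) p ^ 2 with hN
  have hNpos : ∀ u ∈ I₁, 0 < N u := fun u hu => by
    have := hpos u hu
    positivity
  set w : ℝ → LieSpace 2 := fun u => r u + (lieForm 2 (r u) p + Real.sqrt (N u)) • p with hw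
  have hws : ContDiffOn ℝ ∞ w I₁ := by
    have hrp : ContDiffOn ℝ ∞ (fun u => lieForm 2 (r u) p) I₁ := hr.lieForm contDiffOn_const
    have hNs : ContDiffOn ℝ ∞ N I₁ := (hr.lieForm hr).add (hrp.pow 2)
    exact hr.add ((hrp.add (hNs.sqrt fun u hu => (hNpos u hu).ne')).smul contDiffOn_const)
  have hwp : ∀ u, lieForm 2 (w u) p = -Real.sqrt (N u) := fun u => by
    simp only [hw, map_add, map_smul, LinearMap.add_apply, LinearMap.smul_apply, smul_eq_mul, hp]
    ring
  have hw0 : ∀ u ∈ I₁, w u ≠ 0 := fun u hu h0 => by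
    have h1 := hwp u
    rw [h0, map_zero, LinearMap.zero_apply, zero_eq_neg] at h1
    exact (Real.sqrt_pos.2 (hNpos u hu)).ne' h1
  have hww : ∀ u ∈ I₁, lieForm 2 (w u) (w u) = 0 := fun u hu => by
    have h1 := Real.sq_sqrt (hNpos u hu).le
    simp only [hw, map_add, map_smul, LinearMap.add_apply, LinearMap.smul_apply, smul_eq_mul, hp,
      lieForm_comm p (r u)]
    simp only [hN] at h1 ⊢
    linear_combination -h1
  refine ⟨p, hp, fun x => Submodule.span ℝ {w x.1}, ?_, ?_, ?_, ?_, ?_⟩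
  · intro x hx
    refine ⟨finrank_span_singleton (hw0 x.1 hx.1), I₁ ×ˢ I₂, hI₁.prod hI₂, hx, fun _ y => w y.1,
      fun _ => contDiffOn_comp_fst hws, fun y _ => ?_⟩
    rw [Set.range_const]
  · intro x hx a ha b hb
    obtain ⟨s, rfl⟩ := Submodule.mem_span_singleton.1 ha
    obtain ⟨t, rfl⟩ := Submodule.mem_span_singleton.1 hb
    simp [hww x.1 hx.1]
  · intro x _ t _
    simp
  · intro x hx a ha hap b hb
    obtain ⟨t, rfl⟩ := Submodule.mem_span_singleton.1 hb
    simp [hw, hap, hperp x.1 hx.1 x.2 hx.2 a ha]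
  · intro x hx
    rw [Submodule.disjoint_def]
    intro y hy hy'
    obtain ⟨z, hz, z', hz', rfl⟩ := Submodule.mem_sup.1 hy'
    obtain ⟨s, rfl⟩ := Submodule.mem_span_singleton.1 hz
    obtain ⟨t, rfl⟩ := Submodule.mem_span_singleton.1 hz'
    obtain ⟨k, hk⟩ : ∃ k, k = s * (lieForm 2 (r x.1) p + Real.sqrt (N x.1)) + t := ⟨_, rfl⟩
    have hsk : s • w x.1 + t • p = s • r x.1 + k • p := by
      simp only [hw, hk]; module
    rw [hsk] at hy ⊢
    have h1 := hperp x.1 hx.1 x.2 hx.2 _ hy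
    have h2 := hf x hx _ hy _ hy
    have hg := hpos x.1 hx.1
    simp only [map_add, map_smul, LinearMap.add_apply, LinearMap.smul_apply, smul_eq_mul, hp,
      lieForm_comm p (r x.1)] at h1 h2
    have h3 : k * (s * lieForm 2 (r x.1) p - k) = 0 := by linear_combination h2 - s * h1
    have hs : s = 0 := by
      rcases mul_eq_zero.1 h3 with h4 | h4
      · rw [h4] at h1
        exact (mul_eq_zero.1 (by linarith : s * lieForm 2 (r x.1) (r x.1) = 0)).resolve_right hg.ne'
      · have h5 : s * (lieForm 2 (r x.1) (r x.1) + lieForm 2 (r x.1) p ^ 2) = 0 := by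
          linear_combination h1 + lieForm 2 (r x.1) p * h4
        exact (mul_eq_zero.1 h5).resolve_right (hNpos x.1 hx.1).ne'
    rw [hs] at h3 ⊢
    have hk0 : k = 0 := by
      rw [zero_mul, zero_sub, mul_neg, neg_eq_zero, mul_self_eq_zero] at h3
      exact h3
    simp [hk0]

namespace IsSweptFrame

variable {I₁ I₂ : Set ℝ} {f : ℝ × ℝ → Submodule ℝ (LieSpace 2)} {q : ℝ → LieSpace 2} {v₀ : ℝ}
  {B : ℝ → LieSpace 2 →L[ℝ] LieSpace 2} {c : ℕ → ℝ → LieSpace 2}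

/-- If the `v`-parameter lines are not spherical, then `q''(v₀)` and `B(v₁)⁻¹ q'(v₁)`, for some
`v₁`, have independent pairings with the first two derivatives of the generating curve at some
point. Otherwise, the combination of these two derivatives annihilated by `q''(v₀)` is carried by
`B(v)` to a vector that does not depend on `v`. -/
theorem exists_ne_of_not_spherical (h : IsSweptFrame I₁ I₂ f q v₀ B c) (hI₂ : IsOpen I₂)
    (hI₂' : I₂.OrdConnected) (hv₀ : v₀ ∈ I₂) (hf : IsNullOn (I₁ ×ˢ I₂) f)
    (hnot : ¬ HasSphericalLines (I₁ ×ˢ I₂) f (0, 1)) :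
    ∃ v₁ ∈ I₂, ∃ u ∈ I₁,
      lieForm 2 (deriv (deriv q) v₀) (c 1 u) * lieForm 2 (deriv q v₁) (sweep B c 2 (u, v₁))
        - lieForm 2 (deriv (deriv q) v₀) (c 2 u) * lieForm 2 (deriv q v₁) (sweep B c 1 (u, v₁))
        ≠ 0 := by
  by_contra! hcon
  set φ : ℝ → ℝ := fun u =>
    lieForm 2 (deriv (deriv q) v₀) (c 2 u) / lieForm 2 (deriv (deriv q) v₀) (c 1 u) with hφ
  have hψ : ∀ u ∈ I₁, lieForm 2 (deriv (deriv q) v₀) (c 1 u) ≠ 0 := fun u hu => by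
    rw [lieForm_comm]; exact h.reg u hu
  have hφs : ContDiffOn ℝ ∞ φ I₁ :=
    ((contDiffOn_const.lieForm (h.smooth 2)).div (contDiffOn_const.lieForm (h.smooth 1)) hψ)
  have hU : IsOpen (I₁ ×ˢ I₂) := h.isOpen.prod hI₂
  have hconst : ∀ u ∈ I₁, ∀ v ∈ I₂,
      sweep B c 2 (u, v) - φ u • sweep B c 1 (u, v) = c 2 u - φ u • c 1 u := fun u hu v hv => by
    have h1 := eq_of_hasDerivAt_zero hI₂'
      (F := fun t => sweep B c 2 (u, t) - φ u • sweep B c 1 (u, t)) (fun t ht => by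
        have d := fun i => ((h.contDiffOn_sweep i).differentiableAt_of_isOpen hU
          (show (u, t) ∈ _ from ⟨hu, ht⟩)).hasDerivAt_snd
        refine ((d 2).sub ((d 1).const_smul (φ u))).congr_deriv ?_
        have e := fun i => h.dv_sweep hI₂ i (show (u, t) ∈ _ from ⟨hu, ht⟩)
        simp only [dv] at e
        rw [e 2, e 1, smul_smul, ← sub_smul]
        refine smul_eq_zero_of_left ?_ _
        have h2 := hcon t ht u hu
        have h3 := hψ u hu
        simp only [hφ]
        field_simp
        linear_combination -h2) v hv v₀ hv₀
    simpa [sweep, h.transport_init] using h1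
  refine hnot (hasSphericalLines_of_normal (r := fun u => c 2 u - φ u • c 1 u) h.isOpen hI₂ hf
    ((h.smooth 2).sub (hφs.smul (h.smooth 1))) (fun u hu => ?_) fun u hu v hv a ha => ?_)
  · have := h.pos_two u hu
    simpa [h.gram₁₂ hu, lieForm_comm (c 2 u) (c 1 u), h.null_one u hu] using this
  · rw [h.span u hu v hv] at ha
    obtain ⟨s, t, rfl⟩ := Submodule.mem_span_pair.1 ha
    rw [← hconst u hu v hv]
    have e := fun i j => h.lieForm_sweep (show (u, v) ∈ _ from ⟨hu, hv⟩) i j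
    simp only [sweep] at e ⊢
    simp [e, h.gram₀₁ hu, h.gram₀₂ hu, h.gram₁₂ hu, h.null_one u hu]

end IsSweptFrame

/-! ### The generating curve in `ℝ^{3,2}` -/

/-- Two unit spacelike vectors are related, up to sign, by a Lie sphere transformation. -/
theorem exists_isLieSphereTransformation_map_eq {n : ℕ} {a b : LieSpace n}
    (ha : lieForm n a a = 1) (hb : lieForm n b b = 1) :
    ∃ A : LieSpace n ≃ₗ[ℝ] LieSpace n, IsLieSphereTransformation A ∧ (A a = b ∨ A a = -b) := by
  have key : ∀ d : LieSpace n, lieForm n d d ≠ 0 → ∃ A : LieSpace n ≃ₗ[ℝ] LieSpace n,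
      IsLieSphereTransformation A ∧ ∀ z, A z = z - (2 / lieForm n d d * lieForm n d z) • d := by
    intro d hd
    have h2 : ((2 / lieForm n d d) • lieForm n d) d = 2 := by
      simp [hd]
    refine ⟨Module.reflection h2, fun x y => ?_, fun z => ?_⟩
    · simp only [Module.reflection_apply, LinearMap.smul_apply, smul_eq_mul, map_sub, map_smul,
        LinearMap.sub_apply, lieForm_comm x d]
      field_simp
      ring
    · simp [Module.reflection_apply]
  have hsub : lieForm n (a - b) (a - b) = 2 - 2 * lieForm n a b := by
    simp only [map_sub, LinearMap.sub_apply, ha, hb, lieForm_comm b a]; ring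
  have hadd : lieForm n (a + b) (a + b) = 2 + 2 * lieForm n a b := by
    simp only [map_add, LinearMap.add_apply, ha, hb, lieForm_comm b a]; ring
  by_cases h : lieForm n a b = 1
  · obtain ⟨A, hA, hAz⟩ := key (a + b) (by rw [hadd, h]; norm_num)
    refine ⟨A, hA, Or.inr ?_⟩
    rw [hAz, hadd, map_add, LinearMap.add_apply, ha, lieForm_comm b a, h]
    norm_num
  · have hne : lieForm n (a - b) (a - b) ≠ 0 := fun h0 => h (by linarith)
    obtain ⟨A, hA, hAz⟩ := key (a - b) hne
    refine ⟨A, hA, Or.inl ?_⟩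
    have : 2 / lieForm n (a - b) (a - b) * lieForm n (a - b) a = 1 := by
      rw [hsub, map_sub, LinearMap.sub_apply, ha, lieForm_comm b a]
      rw [hsub] at hne
      field_simp
    rw [hAz, this]
    simp

/-- The coordinate projection adjoint to `lieInclusion`. -/
noncomputable def lieRestriction (n : ℕ) : LieSpace (n + 1) →ₗ[ℝ] LieSpace n :=
  LinearMap.funLeft ℝ ℝ (Sum.map Fin.castSucc id)

theorem lieForm_lieRestriction {n : ℕ} (z : LieSpace (n + 1)) (y : LieSpace n) :
    lieForm n (lieRestriction n z) y = lieForm (n + 1) z (lieInclusion n y) := by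
  rw [lieForm_apply, lieForm_apply, Fin.sum_univ_castSucc (n := n + 2)]
  simp [lieRestriction, lieInclusion, LinearMap.funLeft_apply]

theorem lieInclusion_lieRestriction {n : ℕ} {z : LieSpace (n + 1)}
    (hz : lieForm (n + 1) z (Pi.single (Sum.inl (Fin.last (n + 2))) 1) = 0) :
    lieInclusion n (lieRestriction n z) = z := by
  have h0 : z (Sum.inl (Fin.last (n + 2))) = 0 := by
    rw [lieForm_apply] at hz
    simpa [Pi.single_apply] using hz
  ext (j | j)
  · induction j using Fin.lastCases with
    | last => simp [lieInclusion, h0]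
    | cast j => simp [lieInclusion, lieRestriction, LinearMap.funLeft_apply]
  · simp [lieInclusion, lieRestriction, LinearMap.funLeft_apply]

/-- An isometry of `ℝ^{n+2,2}` onto the orthogonal complement of a unit spacelike vector, extended
to a Lie sphere transformation, and the adjoint projection. -/
theorem exists_lieSphereTransformation_onto_perp {n : ℕ} {e : LieSpace (n + 1)}
    (he : lieForm (n + 1) e e = 1) :
    ∃ (A : LieSpace (n + 1) ≃ₗ[ℝ] LieSpace (n + 1)) (π : LieSpace (n + 1) →ₗ[ℝ] LieSpace n),
      IsLieSphereTransformation A ∧ (∀ z, lieForm (n + 1) z e = 0 → A (lieInclusion n (π z)) = z) ∧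
      ∀ z y, lieForm n (π z) y = lieForm (n + 1) z (A (lieInclusion n y)) := by
  obtain ⟨A, hA, hAe⟩ := exists_isLieSphereTransformation_map_eq (n := n + 1)
    (a := Pi.single (Sum.inl (Fin.last (n + 2))) 1) (b := e)
    (by rw [lieForm_apply]; simp [Pi.single_apply]) he
  refine ⟨A, (lieRestriction n).comp A.symm.toLinearMap, hA, fun z hz => ?_, fun z y => ?_⟩
  · rw [LinearMap.comp_apply, LinearEquiv.coe_coe, lieInclusion_lieRestriction,
      LinearEquiv.apply_symm_apply]
    rw [← hA, LinearEquiv.apply_symm_apply]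
    rcases hAe with h | h <;> simp [h, hz]
  · rw [LinearMap.comp_apply, LinearEquiv.coe_coe, lieForm_lieRestriction, ← hA,
      LinearEquiv.apply_symm_apply]

namespace IsSweptFrame

variable {I₁ I₂ : Set ℝ} {f : ℝ × ℝ → Submodule ℝ (LieSpace 2)} {q : ℝ → LieSpace 2} {v₀ : ℝ}
  {B : ℝ → LieSpace 2 →L[ℝ] LieSpace 2} {c : ℕ → ℝ → LieSpace 2}

theorem injective_transport (h : IsSweptFrame I₁ I₂ f q v₀ B c) {v : ℝ} (hv : v ∈ I₂) :
    Function.Injective (B v) := by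
  rw [injective_iff_map_eq_zero]
  intro x hx
  refine eq_zero_of_forall_lieForm fun y => ?_
  rw [← h.isometry v hv, hx]
  simp

/-- At `v₀`, the pairings of `q'(v)` with the moving frame differentiate to those of `q''(v₀)`
with the generating curve, because `q'` is orthogonal to `q`. Hence `q''(v₀)` satisfies every linear
equation with coefficients depending on `u` that all `q'(v)` satisfy. -/
theorem hasDerivAt_form_deriv (h : IsSweptFrame I₁ I₂ f q v₀ B c) (hI₂ : IsOpen I₂)
    (hq : IsUnitNormal I₁ I₂ f q) (hv₀ : v₀ ∈ I₂) (i : ℕ) {u : ℝ} (hu : u ∈ I₁) :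
    HasDerivAt (fun v => lieForm 2 (deriv q v) (sweep B c i (u, v)))
      (lieForm 2 (deriv (deriv q) v₀) (c i u)) v₀ := by
  have hx : (u, v₀) ∈ I₁ ×ˢ I₂ := ⟨hu, hv₀⟩
  have hq1 : ContDiffOn ℝ ∞ (deriv q) I₂ := hq.smooth.deriv_of_isOpen hI₂ (by simp)
  have d0 := (hq.smooth.differentiableAt_of_isOpen hI₂ hv₀).hasDerivAt
  have d1 := (hq1.differentiableAt_of_isOpen hI₂ hv₀).hasDerivAt
  have ds : HasDerivAt (fun v => sweep B c i (u, v)) (dv (sweep B c i) (u, v₀)) v₀ :=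
    ((h.contDiffOn_sweep i).differentiableAt_of_isOpen (h.isOpen.prod hI₂) hx).hasDerivAt_snd
  refine (d1.lieForm ds).congr_deriv ?_
  have h0 := (d0.lieForm d0).eq_zero_of_eqOn_const hI₂ hv₀ hq.unit
  rw [lieForm_comm (q v₀)] at h0
  rw [h.dv_sweep hI₂ i hx, map_smul, show lieForm 2 (deriv q v₀) (q v₀) = 0 by linarith]
  simp [sweep, h.transport_init]

/-- The curve is the frame `c`, read in `ℝ^{3,2} ≅ q(v₀)^⊥`, and `W₀` is spanned by `q'(v₀)`,
`q''(v₀)` and `B(v₁)⁻¹ q'(v₁)` for a suitable `v₁`. -/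
theorem exists_constrainedElastic (h : IsSweptFrame I₁ I₂ f q v₀ B c) (hI₁' : I₁.OrdConnected)
    (hI₂ : IsOpen I₂) (hI₂' : I₂.OrdConnected) (hv₀ : v₀ ∈ I₂) (hq : IsUnitNormal I₁ I₂ f q)
    (hf : IsLieApplicable (I₁ ×ˢ I₂) f)
    (hnot : ¬ HasSphericalLines (I₁ ×ˢ I₂) f (0, 1)) :
    ∃ (C : ℝ → Submodule ℝ (LieSpace 1)) (W₀ : Submodule ℝ (LieSpace 1)),
      IsLegendreMap I₁ C ∧
      IsConstrainedElasticWrt I₁ C W₀ ∧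
      (∃ p ∈ W₀, ∃ q ∈ W₀, ProjectsToConstrainedElastic I₁ C p q) ∧
      ∀ v ∈ I₂, ∃ A : LieSpace 2 ≃ₗ[ℝ] LieSpace 2, IsLieSphereTransformation A ∧
        ∀ u ∈ I₁, f (u, v) = ((C u).map (lieInclusion 1)).map A.toLinearMap := by
  obtain ⟨hleg, η, hη⟩ := hf
  obtain ⟨γ, ρ, hγ, hne, hode⟩ := h.exists_polarisation hI₁' hI₂ hI₂' hv₀ hq hη
  obtain ⟨v₁, hv₁, u₁, hu₁, hω⟩ :=
    h.exists_ne_of_not_spherical hI₂ hI₂' hv₀ hleg.isotropic hnot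
  obtain ⟨A, π, hA, hAπ, hπ⟩ := exists_lieSphereTransformation_onto_perp (n := 1)
    (hq.unit v₀ hv₀)
  have hπi : ∀ i, ∀ u ∈ I₁, A (lieInclusion 1 (π (c i u))) = c i u := fun i u hu =>
    hAπ _ (h.normal i u hu)
  have hform : ∀ z i, ∀ u ∈ I₁, lieForm 1 (π z) (π (c i u)) = lieForm 2 z (c i u) :=
    fun z i u hu => by rw [hπ, hπi i u hu]
  let πL : LieSpace 2 →L[ℝ] LieSpace 1 := LinearMap.toContinuousLinearMap π
  have hfr : IsLegendreFrame I₁ fun i u => π (c i u) :=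
    { isOpen := h.isOpen
      hasDerivAt := fun i u hu => πL.hasFDerivAt.comp_hasDerivAt u (h.hasDerivAt i u hu)
      smooth := fun i => πL.contDiff.comp_contDiffOn (h.smooth i)
      null_zero := fun u hu => by rw [hform _ _ u hu, h.null_zero u hu]
      null_one := fun u hu => by rw [hform _ _ u hu, h.null_one u hu]
      pos_two := fun u hu => by rw [hform _ _ u hu]; exact h.pos_two u hu }
  obtain ⟨e₃, he₃⟩ := LinearMap.surjective_of_injective (f := (B v₁).toLinearMap)
    (h.injective_transport hv₁) (deriv q v₁)
  have he₃c : ∀ i u, lieForm 2 e₃ (c i u) = lieForm 2 (deriv q v₁) (sweep B c i (u, v₁)) :=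
    fun i u => by
      rw [← he₃, sweep, ContinuousLinearMap.coe_coe, h.isometry v₁ hv₁]
  have hsweep : ∀ i u, sweep B c i (u, v₀) = c i u := fun i u => by
    simp [sweep, h.transport_init]
  -- The third order equation, for the three vectors that span `W₀`.
  let L : ℝ → LieSpace 2 → ℝ := fun u m => 2 * γ u * lieForm 2 m (c 3 u)
    + 3 * deriv γ u * lieForm 2 m (c 2 u)
    + (deriv (deriv γ) u - 2 * ρ) * lieForm 2 m (c 1 u)
  have ode₁ : ∀ u ∈ I₁, L u (deriv q v₀) = 0 := fun u hu => by
    have := hode u hu v₀ hv₀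
    simpa only [hsweep] using this
  have ode₂ : ∀ u ∈ I₁, L u (deriv (deriv q) v₀) = 0 := fun u hu => by
    have d := fun i => h.hasDerivAt_form_deriv hI₂ hq hv₀ i hu
    exact ((((d 3).const_mul (2 * γ u)).add ((d 2).const_mul (3 * deriv γ u))).add
      ((d 1).const_mul (deriv (deriv γ) u - 2 * ρ))).eq_zero_of_eqOn_const hI₂ hv₀ (hode u hu)
  have ode₃ : ∀ u ∈ I₁, L u e₃ = 0 := fun u hu => by
    have := hode u hu v₁ hv₁
    simpa only [L, he₃c] using this
  have hpol : IsPolarisedFrame I₁ (fun i u => π (c i u)) (fun i => iteratedDeriv i γ) ρ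
      (Submodule.span ℝ {π (deriv q v₀), π (deriv (deriv q) v₀), π e₃}) :=
    { hfr with
      ordConnected := hI₁'
      hasDerivAt_coeff := fun i u hu => hγ.hasDerivAt_iteratedDeriv h.isOpen i hu
      smooth_coeff := fun i => hγ.iteratedDeriv_of_isOpen h.isOpen i
      ode := fun m hm u hu => by
        obtain ⟨x, y, z, rfl⟩ := Submodule.mem_span_triple.1 hm
        have h1 := ode₁ u hu
        have h2 := ode₂ u hu
        have h3 := ode₃ u hu
        simp only [L] at h1 h2 h3
        simp only [map_add, map_smul, LinearMap.add_apply, LinearMap.smul_apply, smul_eq_mul,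
          hform _ _ u hu, iteratedDeriv_zero, iteratedDeriv_succ]
        linear_combination x * h1 + y * h2 + z * h3 }
  obtain ⟨hce, hproj⟩ := hpol.exists_constrainedElastic
    (fun u hu => by rw [hform _ _ u hu, lieForm_comm]; exact h.norm u hu)
    (fun u hu => by rw [hform _ _ u hu, lieForm_comm]; exact h.reg u hu)
    ⟨u₁, hu₁, by
      rw [hform _ _ u₁ hu₁, hform _ _ u₁ hu₁, hform _ _ u₁ hu₁, hform _ _ u₁ hu₁, he₃c, he₃c]
      exact hω⟩
    (by simpa using hne)
  refine ⟨_, _, hfr.isLegendreMap, hce, hproj, fun v hv => ?_⟩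
  let Bv : LieSpace 2 ≃ₗ[ℝ] LieSpace 2 :=
    LinearEquiv.ofInjectiveEndo (B v).toLinearMap (h.injective_transport hv)
  refine ⟨A.trans Bv, fun x y => ?_, fun u hu => ?_⟩
  · exact (h.isometry v hv _ _).trans (hA x y)
  · rw [h.span u hu v hv, Submodule.map_span, Submodule.map_span, Set.image_pair, Set.image_pair]
    have := fun i => congrArg (B v) (hπi i u hu)
    congr 2
    · exact (this 0).symm
    · congr 1
      exact (this 1).symm

end IsSweptFrame

theorem mainTheorem5 (I₁ I₂ : Set ℝ)
    (hI₁ : IsOpen I₁) (hI₁' : I₁.OrdConnected) (hI₂ : IsOpen I₂) (hI₂' : I₂.OrdConnected)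
    (f s₁ s₂ : ℝ × ℝ → Submodule ℝ (LieSpace 2))
    (hf : IsLieApplicable (I₁ ×ˢ I₂) f)
    (hcurv : IsCurvatureLineParametrisation (I₁ ×ˢ I₂) f s₁ s₂)
    (hreg₁ : IsImmersedBundle (I₁ ×ˢ I₂) s₁) (hreg₂ : IsImmersedBundle (I₁ ×ˢ I₂) s₂)
    (hsph : HasSphericalLines (I₁ ×ˢ I₂) f (1, 0))
    (hnot : ¬ HasSphericalLines (I₁ ×ˢ I₂) f (0, 1)) :
    ∃ (C : ℝ → Submodule ℝ (LieSpace 1)) (W₀ : Submodule ℝ (LieSpace 1)),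
      IsLegendreMap I₁ C ∧
      IsConstrainedElasticWrt I₁ C W₀ ∧
      (∃ p ∈ W₀, ∃ q ∈ W₀, ProjectsToConstrainedElastic I₁ C p q) ∧
      ∀ v ∈ I₂, ∃ A : LieSpace 2 ≃ₗ[ℝ] LieSpace 2, IsLieSphereTransformation A ∧
        ∀ u ∈ I₁, f (u, v) = ((C u).map (lieInclusion 1)).map A.toLinearMap := by
  obtain ⟨η, hη⟩ := hf.2
  obtain ⟨x₀, hx₀, -⟩ := hη.quadDiff_ne_zero
  obtain ⟨q, hqs, hq1, hqf⟩ :=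
    exists_unit_normal hI₁ hI₁' hI₂ ⟨x₀.1, hx₀.1⟩ hf.1 hcurv hreg₁ hsph
  have hq : IsUnitNormal I₁ I₂ f q := ⟨hqs, hq1, hqf⟩
  obtain ⟨s, hs⟩ := hq.exists_normalisedLift hI₁ hI₂ hf.1 hcurv hreg₁ hreg₂
  obtain ⟨B, c, hB⟩ := hs.exists_isSweptFrame hI₁ hI₂ hI₂' hq hf.1 ⟨x₀.1, hx₀.1⟩ hx₀.2
  exact hB.exists_constrainedElastic hI₁' hI₂ hI₂' hx₀.2 hq hf hnot
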